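/- **Model.** Let $\beta,h,\lambda\in\mathbb R$. For $N\ge 1$ let $J=(J_{ij})_{1\le i,j\le N}$ be independent standard Gaussian variables, let $\mathbb E_z$ be the average over $z=(z_1,\dots,z_N)$ with the standard Gaussian law on $\mathbb R^N$, and put $$Z_N=\mathbb E_z\exp\Big(\tfrac{\beta}{\sqrt{2N}}\sum_{i,j=1}^N J_{ij}z_iz_j+\beta h\sum_i z_i-\tfrac{\beta^2}{4N}\big(\sum_i z_i^2\big)^2+\tfrac{\lambda}{2}\sum_i z_i^2\Big),\qquad A_N=\tfrac1N\,\mathbb E\log Z_N .$$ **Order parameter.** Let $K\ge1$, $0=q_0\le q_1\le\dots\le q_K=Q$ and $0=m_0\le m_1\le\dots\le m_K\le m_{K+1}=1$, which encode the piecewise constant nondecreasing function $x(q)=m_a$ for $q_{a-1}<q<q_a$. Assume $$1-\lambda+\beta^2\int_0^Q(1-x(q))\,dq>0,\qquad \int_0^Q(1-x)\,dq=\sum_{a=1}^K(1-m_a)(q_a-q_{a-1})$$ (automatic if $\lambda<1$). **Interpolation.** Let $J^a_i$ ($1\le a\le K$, $1\le i\le N$) be further independent standard Gaussian variables, independent of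 $J$, and for $t\in[0,1]$ let $$B_t(z)=\exp\Big(\beta\sqrt{\tfrac{t}{2N}}\sum_{i,j}J_{ij}z_iz_j-\tfrac{t\beta^2}{4N}\big(\sum_i z_i^2\big)^2+\beta\sqrt{1-t}\sum_{a=1}^K\sqrt{q_a-q_{a-1}}\sum_iJ^a_iz_i-(1-t)\tfrac{\beta^2Q}{2}\sum_iz_i^2+\beta h\sum_iz_i+\tfrac\lambda2\sum_iz_i^2\Big).$$ Let $\mathbb E_0$ be the average over $J$, $\mathbb E_a$ the average over $(J^a_i)_i$, and $\mathbb E=\mathbb E_0\mathbb E_1\cdots\mathbb E_K$. Define $Z_K=\mathbb E_zB_t(z)$ and $Z_{a-1}=(\mathbb E_aZ_a^{m_a})^{1/m_a}$ for $a=K,\dots,1$ (read as $\exp(\mathbb E_a\log Z_a)$ if $m_a=0$), and $\varphi_N(t;x)=\frac1N\mathbb E_0\log Z_0$. Put $f_a=Z_a^{m_a}/\mathbb E_aZ_a^{m_a}$, $\omega(O)=\mathbb E_z[O\,B_t]/\mathbb E_z[B_t]$, $\tilde\omega_a(O)=\mathbb E_{a+1}\cdots\mathbb E_K(f_{a+1}\cdots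 f_K\,\omega(O))$ for $0\le a\le K$ (so $\tilde\omega_K=\omega$), $\tilde\Omega_a=\tilde\omega_a\otimes\tilde\omega_a$ acting on two replicas $z^{(1)},z^{(2)}$ subject to the same noise, $\langle F\rangle_a=\mathbb E(f_1\cdots f_a\tilde\Omega_a(F))$ (which depends on $t$ and $N$), and $q_{12}=\frac1N\sum_iz^{(1)}_iz^{(2)}_i$. **Theorem.** The integrals over $z$, over the noises and over $t$ that define $A_N$, $\varphi_N(t;x)$ ($0\le t\le1$) and the error term below converge, and for every $N\ge1$ $$A_N=\varphi_N(0;x)+\frac{\beta^2}{4}\sum_{a=1}^K(m_{a+1}-m_a)q_a^2-\frac{\beta^2}{4}\sum_{a=0}^K(m_{a+1}-m_a)\int_0^1\langle(q_{12}-q_a)^2\rangle_a\,dt .$$ Moreover $A=\lim_{N\to\infty}A_N$ exists in $\mathbb R$, $\varphi_N(0;x)=\varphi(0;x)$ does not depend on $N\ge1$, the error term converges as $N\to\infty$, and $$A=\varphi(0;x)+\frac{\beta^2}{4}\sum_{a=1}^K(m_{a+1}-m_a)q_a^2-\lim_{N\to\infty}\frac{\beta^2}{4}\sum_{a=0}^K(m_{a+1}-m_a)\int_0^1\langle(q_{12}-q_a)^2\rangle_a\,dt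 .$$ Consequently $$A\le\varphi(0;x)+\frac{\beta^2}{4}\sum_{a=1}^K(m_{a+1}-m_a)q_a^2 .$$ -/

import Mathlib

open MeasureTheory ProbabilityTheory Filter Topology

noncomputable section

namespace GaussianSpinGlass

/-- Configurations of `N` real spins (also used for one family of site noises `(J_i)_i`). -/
abbrev Spins (N : ℕ) := Fin N → ℝ

/-- Realizations of the couplings `J_{ij}`, for all ordered pairs `(i, j)`. -/
abbrev Couplings (N : ℕ) := Fin N → Fin N → ℝ

/-- Realizations of the auxiliary noises `J^a_i`; only the levels `a = 1, …, K` are used. -/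
abbrev Fields (N : ℕ) := ℕ → Spins N

/-- The standard Gaussian measure on `ℝ^N`. -/
def spinMeasure (N : ℕ) : Measure (Spins N) := Measure.pi fun _ => gaussianReal 0 1

/-- The law of the couplings: `N²` independent standard Gaussian variables. -/
def couplingMeasure (N : ℕ) : Measure (Couplings N) :=
  Measure.pi fun _ => Measure.pi fun _ => gaussianReal 0 1

/-- The Hamiltonian `H_N(z, J)` with external field `h`. -/
def hamiltonian {N : ℕ} (h : ℝ) (J : Couplings N) (z : Spins N) : ℝ :=
  -(1 / Real.sqrt (2 * N)) * (∑ i, ∑ j, J i j * z i * z j) - h * ∑ i, z i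

/-- The regularized partition function `Z_N(β, J, λ)`. -/
def partitionFunction {N : ℕ} (β h lam : ℝ) (J : Couplings N) : ℝ :=
  ∫ z, Real.exp (-β * hamiltonian h J z - β ^ 2 / (4 * N) * (∑ i, z i ^ 2) ^ 2
    + lam / 2 * ∑ i, z i ^ 2) ∂(spinMeasure N)

/-- The finite volume pressure `A_N = N⁻¹ E log Z_N`. -/
def pressure (β h lam : ℝ) (N : ℕ) : ℝ :=
  (1 / (N : ℝ)) * ∫ J, Real.log (partitionFunction β h lam J) ∂(couplingMeasure N)

/-- A piecewise constant functional order parameter: `K ≥ 1` steps,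
`0 = q_0 ≤ q_1 ≤ … ≤ q_K = Q` and `0 = m_0 ≤ m_1 ≤ … ≤ m_K ≤ m_{K+1} = 1`, encoding the
nondecreasing function `x(q) = m_a` for `q_{a-1} < q < q_a`.
Values of `q` beyond `K` and of `m` beyond `K + 1` are never used. -/
structure OrderParameter where
  K : ℕ
  one_le_K : 1 ≤ K
  q : ℕ → ℝ
  m : ℕ → ℝ
  q_zero : q 0 = 0
  q_mono : ∀ a < K, q a ≤ q (a + 1)
  m_zero : m 0 = 0
  m_last : m (K + 1) = 1
  m_mono : ∀ a ≤ K, m a ≤ m (a + 1)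

/-- The right end point `Q = q_K`. -/
def OrderParameter.Q (x : OrderParameter) : ℝ := x.q x.K

/-- `∫_0^Q (1 - x(q)) dq = ∑_{a=1}^K (1 - m_a) (q_a - q_{a-1})`. -/
def OrderParameter.gap (x : OrderParameter) : ℝ :=
  ∑ a ∈ Finset.range x.K, (1 - x.m (a + 1)) * (x.q (a + 1) - x.q a)

variable {N : ℕ}

/-- The interpolating Boltzmann factor, with the Lagrange multiplier `C = -β² Q`. -/
def boltzmann (β h lam : ℝ) (x : OrderParameter) (t : ℝ) (J : Couplings N) (g : Fields N)
    (z : Spins N) : ℝ :=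
  Real.exp (β * Real.sqrt (t / (2 * N)) * (∑ i, ∑ j, J i j * z i * z j)
    - t * (β ^ 2 / (4 * N)) * (∑ i, z i ^ 2) ^ 2
    + β * Real.sqrt (1 - t) *
        ∑ a ∈ Finset.range x.K, Real.sqrt (x.q (a + 1) - x.q a) * ∑ i, g (a + 1) i * z i
    + (1 - t) * (-(β ^ 2 * x.Q) / 2) * ∑ i, z i ^ 2
    + β * h * ∑ i, z i + lam / 2 * ∑ i, z i ^ 2)

/-- The interpolating partition function `Z̃_N(t; x)`. -/
def interpZ (β h lam : ℝ) (x : OrderParameter) (t : ℝ) (J : Couplings N) (g : Fields N) : ℝ :=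
  ∫ z, boltzmann β h lam x t J g z ∂(spinMeasure N)

/-- `E_a`: the average over the noises `J^a_i`, `i = 1, …, N`, of one level `a`. -/
def levelAvg (a : ℕ) (F : Fields N → ℝ) (g : Fields N) : ℝ :=
  ∫ y, F (Function.update g a y) ∂(spinMeasure N)

/-- `E_{a+1} E_{a+2} ⋯ E_{a+n}`. -/
def levelsAvg : ℕ → ℕ → (Fields N → ℝ) → Fields N → ℝ
  | _, 0, F => F
  | a, n + 1, F => levelAvg (a + 1) (levelsAvg (a + 1) n F)

/-- `(E_a F^m)^{1/m}`, read as its limit `exp (E_a log F)` when `m = 0`. -/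
def levelPow (m : ℝ) (a : ℕ) (F : Fields N → ℝ) (g : Fields N) : ℝ :=
  if m = 0 then Real.exp (levelAvg a (fun g' => Real.log (F g')) g)
  else (levelAvg a (fun g' => F g' ^ m) g) ^ (1 / m)

/-- Auxiliary recursion for `Z_a`, with `n = K - a` levels above `a` to be averaged. -/
def levelZAux (β h lam : ℝ) (x : OrderParameter) (t : ℝ) (J : Couplings N) :
    ℕ → ℕ → Fields N → ℝ
  | _, 0 => interpZ β h lam x t J
  | a, n + 1 => levelPow (x.m (a + 1)) (a + 1) (levelZAux β h lam x t J (a + 1) n)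

/-- The random variables `Z_K = Z̃_N`, `Z_{a-1} = (E_a Z_a^{m_a})^{1/m_a}`. -/
def levelZ (β h lam : ℝ) (x : OrderParameter) (t : ℝ) (J : Couplings N) (a : ℕ) :
    Fields N → ℝ :=
  levelZAux β h lam x t J a (x.K - a)

/-- `φ_N(t; x) = N⁻¹ E_0 log Z_0`. Since `Z_0` no longer depends on the noises `J^a_i`, it is
evaluated at `J^a_i = 0`. -/
def phi (β h lam : ℝ) (x : OrderParameter) (N : ℕ) (t : ℝ) : ℝ :=
  (1 / (N : ℝ)) * ∫ J, Real.log (levelZ β h lam x t J 0 0) ∂(couplingMeasure N)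

/-- The weights `f_a = Z_a^{m_a} / E_a Z_a^{m_a}`, `a = 1, …, K`. -/
def weight (β h lam : ℝ) (x : OrderParameter) (t : ℝ) (J : Couplings N) (a : ℕ)
    (g : Fields N) : ℝ :=
  levelZ β h lam x t J a g ^ x.m a /
    levelAvg a (fun g' => levelZ β h lam x t J a g' ^ x.m a) g

/-- The Boltzmann state `ω`. -/
def state (β h lam : ℝ) (x : OrderParameter) (t : ℝ) (J : Couplings N) (g : Fields N)
    (O : Spins N → ℝ) : ℝ :=
  (∫ z, O z * boltzmann β h lam x t J g z ∂(spinMeasure N)) / interpZ β h lam x t J g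

/-- The states `ω̃_a(O) = E_{a+1} ⋯ E_K (f_{a+1} ⋯ f_K ω(O))`, `a = 0, …, K`. -/
def levelState (β h lam : ℝ) (x : OrderParameter) (t : ℝ) (J : Couplings N) (a : ℕ)
    (g : Fields N) (O : Spins N → ℝ) : ℝ :=
  levelsAvg a (x.K - a)
    (fun g' => (∏ b ∈ Finset.Ioc a x.K, weight β h lam x t J b g')
      * state β h lam x t J g' O) g

/-- The two-replica product state `Ω̃_a = ω̃_a ⊗ ω̃_a` (same noise for both replicas). -/
def replicaState (β h lam : ℝ) (x : OrderParameter) (t : ℝ) (J : Couplings N) (a : ℕ)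
    (g : Fields N) (F : Spins N → Spins N → ℝ) : ℝ :=
  levelState β h lam x t J a g fun z₁ => levelState β h lam x t J a g fun z₂ => F z₁ z₂

/-- The average `⟨F⟩_a = E (f_1 ⋯ f_a Ω̃_a(F))` at time `t`, where `E = E_0 E_1 ⋯ E_K`. -/
def bracket (β h lam : ℝ) (x : OrderParameter) (t : ℝ) (a : ℕ)
    (F : Spins N → Spins N → ℝ) : ℝ :=
  ∫ J, levelsAvg 0 x.K
    (fun g => (∏ b ∈ Finset.Ioc 0 a, weight β h lam x t J b g)
      * replicaState β h lam x t J a g F) 0 ∂(couplingMeasure N)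

/-- The overlap `q_{12} = N⁻¹ ∑ z^{(1)}_i z^{(2)}_i`. -/
def overlap (z₁ z₂ : Spins N) : ℝ := (1 / (N : ℝ)) * ∑ i, z₁ i * z₂ i

/-- The fluctuation `⟨(q_{12} - q_a)²⟩_a` at time `t` for `N` spins. -/
def fluctuation (β h lam : ℝ) (x : OrderParameter) (N a : ℕ) (t : ℝ) : ℝ :=
  bracket (N := N) β h lam x t a fun z₁ z₂ => (overlap z₁ z₂ - x.q a) ^ 2

/-- `(β²/4) ∑_{a=1}^K (m_{a+1} - m_a) q_a²`; a term `a = 0` would vanish since `q_0 = 0`. -/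
def squareTerm (β : ℝ) (x : OrderParameter) : ℝ :=
  β ^ 2 / 4 * ∑ a ∈ Finset.Icc 1 x.K, (x.m (a + 1) - x.m a) * x.q a ^ 2

/-- `(β²/4) ∑_{a=0}^K (m_{a+1} - m_a) ∫_0^1 ⟨(q_{12} - q_a)²⟩_a dt`. -/
def errorTerm (β h lam : ℝ) (x : OrderParameter) (N : ℕ) : ℝ :=
  β ^ 2 / 4 * ∑ a ∈ Finset.Icc 0 x.K, (x.m (a + 1) - x.m a) *
    ∫ t in (0 : ℝ)..1, fluctuation β h lam x N a t

/-- The integrals that define `A_N`, `φ_N(t; x)` and the error term converge. -/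
def IntegralsConverge (β h lam : ℝ) (x : OrderParameter) (N : ℕ) : Prop :=
  Integrable (fun J => Real.log (partitionFunction β h lam J)) (couplingMeasure N) ∧
  (∀ t ∈ Set.Icc (0 : ℝ) 1, ∀ (J : Couplings N) (g : Fields N),
    Integrable (boltzmann β h lam x t J g) (spinMeasure N) ∧
    ∀ a ∈ Finset.Icc 1 x.K,
      Integrable (fun y => levelZ β h lam x t J a (Function.update g a y) ^ x.m a)
        (spinMeasure N) ∧
      Integrable (fun y => Real.log (levelZ β h lam x t J a (Function.update g a y)))
        (spinMeasure N)) ∧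
  (∀ t ∈ Set.Icc (0 : ℝ) 1,
    Integrable (fun J => Real.log (levelZ β h lam x t J 0 0)) (couplingMeasure N)) ∧
  ∀ a ∈ Finset.Icc 0 x.K, x.m a < x.m (a + 1) →
    IntervalIntegrable (fluctuation β h lam x N a) volume 0 1

end GaussianSpinGlass

end

set_option linter.unusedSectionVars false

noncomputable section

namespace GaussianSpinGlass

/-! ### Gaussian product measures -/

/-- The standard Gaussian measure on `ι → ℝ`. -/
abbrev gaussPi (ι : Type*) [Fintype ι] : Measure (ι → ℝ) := Measure.pi fun _ => gaussianReal 0 1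

lemma integrable_gaussianReal_iff {f : ℝ → ℝ} :
    Integrable f (gaussianReal 0 1) ↔ Integrable (fun y => gaussianPDFReal 0 1 y * f y) := by
  rw [gaussianReal_of_var_ne_zero _ one_ne_zero]
  have := integrable_withDensity_iff_integrable_smul' (μ := volume) (f := gaussianPDF 0 1)
    (measurable_gaussianPDF 0 1) (ae_of_all _ fun _ => gaussianPDF_lt_top) (g := f)
  simpa [toReal_gaussianPDF, smul_eq_mul] using this

lemma gaussianPDFReal_mul_exp_quadratic {a : ℝ} (ha : a < 1 / 2) (b y : ℝ) :
    gaussianPDFReal 0 1 y * Real.exp (a * y ^ 2 + b * y) =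
      (Real.sqrt (1 - 2 * a))⁻¹ * Real.exp (b ^ 2 / (2 * (1 - 2 * a))) *
        gaussianPDFReal (b / (1 - 2 * a)) (1 / (1 - 2 * a)).toNNReal y := by
  have h : 0 < 1 - 2 * a := by linarith
  have hv : ((1 / (1 - 2 * a)).toNNReal : ℝ) = 1 / (1 - 2 * a) :=
    Real.coe_toNNReal _ (by positivity)
  rw [gaussianPDFReal, gaussianPDFReal, hv]
  have hs : Real.sqrt (2 * Real.pi * (1 / (1 - 2 * a))) =
      Real.sqrt (2 * Real.pi) / Real.sqrt (1 - 2 * a) := by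
    rw [mul_one_div, Real.sqrt_div (by positivity)]
  rw [hs]
  have h1 : Real.sqrt (1 - 2 * a) ≠ 0 := (Real.sqrt_pos.2 h).ne'
  have h2 : Real.sqrt (2 * Real.pi) ≠ 0 := by positivity
  have e : Real.exp (-(y - 0) ^ 2 / (2 * ((1 : NNReal) : ℝ))) * Real.exp (a * y ^ 2 + b * y) =
      Real.exp (b ^ 2 / (2 * (1 - 2 * a))) *
        Real.exp (-(y - b / (1 - 2 * a)) ^ 2 / (2 * (1 / (1 - 2 * a)))) := by
    rw [← Real.exp_add, ← Real.exp_add]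
    congr 1
    have h3 := h.ne'
    field_simp
    push_cast
    ring
  rw [mul_assoc, e]
  simp only [NNReal.coe_one, mul_one]
  field_simp

lemma integrable_exp_quadratic {a : ℝ} (ha : a < 1 / 2) (b : ℝ) :
    Integrable (fun y => Real.exp (a * y ^ 2 + b * y)) (gaussianReal 0 1) := by
  rw [integrable_gaussianReal_iff]
  simp_rw [gaussianPDFReal_mul_exp_quadratic ha b]
  exact (integrable_gaussianPDFReal _ _).const_mul _

lemma integral_exp_quadratic {a : ℝ} (ha : a < 1 / 2) (b : ℝ) :
    ∫ y, Real.exp (a * y ^ 2 + b * y) ∂(gaussianReal 0 1) =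
      (Real.sqrt (1 - 2 * a))⁻¹ * Real.exp (b ^ 2 / (2 * (1 - 2 * a))) := by
  have h : 0 < 1 - 2 * a := by linarith
  rw [integral_gaussianReal_eq_integral_smul one_ne_zero]
  simp_rw [smul_eq_mul, gaussianPDFReal_mul_exp_quadratic ha b]
  rw [integral_const_mul, integral_gaussianPDFReal_eq_one, mul_one]
  simpa using h

lemma integrable_exp_abs (c : ℝ) :
    Integrable (fun y => Real.exp (c * |y|)) (gaussianReal 0 1) := by
  have h1 := integrable_exp_quadratic (a := 0) (by norm_num) c
  have h2 := integrable_exp_quadratic (a := 0) (by norm_num) (-c)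
  refine (h1.add h2).mono' (by fun_prop) (ae_of_all _ fun y => ?_)
  rw [Real.norm_of_nonneg (Real.exp_nonneg _)]
  simp only [Pi.add_apply]
  rcases abs_cases y with ⟨h, _⟩ | ⟨h, _⟩ <;> rw [h]
  · have := Real.exp_nonneg (0 * y ^ 2 + -c * y)
    simp only [zero_mul, zero_add] at *; linarith
  · have := Real.exp_nonneg (0 * y ^ 2 + c * y)
    simp only [zero_mul, zero_add] at *
    rw [show c * -y = -c * y by ring]; linarith

/-- Gaussian integration by parts on the line. -/
lemma integral_id_mul_gaussianReal {f f' : ℝ → ℝ} (hf : ∀ y, HasDerivAt f (f' y) y)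
    (h1 : Integrable f (gaussianReal 0 1)) (h2 : Integrable f' (gaussianReal 0 1))
    (h3 : Integrable (fun y => y * f y) (gaussianReal 0 1)) :
    ∫ y, y * f y ∂(gaussianReal 0 1) = ∫ y, f' y ∂(gaussianReal 0 1) := by
  rw [integrable_gaussianReal_iff] at h1 h2 h3
  rw [integral_gaussianReal_eq_integral_smul one_ne_zero,
    integral_gaussianReal_eq_integral_smul one_ne_zero]
  have hp : ∀ y : ℝ, HasDerivAt (gaussianPDFReal 0 1) (-y * gaussianPDFReal 0 1 y) y := by
    intro y
    have : HasDerivAt (fun y : ℝ => -(y - 0) ^ 2 / (2 * ((1 : NNReal) : ℝ))) (-y) y := by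
      have := (((hasDerivAt_id y).sub_const 0).pow 2).neg.div_const (2 * ((1 : NNReal) : ℝ))
      refine this.congr_deriv ?_
      simp only [id_eq, NNReal.coe_one]
      ring
    have h := (this.exp).const_mul (Real.sqrt (2 * Real.pi * ((1 : NNReal) : ℝ)))⁻¹
    refine h.congr_deriv ?_
    simp only [gaussianPDFReal]
    ring
  have key := integral_mul_deriv_eq_deriv_mul_of_integrable (u := f) (u' := f')
    (v := gaussianPDFReal 0 1) (v' := fun y => -y * gaussianPDFReal 0 1 y)
    (fun y _ => hf y) (fun y _ => hp y)
    (by convert h3.neg using 1; ext y; simp; ring)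
    (by convert h2 using 1; ext y; simp; ring)
    (by convert h1 using 1; ext y; simp; ring)
  simp only [smul_eq_mul]
  have e1 : ∫ y, gaussianPDFReal 0 1 y * (y * f y) =
      - ∫ y, f y * (-y * gaussianPDFReal 0 1 y) := by
    rw [← integral_neg]; congr 1; ext y; ring
  rw [e1, key, neg_neg]
  congr 1; ext y; ring

section Pi
variable {ι : Type*} [Fintype ι]

lemma integrable_gaussPi_exp_sum_abs (c : ℝ) :
    Integrable (fun x : ι → ℝ => Real.exp (c * ∑ i, |x i|)) (gaussPi ι) := by
  have := Integrable.fintype_prod (𝕜 := ℝ) (μ := fun _ : ι => gaussianReal 0 1)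
    (f := fun _ y => Real.exp (c * |y|)) (fun _ => integrable_exp_abs c)
  simpa [← Real.exp_sum, Finset.mul_sum] using this

lemma integrable_gaussPi_exp_sum_sq {c : ℝ} (hc : c < 1 / 2) :
    Integrable (fun x : ι → ℝ => Real.exp (c * ∑ i, x i ^ 2)) (gaussPi ι) := by
  have := Integrable.fintype_prod (𝕜 := ℝ) (μ := fun _ : ι => gaussianReal 0 1)
    (f := fun _ y => Real.exp (c * y ^ 2))
    (fun _ => by simpa using integrable_exp_quadratic hc 0)
  simpa [← Real.exp_sum, Finset.mul_sum] using this

lemma measurePreserving_update [DecidableEq ι] (i : ι) :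
    MeasurePreserving (fun p : (ι → ℝ) × ℝ => Function.update p.1 i p.2)
      ((gaussPi ι).prod (gaussianReal 0 1)) (gaussPi ι) := by
  have hm : Measurable (fun p : (ι → ℝ) × ℝ => Function.update p.1 i p.2) := by
    rw [measurable_pi_iff]
    intro j
    by_cases h : j = i
    · subst h; simpa using measurable_snd
    · simp only [Function.update_of_ne h]; fun_prop
  refine ⟨hm, (Measure.pi_eq fun s hs => ?_).symm⟩
  rw [Measure.map_apply hm (MeasurableSet.univ_pi hs)]
  have : (fun p : (ι → ℝ) × ℝ => Function.update p.1 i p.2) ⁻¹' (Set.univ.pi s) =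
      (Set.univ.pi (Function.update s i Set.univ)) ×ˢ (s i) := by
    ext p
    simp only [Set.mem_preimage, Set.mem_pi, Set.mem_univ, true_implies, Set.mem_prod]
    constructor
    · intro h
      refine ⟨fun j => ?_, by simpa using h i⟩
      by_cases hj : j = i
      · subst hj; simp
      · simpa [Function.update_of_ne hj] using h j
    · rintro ⟨h1, h2⟩ j
      by_cases hj : j = i
      · subst hj; simpa using h2
      · simpa [Function.update_of_ne hj] using h1 j
  rw [this, Measure.prod_prod, Measure.pi_pi]
  have h2 : ∀ j, (gaussianReal 0 1) (Function.update s i Set.univ j) =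
      Function.update (fun j => (gaussianReal 0 1) (s j)) i 1 j := by
    intro j
    by_cases hj : j = i
    · subst hj; simp
    · simp [Function.update_of_ne hj]
  simp_rw [h2]
  rw [Finset.prod_update_of_mem (Finset.mem_univ i), one_mul, mul_comm,
    ← Finset.mul_prod_erase _ _ (Finset.mem_univ i), Finset.sdiff_singleton_eq_erase]

lemma measurePreserving_comp_injective {κ : Type*} [Fintype κ] {f : κ → ι}
    (hf : Function.Injective f) :
    MeasurePreserving (fun x : ι → ℝ => fun k => x (f k)) (gaussPi ι) (gaussPi κ) := by
  classical
  have hm : Measurable (fun x : ι → ℝ => fun k => x (f k)) := by fun_prop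
  refine ⟨hm, (Measure.pi_eq fun s hs => ?_).symm⟩
  rw [Measure.map_apply hm (MeasurableSet.univ_pi hs)]
  have : (fun x : ι → ℝ => fun k => x (f k)) ⁻¹' (Set.univ.pi s) =
      Set.univ.pi (fun i => Function.extend f s (fun _ => Set.univ) i) := by
    ext x
    simp only [Set.mem_preimage, Set.mem_pi, Set.mem_univ, true_implies]
    constructor
    · intro h i
      by_cases hi : ∃ k, f k = i
      · obtain ⟨k, rfl⟩ := hi; rw [hf.extend_apply]; exact h k
      · rw [Function.extend_apply' _ _ _ hi]; trivial
    · intro h k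
      have := h (f k); rwa [hf.extend_apply] at this
  rw [this, Measure.pi_pi]
  rw [← Finset.prod_subset (Finset.subset_univ (Finset.univ.image f)),
    Finset.prod_image (fun a _ b _ h => hf h)]
  · exact Finset.prod_congr rfl fun k _ => by rw [hf.extend_apply]
  · intro i _ hi
    have : ¬ ∃ k, f k = i := by simpa using hi
    rw [Function.extend_apply' _ _ _ this]; simp

lemma integrable_of_expBound {F : (ι → ℝ) → ℝ} (hm : Measurable F) {C D : ℝ}
    (hF : ∀ x, |F x| ≤ D * Real.exp (C * ∑ i, |x i|)) : Integrable F (gaussPi ι) :=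
  ((integrable_gaussPi_exp_sum_abs C).const_mul D).mono' hm.aestronglyMeasurable
    (ae_of_all _ fun x => hF x)

lemma sum_abs_update_le [DecidableEq ι] (x : ι → ℝ) (i : ι) (y : ℝ) :
    ∑ j, |Function.update x i y j| ≤ ∑ j, |x j| + |y| := by
  have : ∀ j, |Function.update x i y j| = Function.update (fun j => |x j|) i |y| j := by
    intro j
    by_cases hj : j = i
    · subst hj; simp
    · simp [Function.update_of_ne hj]
  simp_rw [this]
  rw [Finset.sum_update_of_mem (Finset.mem_univ i), add_comm]
  gcongr
  exact Finset.subset_univ _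

/-- Gaussian integration by parts in one coordinate of a product. -/
lemma integral_coord_mul_gaussPi [DecidableEq ι] (i : ι) {F F' : (ι → ℝ) → ℝ} {C : ℝ}
    (hC : 0 ≤ C)
    (hd : ∀ x, HasDerivAt (fun s => F (Function.update x i s)) (F' x) (x i))
    (hm : Measurable F) (hm' : Measurable F')
    (hF : ∀ x, |F x| ≤ C * Real.exp (C * ∑ i, |x i|))
    (hF' : ∀ x, |F' x| ≤ C * Real.exp (C * ∑ i, |x i|)) :
    ∫ x, x i * F x ∂(gaussPi ι) = ∫ x, F' x ∂(gaussPi ι) := by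
  have hxF : ∀ x : ι → ℝ, |x i * F x| ≤ C * Real.exp ((C + 1) * ∑ i, |x i|) := by
    intro x
    have h1 : |x i| ≤ Real.exp (∑ i, |x i|) := by
      have h2 : |x i| ≤ ∑ i, |x i| :=
        Finset.single_le_sum (f := fun i => |x i|) (fun _ _ => abs_nonneg _) (Finset.mem_univ i)
      linarith [Real.add_one_le_exp (∑ i, |x i|)]
    rw [abs_mul, add_mul, one_mul, Real.exp_add]
    calc |x i| * |F x| ≤ Real.exp (∑ i, |x i|) * (C * Real.exp (C * ∑ i, |x i|)) :=
          mul_le_mul h1 (hF x) (abs_nonneg _) (Real.exp_nonneg _)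
      _ = _ := by ring
  have hInt : Integrable (fun x : ι → ℝ => x i * F x) (gaussPi ι) :=
    integrable_of_expBound (by fun_prop) hxF
  have hInt' : Integrable F' (gaussPi ι) := integrable_of_expBound hm' hF'
  have mp := measurePreserving_update i
  have fub : ∀ G : (ι → ℝ) → ℝ, Integrable G (gaussPi ι) → ∫ x, G x ∂(gaussPi ι) =
      ∫ x, ∫ y, G (Function.update x i y) ∂(gaussianReal 0 1) ∂(gaussPi ι) := by
    intro G hG
    have hG' : Integrable (fun p : (ι → ℝ) × ℝ => G (Function.update p.1 i p.2))
        ((gaussPi ι).prod (gaussianReal 0 1)) := mp.integrable_comp_of_integrable hG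
    rw [← integral_prod (fun p : (ι → ℝ) × ℝ => G (Function.update p.1 i p.2)) hG']
    conv_lhs => rw [← mp.map_eq]
    rw [integral_map mp.measurable.aemeasurable]
    rw [mp.map_eq]; exact hG.1
  rw [fub _ hInt, fub _ hInt']
  congr 1
  ext x
  simp only [Function.update_self]
  have hu : Measurable (fun y : ℝ => Function.update x i y) := measurable_update x
  have bd : ∀ {G : (ι → ℝ) → ℝ} {D : ℝ}, 0 ≤ D → Measurable G →
      (∀ x, |G x| ≤ C * Real.exp (D * ∑ i, |x i|)) →
      Integrable (fun y => G (Function.update x i y)) (gaussianReal 0 1) := by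
    intro G D hD hGm hG
    refine ((integrable_exp_abs D).const_mul (C * Real.exp (D * ∑ i, |x i|))).mono'
      (hGm.comp hu).aestronglyMeasurable (ae_of_all _ fun y => ?_)
    refine (hG _).trans ?_
    rw [mul_assoc, ← Real.exp_add, ← mul_add]
    gcongr
    exact sum_abs_update_le x i y
  refine integral_id_mul_gaussianReal (fun y => ?_) (bd hC hm hF) (bd hC hm' hF') ?_
  · have := hd (Function.update x i y)
    simpa using this
  · have := bd (G := fun x => x i * F x) (D := C + 1) (by linarith) (by fun_prop) hxF
    simpa using this

end Pi

end GaussianSpinGlass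
end

noncomputable section

namespace GaussianSpinGlass

/-! ### Calculus of smoothed families -/

section Calculus
variable {ι : Type*} [Fintype ι]

/-- A function of time and space together with its candidate time derivative, first and pure
second space derivatives. -/
structure Jet (ι : Type*) where
  U : ℝ → (ι → ℝ) → ℝ
  Ut : ℝ → (ι → ℝ) → ℝ
  Ui : ι → ℝ → (ι → ℝ) → ℝ
  Uii : ι → ℝ → (ι → ℝ) → ℝ

/-- The linear form `(τ, y) ↦ a τ + ∑ b_i y_i`. -/
def spaceTimeForm (a : ℝ) (b : ι → ℝ) : ℝ × (ι → ℝ) →L[ℝ] ℝ :=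
  a • ContinuousLinearMap.fst ℝ ℝ (ι → ℝ) +
    ∑ i, b i • (ContinuousLinearMap.proj (R := ℝ) (φ := fun _ : ι => ℝ) i).comp
      (ContinuousLinearMap.snd ℝ ℝ (ι → ℝ))

lemma spaceTimeForm_apply (a : ℝ) (b : ι → ℝ) (p : ℝ × (ι → ℝ)) :
    spaceTimeForm a b p = a * p.1 + ∑ i, b i * p.2 i := by
  simp [spaceTimeForm]

lemma norm_spaceTimeForm_le (a : ℝ) (b : ι → ℝ) : ‖spaceTimeForm a b‖ ≤ |a| + ∑ i, |b i| := by
  refine ContinuousLinearMap.opNorm_le_bound _ (by positivity) fun p => ?_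
  rw [spaceTimeForm_apply, Real.norm_eq_abs]
  refine (abs_add_le _ _).trans ?_
  rw [add_mul, Finset.sum_mul, abs_mul]
  gcongr
  · exact norm_fst_le p
  · refine (Finset.abs_sum_le_sum_abs _ _).trans (Finset.sum_le_sum fun i _ => ?_)
    rw [abs_mul]
    gcongr
    exact (norm_le_pi_norm p.2 i).trans (norm_snd_le p)

lemma integral_spaceTimeForm {Ω : Type*} [MeasurableSpace Ω] {μ : Measure Ω} {a : Ω → ℝ}
    {b : ι → Ω → ℝ} (ha : Integrable a μ) (hb : ∀ i, Integrable (b i) μ) :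
    ∫ ω, spaceTimeForm (a ω) (fun i => b i ω) ∂μ =
      spaceTimeForm (∫ ω, a ω ∂μ) (fun i => ∫ ω, b i ω ∂μ) := by
  simp only [spaceTimeForm]
  rw [integral_add (ha.smul_const _) (integrable_finsetSum _ fun i _ => (hb i).smul_const _),
    integral_smul_const, integral_finsetSum _ fun i _ => (hb i).smul_const _]
  simp_rw [integral_smul_const]

/-- The entries of the jet are the derivatives of its first component on `(0, 1) × ℝ^ι`. -/
structure Jet.Regular [DecidableEq ι] (j : Jet ι) : Prop where
  cont : ContinuousOn (fun p : ℝ × (ι → ℝ) => j.U p.1 p.2) (Set.Icc 0 1 ×ˢ Set.univ)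
  hasFDeriv : ∀ t ∈ Set.Ioo (0 : ℝ) 1, ∀ x,
    HasFDerivAt (fun p : ℝ × (ι → ℝ) => j.U p.1 p.2)
      (spaceTimeForm (j.Ut t x) (fun i => j.Ui i t x)) (t, x)
  hasDeriv : ∀ t ∈ Set.Ioo (0 : ℝ) 1, ∀ x i,
    HasDerivAt (fun s => j.Ui i t (Function.update x i s)) (j.Uii i t x) (x i)
  meas_t : ∀ t ∈ Set.Ioo (0 : ℝ) 1, Measurable (j.Ut t)
  meas_i : ∀ t ∈ Set.Ioo (0 : ℝ) 1, ∀ i, Measurable (j.Ui i t)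
  meas_ii : ∀ t ∈ Set.Ioo (0 : ℝ) 1, ∀ i, Measurable (j.Uii i t)

/-- All entries grow at most exponentially in space, uniformly in time. -/
structure Jet.ExpBound (j : Jet ι) (C : ℝ) : Prop where
  nonneg : 0 ≤ C
  U : ∀ t ∈ Set.Icc (0 : ℝ) 1, ∀ x, |j.U t x| ≤ C * Real.exp (C * ∑ i, |x i|)
  Ut : ∀ t ∈ Set.Ioo (0 : ℝ) 1, ∀ x, |j.Ut t x| ≤ C * Real.exp (C * ∑ i, |x i|)
  Ui : ∀ t ∈ Set.Ioo (0 : ℝ) 1, ∀ x i, |j.Ui i t x| ≤ C * Real.exp (C * ∑ i, |x i|)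
  Uii : ∀ t ∈ Set.Ioo (0 : ℝ) 1, ∀ x i, |j.Uii i t x| ≤ C * Real.exp (C * ∑ i, |x i|)

/-- The first component is of linear growth and the derivatives are bounded. -/
structure Jet.LinBound (j : Jet ι) (C : ℝ) : Prop where
  nonneg : 0 ≤ C
  U : ∀ t ∈ Set.Icc (0 : ℝ) 1, ∀ x, |j.U t x| ≤ C * (1 + ∑ i, |x i|)
  Ut : ∀ t ∈ Set.Ioo (0 : ℝ) 1, ∀ x, |j.Ut t x| ≤ C
  Ui : ∀ t ∈ Set.Ioo (0 : ℝ) 1, ∀ x i, |j.Ui i t x| ≤ C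
  Uii : ∀ t ∈ Set.Ioo (0 : ℝ) 1, ∀ x i, |j.Uii i t x| ≤ C

/-- The point `x + σ(t) ξ` with `σ_i(t)² = α_i + d_i t`. -/
def shift (α d : ι → ℝ) (t : ℝ) (x ξ : ι → ℝ) : ι → ℝ :=
  fun i => x i + Real.sqrt (α i + d i * t) * ξ i

/-- The smoothing of a jet by a Gaussian noise of covariance `diag (α + d t)`. -/
def Jet.avg (j : Jet ι) (α d : ι → ℝ) : Jet ι where
  U t x := ∫ ξ, j.U t (shift α d t x ξ) ∂(gaussPi ι)
  Ut t x := ∫ ξ, (j.Ut t (shift α d t x ξ) + 1 / 2 * ∑ i, d i * j.Uii i t (shift α d t x ξ))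
    ∂(gaussPi ι)
  Ui i t x := ∫ ξ, j.Ui i t (shift α d t x ξ) ∂(gaussPi ι)
  Uii i t x := ∫ ξ, j.Uii i t (shift α d t x ξ) ∂(gaussPi ι)

lemma measurable_shift (α d : ι → ℝ) (t : ℝ) :
    Measurable (fun p : (ι → ℝ) × (ι → ℝ) => shift α d t p.1 p.2) := by
  unfold shift; fun_prop

lemma measurable_shift_right (α d : ι → ℝ) (t : ℝ) (x : ι → ℝ) :
    Measurable (shift α d t x) := by
  unfold shift; fun_prop

lemma exists_sum_abs_shift_le (α d : ι → ℝ) : ∃ A : ℝ, 0 ≤ A ∧ ∀ t ∈ Set.Icc (0 : ℝ) 1,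
    ∀ x ξ, ∑ i, |shift α d t x ξ i| ≤ ∑ i, |x i| + A * ∑ i, |ξ i| := by
  refine ⟨∑ i, Real.sqrt (|α i| + |d i|), by positivity, fun t ht x ξ => ?_⟩
  rw [Finset.mul_sum, ← Finset.sum_add_distrib]
  refine Finset.sum_le_sum fun i _ => ?_
  refine (abs_add_le _ _).trans ?_
  rw [abs_mul, abs_of_nonneg (Real.sqrt_nonneg _)]
  gcongr
  calc Real.sqrt (α i + d i * t) ≤ Real.sqrt (|α i| + |d i|) := by
        apply Real.sqrt_le_sqrt
        have : d i * t ≤ |d i| := by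
          calc d i * t ≤ |d i * t| := le_abs_self _
            _ = |d i| * t := by rw [abs_mul, abs_of_nonneg ht.1]
            _ ≤ |d i| * 1 := by gcongr; exact ht.2
            _ = _ := mul_one _
        linarith [le_abs_self (α i)]
    _ ≤ _ := Finset.single_le_sum (f := fun i => Real.sqrt (|α i| + |d i|))
        (fun _ _ => Real.sqrt_nonneg _) (Finset.mem_univ i)

/-- Nonnegativity of `α + d t` on `[0, 1]`. -/
structure NoiseProfile (α d : ι → ℝ) : Prop where
  zero : ∀ i, 0 ≤ α i
  one : ∀ i, 0 ≤ α i + d i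

lemma NoiseProfile.pos_or {α d : ι → ℝ} (h : NoiseProfile α d) (i : ι) :
    (α i = 0 ∧ d i = 0) ∨ ∀ t ∈ Set.Ioo (0 : ℝ) 1, 0 < α i + d i * t := by
  have h0 := h.zero i
  have h1 := h.one i
  rcases h0.eq_or_lt with h0 | h0
  · rcases h1.eq_or_lt with h1 | h1
    · left; constructor <;> linarith
    · right; intro t ht
      have : 0 < d i := by linarith
      have := mul_pos this ht.1
      linarith
  · right; intro t ht
    have e : α i + d i * t = α i * (1 - t) + (α i + d i) * t := by ring
    have := mul_pos h0 (sub_pos.2 ht.2)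
    have := mul_nonneg h1 ht.1.le
    linarith

/-- The derivative of `√(α_i + d_i t)`. -/
def sigmaDeriv (α d : ι → ℝ) (i : ι) (t : ℝ) : ℝ := d i / (2 * Real.sqrt (α i + d i * t))

lemma NoiseProfile.hasDerivAt {α d : ι → ℝ} (h : NoiseProfile α d) (i : ι) {t : ℝ}
    (ht : t ∈ Set.Ioo (0 : ℝ) 1) :
    HasDerivAt (fun t => Real.sqrt (α i + d i * t)) (sigmaDeriv α d i t) t := by
  rcases h.pos_or i with ⟨h0, h1⟩ | h0
  · simp only [sigmaDeriv, h0, h1]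
    simpa using hasDerivAt_const t (0 : ℝ)
  · have : HasDerivAt (fun t => α i + d i * t) (d i) t := by
      simpa using ((hasDerivAt_id t).const_mul (d i)).const_add (α i)
    exact this.sqrt (h0 t ht).ne'

lemma NoiseProfile.sigmaDeriv_mul {α d : ι → ℝ} (h : NoiseProfile α d) (i : ι) {t : ℝ}
    (ht : t ∈ Set.Ioo (0 : ℝ) 1) :
    sigmaDeriv α d i t * Real.sqrt (α i + d i * t) = d i / 2 := by
  rcases h.pos_or i with ⟨h0, h1⟩ | h0
  · simp [sigmaDeriv, h0, h1]
  · have := (Real.sqrt_pos.2 (h0 t ht)).ne'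
    rw [sigmaDeriv]; field_simp

lemma NoiseProfile.continuousAt {α d : ι → ℝ} (h : NoiseProfile α d) (i : ι) {t : ℝ}
    (ht : t ∈ Set.Ioo (0 : ℝ) 1) : ContinuousAt (sigmaDeriv α d i) t := by
  rcases h.pos_or i with ⟨h0, h1⟩ | h0
  · have : sigmaDeriv α d i = fun _ => 0 := by ext s; simp [sigmaDeriv, h1]
    rw [this]; exact continuousAt_const
  · have := (Real.sqrt_pos.2 (h0 t ht)).ne'
    unfold sigmaDeriv
    refine ContinuousAt.div (by fun_prop) (by fun_prop) (by positivity)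

lemma NoiseProfile.exists_bound {α d : ι → ℝ} (h : NoiseProfile α d) {t : ℝ}
    (ht : t ∈ Set.Ioo (0 : ℝ) 1) : ∃ B : ℝ, 0 ≤ B ∧ ∀ᶠ τ in 𝓝 t, ∀ i, |sigmaDeriv α d i τ| ≤ B := by
  refine ⟨∑ i, (|sigmaDeriv α d i t| + 1), by positivity, ?_⟩
  rw [Filter.eventually_all]
  intro i
  have hc := (h.continuousAt i ht).abs
  have : ∀ᶠ τ in 𝓝 t, |sigmaDeriv α d i τ| < |sigmaDeriv α d i t| + 1 :=
    hc.eventually_lt_const (by linarith)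
  refine this.mono fun τ hτ => hτ.le.trans ?_
  exact Finset.single_le_sum (f := fun i => |sigmaDeriv α d i t| + 1)
    (fun _ _ => by positivity) (Finset.mem_univ i)

lemma Jet.Regular.measurable [DecidableEq ι] {j : Jet ι} (hj : j.Regular) {t : ℝ}
    (ht : t ∈ Set.Icc (0 : ℝ) 1) : Measurable (j.U t) := by
  have : Continuous (j.U t) := by
    rw [← continuousOn_univ]
    exact hj.cont.comp (f := fun x => (t, x)) (by fun_prop) (fun x _ => ⟨ht, trivial⟩)
  exact this.measurable

lemma expBound_shift {C A : ℝ} (hC : 0 ≤ C) {x ξ : ι → ℝ} {y : ι → ℝ} {v : ℝ}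
    (hA : ∑ i, |y i| ≤ ∑ i, |x i| + A * ∑ i, |ξ i|) (hv : |v| ≤ C * Real.exp (C * ∑ i, |y i|)) :
    |v| ≤ C * Real.exp (C * ∑ i, |x i|) * Real.exp (C * A * ∑ i, |ξ i|) := by
  refine hv.trans ?_
  rw [mul_assoc, ← Real.exp_add]
  gcongr
  calc C * ∑ i, |y i| ≤ C * (∑ i, |x i| + A * ∑ i, |ξ i|) := by gcongr
    _ = _ := by ring

lemma measurable_integral_shift (α d : ι → ℝ) (t : ℝ) {F : (ι → ℝ) → ℝ} (hF : Measurable F) :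
    Measurable (fun x => ∫ ξ, F (shift α d t x ξ) ∂(gaussPi ι)) := by
  have : StronglyMeasurable (fun p : (ι → ℝ) × (ι → ℝ) => F (shift α d t p.1 p.2)) :=
    (hF.comp (measurable_shift α d t)).stronglyMeasurable
  exact this.integral_prod_right.measurable

lemma integrable_shift {α d : ι → ℝ} {t : ℝ} (ht : t ∈ Set.Icc (0 : ℝ) 1) (x : ι → ℝ)
    {F : (ι → ℝ) → ℝ} (hm : Measurable F) {C : ℝ} (hC : 0 ≤ C)
    (hF : ∀ x, |F x| ≤ C * Real.exp (C * ∑ i, |x i|)) :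
    Integrable (fun ξ => F (shift α d t x ξ)) (gaussPi ι) := by
  obtain ⟨A, hA, hs⟩ := exists_sum_abs_shift_le α d
  exact integrable_of_expBound (hm.comp (measurable_shift_right α d t x))
    fun ξ => expBound_shift hC (hs t ht x ξ) (hF _)

variable [DecidableEq ι]

lemma shift_update_right (α d : ι → ℝ) (t : ℝ) (x ξ : ι → ℝ) (i : ι) (s : ℝ) :
    shift α d t x (Function.update ξ i s) =
      Function.update (shift α d t x ξ) i (x i + Real.sqrt (α i + d i * t) * s) := by
  ext k
  by_cases h : k = i
  · subst h; simp [shift]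
  · simp [shift, Function.update_of_ne h]

lemma shift_update_left (α d : ι → ℝ) (t : ℝ) (x ξ : ι → ℝ) (i : ι) (s : ℝ) :
    shift α d t (Function.update x i s) ξ =
      Function.update (shift α d t x ξ) i (s + Real.sqrt (α i + d i * t) * ξ i) := by
  ext k
  by_cases h : k = i
  · subst h; simp [shift]
  · simp [shift, Function.update_of_ne h]

lemma integral_noise_mul {j : Jet ι} (hj : j.Regular) {C : ℝ} (hC : j.ExpBound C)
    (α d : ι → ℝ) {t : ℝ} (ht : t ∈ Set.Ioo (0 : ℝ) 1) (x : ι → ℝ) (i : ι) :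
    ∫ ξ, ξ i * j.Ui i t (shift α d t x ξ) ∂(gaussPi ι) =
      Real.sqrt (α i + d i * t) * ∫ ξ, j.Uii i t (shift α d t x ξ) ∂(gaussPi ι) := by
  obtain ⟨A, hA, hs⟩ := exists_sum_abs_shift_le α d
  have ht' := Set.Ioo_subset_Icc_self ht
  have h0 := hC.nonneg
  set σ := Real.sqrt (α i + d i * t)
  have hσ : 0 ≤ σ := Real.sqrt_nonneg _
  set E := C * Real.exp (C * ∑ i, |x i|) with hE
  have hE0 : 0 ≤ E := by positivity
  set D := E + σ * E + C * A
  have hD : 0 ≤ D := by positivity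
  have b1 : E ≤ D := by have := mul_nonneg h0 hA; have := mul_nonneg hσ hE0; linarith
  have b2 : σ * E ≤ D := by have := mul_nonneg h0 hA; linarith
  have b3 : C * A ≤ D := by have := mul_nonneg hσ hE0; linarith
  rw [← integral_const_mul]
  refine integral_coord_mul_gaussPi i (C := D) hD (fun ξ => ?_) ?_ ?_ (fun ξ => ?_) (fun ξ => ?_)
  · have h1 := hj.hasDeriv t ht (shift α d t x ξ) i
    have h2 : HasDerivAt (fun s => x i + σ * s) σ (ξ i) := by
      simpa using ((hasDerivAt_id (ξ i)).const_mul σ).const_add (x i)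
    have h3 := HasDerivAt.comp (ξ i) (h₂ := fun s => j.Ui i t (Function.update (shift α d t x ξ) i s))
      (h := fun s => x i + σ * s) h1 h2
    refine (h3.congr_deriv (mul_comm _ _)).congr_of_eventuallyEq (Eventually.of_forall fun s => ?_)
    simp only [shift_update_right, Function.comp]
    rfl
  · exact (hj.meas_i t ht i).comp (measurable_shift_right α d t x)
  · exact ((hj.meas_ii t ht i).comp (measurable_shift_right α d t x)).const_mul _
  · have := expBound_shift h0 (hs t ht' x ξ) (hC.Ui t ht _ i)
    refine this.trans ?_
    gcongr
  · have := expBound_shift h0 (hs t ht' x ξ) (hC.Uii t ht _ i)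
    rw [abs_mul, abs_of_nonneg hσ]
    calc _ ≤ σ * (E * Real.exp (C * A * ∑ i, |ξ i|)) := by gcongr
      _ = σ * E * Real.exp (C * A * ∑ i, |ξ i|) := by ring
      _ ≤ _ := by gcongr

end Calculus
end GaussianSpinGlass
end

noncomputable section

namespace GaussianSpinGlass

section Calculus
variable {ι : Type*} [Fintype ι] [DecidableEq ι]

lemma continuous_shift (α d : ι → ℝ) (ξ : ι → ℝ) :
    Continuous (fun p : ℝ × (ι → ℝ) => shift α d p.1 p.2 ξ) := by
  unfold shift; fun_prop

lemma NoiseProfile.hasFDerivAt_shift {α d : ι → ℝ} (h : NoiseProfile α d) (ξ : ι → ℝ) {t : ℝ}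
    (ht : t ∈ Set.Ioo (0 : ℝ) 1) (x : ι → ℝ) :
    HasFDerivAt (fun p : ℝ × (ι → ℝ) => (p.1, shift α d p.1 p.2 ξ))
      ((ContinuousLinearMap.fst ℝ ℝ (ι → ℝ)).prod
        (ContinuousLinearMap.pi fun i => spaceTimeForm (sigmaDeriv α d i t * ξ i)
          (Pi.single i 1))) (t, x) := by
  refine HasFDerivAt.prodMk hasFDerivAt_fst (hasFDerivAt_pi.2 fun i => ?_)
  have h1 : HasFDerivAt (fun p : ℝ × (ι → ℝ) => p.2 i)
      ((ContinuousLinearMap.proj (R := ℝ) (φ := fun _ : ι => ℝ) i).comp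
      (ContinuousLinearMap.snd ℝ ℝ (ι → ℝ))) (t, x) :=
    ((ContinuousLinearMap.proj (R := ℝ) (φ := fun _ : ι => ℝ) i).comp
      (ContinuousLinearMap.snd ℝ ℝ (ι → ℝ))).hasFDerivAt
  have h2 : HasFDerivAt (fun p : ℝ × (ι → ℝ) => Real.sqrt (α i + d i * p.1) * ξ i)
      ((sigmaDeriv α d i t * ξ i) • ContinuousLinearMap.fst ℝ ℝ (ι → ℝ)) (t, x) :=
    HasDerivAt.comp_hasFDerivAt (t, x) (f := fun p : ℝ × (ι → ℝ) => p.1)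
      ((h.hasDerivAt i ht).mul_const (ξ i)) hasFDerivAt_fst
  refine (h1.add h2).congr_fderiv ?_
  ext p <;> simp [spaceTimeForm_apply, Pi.single_apply]

lemma Jet.Regular.hasFDerivAt_comp_shift {j : Jet ι} (hj : j.Regular) {α d : ι → ℝ}
    (h : NoiseProfile α d) (ξ : ι → ℝ) {t : ℝ} (ht : t ∈ Set.Ioo (0 : ℝ) 1) (x : ι → ℝ) :
    HasFDerivAt (fun p : ℝ × (ι → ℝ) => j.U p.1 (shift α d p.1 p.2 ξ))
      (spaceTimeForm (j.Ut t (shift α d t x ξ) +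
          ∑ i, sigmaDeriv α d i t * (ξ i * j.Ui i t (shift α d t x ξ)))
        (fun i => j.Ui i t (shift α d t x ξ))) (t, x) := by
  have h1 := hj.hasFDeriv t ht (shift α d t x ξ)
  have h2 := HasFDerivAt.comp (t, x) (f := fun p : ℝ × (ι → ℝ) => (p.1, shift α d p.1 p.2 ξ))
    (g := fun p : ℝ × (ι → ℝ) => j.U p.1 p.2) h1 (h.hasFDerivAt_shift ξ ht x)
  refine h2.congr_fderiv ?_
  refine ContinuousLinearMap.ext fun p => ?_
  simp only [ContinuousLinearMap.comp_apply, spaceTimeForm_apply, ContinuousLinearMap.prod_apply,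
    ContinuousLinearMap.coe_fst', ContinuousLinearMap.coe_pi', Pi.single_apply]
  simp only [ite_mul, one_mul, zero_mul, Finset.sum_ite_eq', Finset.mem_univ, if_true, mul_add,
    Finset.sum_add_distrib, add_mul, Finset.sum_mul]
  rw [add_assoc]
  congr 2
  exact Finset.sum_congr rfl fun i _ => by ring

lemma Jet.Regular.continuousOn_avg {j : Jet ι} (hj : j.Regular) {C : ℝ} (hC : j.ExpBound C) {α d : ι → ℝ} :
    ContinuousOn (fun p : ℝ × (ι → ℝ) => (j.avg α d).U p.1 p.2) (Set.Icc 0 1 ×ˢ Set.univ) := by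
  obtain ⟨A, hA, hs⟩ := exists_sum_abs_shift_le α d
  have h0 := hC.nonneg
  have sub := @Set.Ioo_subset_Icc_self ℝ _ 0 1
  intro p hp
  let B : Set (ℝ × (ι → ℝ)) := {q | ∑ i, |q.2 i| < ∑ i, |p.2 i| + 1}
  have hB : B ∈ 𝓝 p := by
    have : IsOpen B := isOpen_lt (by fun_prop) (by fun_prop)
    exact this.mem_nhds (by simp [B])
  refine ContinuousWithinAt.mono_of_mem_nhdsWithin (t := (Set.Icc 0 1 ×ˢ Set.univ) ∩ B) ?_
    (inter_mem_nhdsWithin _ hB)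
  have : ContinuousOn (fun q : ℝ × (ι → ℝ) => ∫ ξ, j.U q.1 (shift α d q.1 q.2 ξ) ∂(gaussPi ι))
      ((Set.Icc 0 1 ×ˢ Set.univ) ∩ B) := by
    refine continuousOn_of_dominated (bound := fun ξ =>
      C * Real.exp (C * (∑ i, |p.2 i| + 1)) * Real.exp (C * A * ∑ i, |ξ i|)) ?_ ?_
      ((integrable_gaussPi_exp_sum_abs (C * A)).const_mul _) ?_
    · intro q hq
      exact ((hj.measurable hq.1.1).comp (measurable_shift_right α d _ _)).aestronglyMeasurable
    · intro q hq
      refine ae_of_all _ fun ξ => ?_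
      refine (expBound_shift h0 (hs q.1 hq.1.1 q.2 ξ) (hC.U _ hq.1.1 _)).trans ?_
      gcongr
      exact le_of_lt hq.2
    · refine ae_of_all _ fun ξ => ?_
      refine (hj.cont.comp (f := fun q : ℝ × (ι → ℝ) => (q.1, shift α d q.1 q.2 ξ)) ?_ ?_)
      · exact (continuous_fst.prodMk (continuous_shift α d ξ)).continuousOn
      · exact fun q hq => ⟨hq.1.1, trivial⟩
  exact this p ⟨hp, by simp [B]⟩

lemma Jet.Regular.hasFDerivAt_avg {j : Jet ι} (hj : j.Regular) {C : ℝ} (hC : j.ExpBound C) {α d : ι → ℝ}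
    (hα : NoiseProfile α d) {t : ℝ} (ht : t ∈ Set.Ioo (0 : ℝ) 1) (x : ι → ℝ) :
    HasFDerivAt (fun p : ℝ × (ι → ℝ) => (j.avg α d).U p.1 p.2)
      (spaceTimeForm ((j.avg α d).Ut t x) (fun i => (j.avg α d).Ui i t x)) (t, x) := by
  obtain ⟨A, hA, hs⟩ := exists_sum_abs_shift_le α d
  have h0 := hC.nonneg
  have sub := @Set.Ioo_subset_Icc_self ℝ _ 0 1
  obtain ⟨B, hB, hBt⟩ := hα.exists_bound ht
  let F : ℝ × (ι → ℝ) → (ι → ℝ) → ℝ := fun p ξ => j.U p.1 (shift α d p.1 p.2 ξ)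
  let a : ℝ × (ι → ℝ) → (ι → ℝ) → ℝ := fun p ξ => j.Ut p.1 (shift α d p.1 p.2 ξ) +
    ∑ i, sigmaDeriv α d i p.1 * (ξ i * j.Ui i p.1 (shift α d p.1 p.2 ξ))
  let b : ι → ℝ × (ι → ℝ) → (ι → ℝ) → ℝ := fun i p ξ => j.Ui i p.1 (shift α d p.1 p.2 ξ)
  have hmt : Measurable fun ξ => j.Ut t (shift α d t x ξ) :=
    (hj.meas_t t ht).comp (measurable_shift_right α d t x)
  have hmi : ∀ i, Measurable (b i (t, x)) := fun i =>
    (hj.meas_i t ht i).comp (measurable_shift_right α d t x)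
  have ev : ∀ᶠ p : ℝ × (ι → ℝ) in 𝓝 (t, x), p.1 ∈ Set.Ioo (0 : ℝ) 1 ∧
      (∀ i, |sigmaDeriv α d i p.1| ≤ B) ∧ ∑ i, |p.2 i| < ∑ i, |x i| + 1 := by
    have e1 : ∀ᶠ p : ℝ × (ι → ℝ) in 𝓝 (t, x), p.1 ∈ Set.Ioo (0 : ℝ) 1 :=
      continuous_fst.continuousAt.eventually (isOpen_Ioo.mem_nhds ht)
    have e2 : ∀ᶠ p : ℝ × (ι → ℝ) in 𝓝 (t, x), ∀ i, |sigmaDeriv α d i p.1| ≤ B :=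
      (continuous_fst.tendsto (t, x)).eventually hBt
    have e3 : ∀ᶠ p : ℝ × (ι → ℝ) in 𝓝 (t, x), ∑ i, |p.2 i| < ∑ i, |x i| + 1 := by
      have : IsOpen {p : ℝ × (ι → ℝ) | ∑ i, |p.2 i| < ∑ i, |x i| + 1} :=
        isOpen_lt (by fun_prop) (by fun_prop)
      exact this.mem_nhds (by simp)
    filter_upwards [e1, e2, e3] with p h1 h2 h3 using ⟨h1, h2, h3⟩
  set E := C * Real.exp (C * (∑ i, |x i| + 1)) with hE
  have hE0 : 0 ≤ E := by positivity
  have bd : ∀ (p : ℝ × (ι → ℝ)) (ξ : ι → ℝ) (v : ℝ), p.1 ∈ Set.Ioo (0 : ℝ) 1 →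
      ∑ i, |p.2 i| < ∑ i, |x i| + 1 →
      |v| ≤ C * Real.exp (C * ∑ i, |shift α d p.1 p.2 ξ i|) →
      |v| ≤ E * Real.exp (C * A * ∑ i, |ξ i|) := by
    intro p ξ v h1 h2 hv
    refine (expBound_shift h0 (hs _ (sub h1) _ ξ) hv).trans ?_
    rw [hE]
    gcongr
  let card : ℝ := Fintype.card ι
  let bound : (ι → ℝ) → ℝ := fun ξ =>
    (E + B * E + card * E) * Real.exp ((C * A + 1) * ∑ i, |ξ i|)
  have key := hasFDerivAt_integral_of_dominated_of_fderiv_le (𝕜 := ℝ) (μ := gaussPi ι)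
    (F := F) (F' := fun p ξ => spaceTimeForm (a p ξ) (fun i => b i p ξ)) (x₀ := (t, x))
    (bound := bound) ev ?_ ?_ ?_ ?_ ?_ ?_
  · have hia : Integrable (fun ξ => j.Ut t (shift α d t x ξ)) (gaussPi ι) :=
      integrable_shift (sub ht) x (hj.meas_t t ht) h0 (hC.Ut t ht)
    have hib : ∀ i, Integrable (b i (t, x)) (gaussPi ι) := fun i =>
      integrable_shift (sub ht) x (hj.meas_i t ht i) h0 (fun x => hC.Ui t ht x i)
    have hic : ∀ i, Integrable (fun ξ => j.Uii i t (shift α d t x ξ)) (gaussPi ι) := fun i =>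
      integrable_shift (sub ht) x (hj.meas_ii t ht i) h0 (fun x => hC.Uii t ht x i)
    have hid : ∀ i, Integrable (fun ξ : ι → ℝ => ξ i * b i (t, x) ξ) (gaussPi ι) := by
      intro i
      refine integrable_of_expBound (C := C * A + 1) (D := E) (by fun_prop) fun ξ => ?_
      have h1 := bd (t, x) ξ (b i (t, x) ξ) ht (by simp) (hC.Ui t ht _ i)
      have h2 : |ξ i| ≤ Real.exp (∑ i, |ξ i|) := by
        have h2 : |ξ i| ≤ ∑ i, |ξ i| :=
          Finset.single_le_sum (f := fun i => |ξ i|) (fun _ _ => abs_nonneg _)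
            (Finset.mem_univ i)
        linarith [Real.add_one_le_exp (∑ i, |ξ i|)]
      rw [abs_mul, add_mul, one_mul, Real.exp_add]
      calc |ξ i| * |b i (t, x) ξ|
          ≤ Real.exp (∑ i, |ξ i|) * (E * Real.exp (C * A * ∑ i, |ξ i|)) :=
            mul_le_mul h2 h1 (abs_nonneg _) (Real.exp_nonneg _)
        _ = _ := by ring
    have his : Integrable (fun ξ : ι → ℝ => ∑ i, sigmaDeriv α d i t * (ξ i * b i (t, x) ξ))
        (gaussPi ι) := integrable_finsetSum _ fun i _ => (hid i).const_mul _
    have hiab : Integrable (a (t, x)) (gaussPi ι) := hia.add his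
    rw [integral_spaceTimeForm hiab hib] at key
    refine key.congr_fderiv ?_
    congr 1
    simp only [Jet.avg, a]
    rw [integral_add hia his, integral_add hia
      ((integrable_finsetSum _ fun i _ => (hic i).const_mul (d i)).const_mul (1 / 2))]
    congr 1
    rw [integral_finsetSum _ fun i _ => (hid i).const_mul _, integral_const_mul,
      integral_finsetSum _ fun i _ => (hic i).const_mul (d i), Finset.mul_sum]
    refine Finset.sum_congr rfl fun i _ => ?_
    rw [integral_const_mul, integral_const_mul]
    have := integral_noise_mul hj hC α d ht x i
    simp only [b]
    rw [this, ← mul_assoc, hα.sigmaDeriv_mul i ht]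
    ring
  · exact ev.mono fun p hp =>
      ((hj.measurable (sub hp.1)).comp (measurable_shift_right α d _ _)).aestronglyMeasurable
  · exact integrable_shift (sub ht) x (hj.measurable (sub ht)) h0 (hC.U t (sub ht))
  · refine Measurable.aestronglyMeasurable ?_
    simp only [spaceTimeForm, a]
    have hm1 : Measurable (a (t, x)) := by
      refine hmt.add (Finset.measurable_sum _ fun i _ => ?_)
      exact ((measurable_pi_apply i).mul (hmi i)).const_mul _
    refine (hm1.smul_const _).add (Finset.measurable_sum _ fun i _ => (hmi i).smul_const _)
  · refine ae_of_all _ fun ξ p hp => ?_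
    obtain ⟨hp1, hp2, hp3⟩ := hp
    refine (norm_spaceTimeForm_le _ _).trans ?_
    have e1 : Real.exp ((C * A + 1) * ∑ i, |ξ i|) =
        Real.exp (C * A * ∑ i, |ξ i|) * Real.exp (∑ i, |ξ i|) := by
      rw [add_mul, one_mul, Real.exp_add]
    have e2 : (∑ i, |ξ i|) ≤ Real.exp (∑ i, |ξ i|) := by
      linarith [Real.add_one_le_exp (∑ i, |ξ i|)]
    have e3 : 1 ≤ Real.exp (∑ i, |ξ i|) := Real.one_le_exp (by positivity)
    set G := Real.exp (C * A * ∑ i, |ξ i|)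
    have hb : ∀ i, |b i p ξ| ≤ E * G := fun i => bd p ξ _ hp1 hp3 (hC.Ui _ hp1 _ i)
    have ht' : |j.Ut p.1 (shift α d p.1 p.2 ξ)| ≤ E * G := bd p ξ _ hp1 hp3 (hC.Ut _ hp1 _)
    have hsum : |∑ i, sigmaDeriv α d i p.1 * (ξ i * b i p ξ)| ≤ B * E * G * ∑ i, |ξ i| := by
      refine (Finset.abs_sum_le_sum_abs _ _).trans ?_
      rw [Finset.mul_sum]
      refine Finset.sum_le_sum fun i _ => ?_
      rw [abs_mul, abs_mul]
      calc _ ≤ B * (|ξ i| * (E * G)) := by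
            gcongr
            · exact hp2 i
            · exact hb i
        _ = _ := by ring
    have hsum2 : ∑ i, |b i p ξ| ≤ card * (E * G) := by
      refine (Finset.sum_le_sum fun i _ => hb i).trans ?_
      simp [card]
    have hG : 0 ≤ G := Real.exp_nonneg _
    calc |a p ξ| + ∑ i, |b i p ξ| ≤ (E * G + B * E * G * ∑ i, |ξ i|) + card * (E * G) := by
          gcongr
          exact (abs_add_le _ _).trans (add_le_add ht' hsum)
      _ ≤ (E * G * Real.exp (∑ i, |ξ i|) + B * E * G * Real.exp (∑ i, |ξ i|)) +
          card * (E * G * Real.exp (∑ i, |ξ i|)) := by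
          have hcard : 0 ≤ card := Nat.cast_nonneg _
          have : E * G ≤ E * G * Real.exp (∑ i, |ξ i|) :=
            le_mul_of_one_le_right (by positivity) e3
          gcongr
      _ = bound ξ := by simp only [bound, e1]; ring
  · exact (integrable_gaussPi_exp_sum_abs _).const_mul _
  · exact ae_of_all _ fun ξ p hp => hj.hasFDerivAt_comp_shift hα ξ hp.1 p.2

lemma Jet.Regular.hasDerivAt_avg {j : Jet ι} (hj : j.Regular) {C : ℝ} (hC : j.ExpBound C) {α d : ι → ℝ}
    {t : ℝ} (ht : t ∈ Set.Ioo (0 : ℝ) 1) (x : ι → ℝ) (i : ι) :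
    HasDerivAt (fun s => (j.avg α d).Ui i t (Function.update x i s)) ((j.avg α d).Uii i t x)
      (x i) := by
  obtain ⟨A, hA, hs⟩ := exists_sum_abs_shift_le α d
  have h0 := hC.nonneg
  have sub := @Set.Ioo_subset_Icc_self ℝ _ 0 1
  have key := hasDerivAt_integral_of_dominated_loc_of_deriv_le (𝕜 := ℝ) (μ := gaussPi ι)
    (F := fun s ξ => j.Ui i t (shift α d t (Function.update x i s) ξ))
    (F' := fun s ξ => j.Uii i t (shift α d t (Function.update x i s) ξ)) (x₀ := x i)
    (s := Metric.ball (x i) 1)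
    (bound := fun ξ => C * Real.exp (C * (∑ i, |x i| + (|x i| + 1))) *
      Real.exp (C * A * ∑ i, |ξ i|)) (Metric.ball_mem_nhds _ one_pos) ?_ ?_ ?_ ?_ ?_ ?_
  · have := key.2
    simpa [Jet.avg, Function.update_eq_self] using this
  · exact Eventually.of_forall fun s =>
      ((hj.meas_i t ht i).comp (measurable_shift_right α d t _)).aestronglyMeasurable
  · exact integrable_shift (sub ht) _ (hj.meas_i t ht i) h0 (fun x => hC.Ui t ht x i)
  · exact ((hj.meas_ii t ht i).comp (measurable_shift_right α d t _)).aestronglyMeasurable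
  · refine ae_of_all _ fun ξ s hs' => ?_
    refine (expBound_shift h0 (hs t (sub ht) _ ξ) (hC.Uii t ht _ i)).trans ?_
    gcongr
    refine (sum_abs_update_le x i s).trans ?_
    gcongr
    have := abs_sub_abs_le_abs_sub s (x i)
    rw [Metric.mem_ball, Real.dist_eq] at hs'
    linarith
  · exact (integrable_gaussPi_exp_sum_abs _).const_mul _
  · refine ae_of_all _ fun ξ s _ => ?_
    have h1 := hj.hasDeriv t ht (shift α d t (Function.update x i s) ξ) i
    have h2 : HasDerivAt (fun s => s + Real.sqrt (α i + d i * t) * ξ i) 1 s :=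
      (hasDerivAt_id s).add_const _
    simp only [shift_update_left, Function.update_self, Function.update_idem] at h1 ⊢
    have h3 := HasDerivAt.comp s h1 h2
    rw [mul_one] at h3
    exact h3

lemma Jet.Regular.avg {j : Jet ι} (hj : j.Regular) {C : ℝ} (hC : j.ExpBound C) {α d : ι → ℝ}
    (hα : NoiseProfile α d) : (j.avg α d).Regular := by
  refine ⟨hj.continuousOn_avg hC, fun t ht x => hj.hasFDerivAt_avg hC hα ht x,
    fun t ht x i => hj.hasDerivAt_avg hC ht x i, ?_, ?_, ?_⟩
  · intro t ht
    exact measurable_integral_shift α d t ((hj.meas_t t ht).add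
      ((Finset.measurable_sum _ fun i _ => (hj.meas_ii t ht i).const_mul (d i)).const_mul (1 / 2)))
  · exact fun t ht i => measurable_integral_shift α d t (hj.meas_i t ht i)
  · exact fun t ht i => measurable_integral_shift α d t (hj.meas_ii t ht i)

end Calculus
end GaussianSpinGlass
end

noncomputable section

namespace GaussianSpinGlass

/-! ### Log-exponential means and tilted means -/

section Means
variable {Ω : Type*} [MeasurableSpace Ω]

/-- `(1/m) log E exp (m v)`, read as `E v` if `m = 0`. -/
def lme (μ : Measure Ω) (m : ℝ) (v : Ω → ℝ) : ℝ :=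
  if m = 0 then ∫ ω, v ω ∂μ else (1 / m) * Real.log (∫ ω, Real.exp (m * v ω) ∂μ)

/-- The mean of `X` with respect to the measure tilted by `exp (m v)`. -/
def tmean (μ : Measure Ω) (m : ℝ) (v X : Ω → ℝ) : ℝ :=
  (∫ ω, Real.exp (m * v ω) * X ω ∂μ) / ∫ ω, Real.exp (m * v ω) ∂μ

variable {μ : Measure Ω} {m : ℝ} {v w X Y : Ω → ℝ}

lemma lme_zero : lme μ 0 v = ∫ ω, v ω ∂μ := if_pos rfl

lemma lme_of_ne (hm : m ≠ 0) :
    lme μ m v = (1 / m) * Real.log (∫ ω, Real.exp (m * v ω) ∂μ) := if_neg hm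

section Probability
variable [IsProbabilityMeasure μ]

lemma tmean_zero : tmean μ 0 v X = ∫ ω, X ω ∂μ := by simp [tmean]

lemma lme_const (m c : ℝ) : lme μ m (fun _ => c) = c := by
  by_cases hm : m = 0
  · subst hm; simp [lme_zero]
  · rw [lme_of_ne hm]; simp [Real.log_exp, hm]

lemma lme_const_add (c : ℝ) (h : Integrable v μ) (he : Integrable (fun ω => Real.exp (m * v ω)) μ) :
    lme μ m (fun ω => c + v ω) = c + lme μ m v := by
  by_cases hm : m = 0
  · subst hm
    simp only [lme_zero]
    rw [integral_add (integrable_const _) h]; simp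
  · rw [lme_of_ne hm, lme_of_ne hm]
    simp_rw [mul_add, Real.exp_add]
    rw [integral_const_mul, Real.log_mul (Real.exp_ne_zero _) (integral_exp_pos he).ne',
      Real.log_exp]
    field_simp

lemma lme_mono (hm : 0 ≤ m) (hvw : ∀ ω, v ω ≤ w ω) (hv : Integrable v μ) (hw : Integrable w μ)
    (hev : Integrable (fun ω => Real.exp (m * v ω)) μ)
    (hew : Integrable (fun ω => Real.exp (m * w ω)) μ) : lme μ m v ≤ lme μ m w := by
  rcases hm.eq_or_lt with rfl | hm
  · simp only [lme_zero]; exact integral_mono hv hw hvw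
  · rw [lme_of_ne hm.ne', lme_of_ne hm.ne']
    refine mul_le_mul_of_nonneg_left (Real.log_le_log (integral_exp_pos hev)
      (integral_mono hev hew fun ω => ?_)) (by positivity)
    exact Real.exp_le_exp.2 (mul_le_mul_of_nonneg_left (hvw ω) hm.le)

lemma exp_integral_le (h : Integrable v μ) (he : Integrable (fun ω => Real.exp (v ω)) μ) :
    Real.exp (∫ ω, v ω ∂μ) ≤ ∫ ω, Real.exp (v ω) ∂μ := by
  have := convexOn_exp.map_integral_le (μ := μ) (f := v) Real.continuous_exp.continuousOn
    isClosed_univ (ae_of_all _ fun _ => trivial) h he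
  exact this

lemma integral_le_lme (hm : 0 ≤ m) (h : Integrable v μ)
    (he : Integrable (fun ω => Real.exp (m * v ω)) μ) : ∫ ω, v ω ∂μ ≤ lme μ m v := by
  rcases hm.eq_or_lt with rfl | hm
  · rw [lme_zero]
  · rw [lme_of_ne hm.ne']
    have h1 := exp_integral_le (h.const_mul m) he
    rw [integral_const_mul] at h1
    have h2 := Real.log_le_log (Real.exp_pos _) h1
    rw [Real.log_exp] at h2
    calc ∫ ω, v ω ∂μ = (1 / m) * (m * ∫ ω, v ω ∂μ) := by field_simp
      _ ≤ _ := by gcongr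

lemma abs_lme_le (hm : 0 ≤ m) {c : ℝ} {k : Ω → ℝ} (hk : Integrable k μ)
    (hek : Integrable (fun ω => Real.exp (m * k ω)) μ) (h : Integrable v μ)
    (he : Integrable (fun ω => Real.exp (m * v ω)) μ) (hv : ∀ ω, |v ω| ≤ c + k ω) :
    |lme μ m v| ≤ c + lme μ m k := by
  rw [abs_le]
  constructor
  · have h1 := integral_le_lme hm h he
    have h2 := integral_le_lme hm hk hek
    have h3 : ∫ ω, -(c + k ω) ∂μ ≤ ∫ ω, v ω ∂μ :=
      integral_mono ((integrable_const c).add hk).neg h fun ω => (abs_le.1 (hv ω)).1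
    rw [integral_neg, integral_add (integrable_const _) hk] at h3
    simp only [integral_const, probReal_univ, one_smul] at h3
    linarith
  · have hek' : Integrable (fun ω => Real.exp (m * (c + k ω))) μ := by
      simp_rw [mul_add, Real.exp_add]; exact hek.const_mul _
    rw [← lme_const_add c hk hek]
    exact lme_mono hm (fun ω => (abs_le.1 (hv ω)).2) h ((integrable_const c).add hk) he hek'

end Probability

lemma tmean_add (hX : Integrable (fun ω => Real.exp (m * v ω) * X ω) μ)
    (hY : Integrable (fun ω => Real.exp (m * v ω) * Y ω) μ) :
    tmean μ m v (fun ω => X ω + Y ω) = tmean μ m v X + tmean μ m v Y := by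
  simp only [tmean, mul_add]
  rw [integral_add hX hY, add_div]

lemma tmean_const_mul (c : ℝ) :
    tmean μ m v (fun ω => c * X ω) = c * tmean μ m v X := by
  simp only [tmean, mul_left_comm _ c]
  rw [integral_const_mul, mul_div_assoc]

lemma tmean_sub (hX : Integrable (fun ω => Real.exp (m * v ω) * X ω) μ)
    (hY : Integrable (fun ω => Real.exp (m * v ω) * Y ω) μ) :
    tmean μ m v (fun ω => X ω - Y ω) = tmean μ m v X - tmean μ m v Y := by
  simp only [tmean, mul_sub]
  rw [integral_sub hX hY, sub_div]

lemma tmean_sum {ι : Type*} (s : Finset ι) {X : ι → Ω → ℝ}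
    (hX : ∀ i ∈ s, Integrable (fun ω => Real.exp (m * v ω) * X i ω) μ) :
    tmean μ m v (fun ω => ∑ i ∈ s, X i ω) = ∑ i ∈ s, tmean μ m v (X i) := by
  simp only [tmean, Finset.mul_sum]
  rw [integral_finsetSum _ hX, Finset.sum_div]

lemma tmean_const [NeZero μ] (he : Integrable (fun ω => Real.exp (m * v ω)) μ) (c : ℝ) :
    tmean μ m v (fun _ => c) = c := by
  simp only [tmean]
  rw [integral_mul_const, mul_comm, mul_div_assoc, div_self (integral_exp_pos he).ne', mul_one]

lemma tmean_mono (hX : Integrable (fun ω => Real.exp (m * v ω) * X ω) μ)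
    (hY : Integrable (fun ω => Real.exp (m * v ω) * Y ω) μ) (h : ∀ ω, X ω ≤ Y ω) :
    tmean μ m v X ≤ tmean μ m v Y := by
  simp only [tmean]
  have h0 : 0 ≤ ∫ ω, Real.exp (m * v ω) ∂μ := integral_nonneg fun _ => Real.exp_nonneg _
  refine div_le_div_of_nonneg_right (integral_mono hX hY fun ω => ?_) h0
  exact mul_le_mul_of_nonneg_left (h ω) (Real.exp_nonneg _)

lemma tmean_nonneg (h : ∀ ω, 0 ≤ X ω) : 0 ≤ tmean μ m v X :=
  div_nonneg (integral_nonneg fun ω => mul_nonneg (Real.exp_nonneg _) (h ω))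
    (integral_nonneg fun _ => Real.exp_nonneg _)

lemma abs_tmean_le [NeZero μ] (he : Integrable (fun ω => Real.exp (m * v ω)) μ) {C : ℝ}
    (h : ∀ ω, |X ω| ≤ C) : |tmean μ m v X| ≤ C := by
  have h0 := integral_exp_pos he
  rw [tmean, abs_div, abs_of_pos h0, div_le_iff₀ h0, ← integral_const_mul]
  rw [← Real.norm_eq_abs]
  refine norm_integral_le_of_norm_le (he.const_mul C) (ae_of_all _ fun ω => ?_)
  rw [norm_mul, Real.norm_of_nonneg (Real.exp_nonneg _), mul_comm]
  exact mul_le_mul_of_nonneg_right (h ω) (Real.exp_nonneg _)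

end Means

/-! ### Jets of log-exponential means -/

section Calculus
variable {ι : Type*} [Fintype ι]

lemma smul_spaceTimeForm (c a : ℝ) (b : ι → ℝ) :
    c • spaceTimeForm a b = spaceTimeForm (c * a) (fun i => c * b i) := by
  refine ContinuousLinearMap.ext fun p => ?_
  simp only [smul_apply, spaceTimeForm_apply, smul_eq_mul, mul_add,
    Finset.mul_sum, mul_assoc]

/-- The jet of `exp (m U)`. -/
def Jet.expJet (j : Jet ι) (m : ℝ) : Jet ι where
  U t x := Real.exp (m * j.U t x)
  Ut t x := Real.exp (m * j.U t x) * (m * j.Ut t x)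
  Ui i t x := Real.exp (m * j.U t x) * (m * j.Ui i t x)
  Uii i t x := Real.exp (m * j.U t x) * (m * (j.Uii i t x + m * j.Ui i t x ^ 2))

/-- The jet of `(1/m) log U`. -/
def Jet.logJet (j : Jet ι) (m : ℝ) : Jet ι where
  U t x := (1 / m) * Real.log (j.U t x)
  Ut t x := (1 / m) * (j.Ut t x / j.U t x)
  Ui i t x := (1 / m) * (j.Ui i t x / j.U t x)
  Uii i t x := (1 / m) * (j.Uii i t x / j.U t x - (j.Ui i t x / j.U t x) ^ 2)

variable [DecidableEq ι]

lemma Jet.Regular.hasDerivAt_U {j : Jet ι} (hj : j.Regular) {t : ℝ}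
    (ht : t ∈ Set.Ioo (0 : ℝ) 1) (x : ι → ℝ) (i : ι) :
    HasDerivAt (fun s => j.U t (Function.update x i s)) (j.Ui i t x) (x i) := by
  have h1 := hj.hasFDeriv t ht x
  have h2 : HasDerivAt (fun s : ℝ => (t, Function.update x i s)) (0, Pi.single i 1) (x i) :=
    (hasDerivAt_const _ t).prodMk (hasDerivAt_update x i (x i))
  have e : (t, x) = (t, Function.update x i (x i)) := by simp
  rw [e] at h1
  have h3 := h1.comp_hasDerivAt (x i) h2
  refine h3.congr_deriv ?_
  simp [spaceTimeForm_apply, Pi.single_apply]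

lemma Jet.Regular.expJet {j : Jet ι} (hj : j.Regular) (m : ℝ) : (j.expJet m).Regular := by
  refine ⟨?_, ?_, ?_, ?_, ?_, ?_⟩
  · exact (hj.cont.const_mul m).rexp
  · intro t ht x
    refine ((hj.hasFDeriv t ht x).const_mul m).exp.congr_fderiv ?_
    rw [smul_spaceTimeForm, smul_spaceTimeForm]
    rfl
  · intro t ht x i
    have h1 := ((hj.hasDerivAt_U ht x i).const_mul m).exp
    have h2 := (hj.hasDeriv t ht x i).const_mul m
    refine (h1.mul h2).congr_deriv ?_
    simp only [Function.update_eq_self, Jet.expJet]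
    ring
  · intro t ht
    have hU := hj.measurable (Set.Ioo_subset_Icc_self ht)
    have := hj.meas_t t ht
    simp only [Jet.expJet]; fun_prop
  · intro t ht i
    have hU := hj.measurable (Set.Ioo_subset_Icc_self ht)
    have := hj.meas_i t ht i
    simp only [Jet.expJet]; fun_prop
  · intro t ht i
    have hU := hj.measurable (Set.Ioo_subset_Icc_self ht)
    have := hj.meas_i t ht i
    have := hj.meas_ii t ht i
    simp only [Jet.expJet]; fun_prop

lemma Jet.Regular.logJet {j : Jet ι} (hj : j.Regular) (m : ℝ)
    (hpos : ∀ t ∈ Set.Icc (0 : ℝ) 1, ∀ x, 0 < j.U t x) : (j.logJet m).Regular := by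
  refine ⟨?_, ?_, ?_, ?_, ?_, ?_⟩
  · exact (hj.cont.log fun p hp => (hpos p.1 hp.1 p.2).ne').const_mul _
  · intro t ht x
    refine (((hj.hasFDeriv t ht x).log
      (hpos t (Set.Ioo_subset_Icc_self ht) x).ne').const_mul (1 / m)).congr_fderiv ?_
    rw [smul_spaceTimeForm, smul_spaceTimeForm]
    simp only [Jet.logJet, div_eq_inv_mul]
  · intro t ht x i
    have hp := (hpos t (Set.Ioo_subset_Icc_self ht) x).ne'
    have h1 := hj.hasDerivAt_U ht x i
    have h2 := hj.hasDeriv t ht x i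
    refine ((h2.div h1 (by simpa using hp)).const_mul (1 / m)).congr_deriv ?_
    simp only [Function.update_eq_self, Jet.logJet]
    field_simp
  · intro t ht
    have hU := hj.measurable (Set.Ioo_subset_Icc_self ht)
    have := hj.meas_t t ht
    simp only [Jet.logJet]; fun_prop
  · intro t ht i
    have hU := hj.measurable (Set.Ioo_subset_Icc_self ht)
    have := hj.meas_i t ht i
    simp only [Jet.logJet]; fun_prop
  · intro t ht i
    have hU := hj.measurable (Set.Ioo_subset_Icc_self ht)
    have := hj.meas_i t ht i
    have := hj.meas_ii t ht i
    simp only [Jet.logJet]; fun_prop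

lemma Jet.LinBound.exp_le {j : Jet ι} {C : ℝ} (hC : j.LinBound C) (m : ℝ) {t : ℝ}
    (ht : t ∈ Set.Icc (0 : ℝ) 1) (x : ι → ℝ) :
    Real.exp (m * j.U t x) ≤ Real.exp (|m| * C) * Real.exp (|m| * C * ∑ i, |x i|) := by
  rw [← Real.exp_add]
  gcongr
  calc m * j.U t x ≤ |m * j.U t x| := le_abs_self _
    _ = |m| * |j.U t x| := abs_mul _ _
    _ ≤ |m| * (C * (1 + ∑ i, |x i|)) := by gcongr; exact hC.U t ht x
    _ = _ := by ring

lemma Jet.LinBound.expJet {j : Jet ι} {C : ℝ} (hC : j.LinBound C) (m : ℝ) :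
    ∃ C', (j.expJet m).ExpBound C' := by
  have h0 := hC.nonneg
  set E := Real.exp (|m| * C)
  have hE : 0 ≤ E := Real.exp_nonneg _
  set D := |m| * C + E + E * (|m| * C) + E * (|m| * (C + |m| * C ^ 2)) with hD
  have hD1 : |m| * C ≤ D := by
    have : 0 ≤ E + E * (|m| * C) + E * (|m| * (C + |m| * C ^ 2)) := by positivity
    linarith
  have hD2 : E ≤ D := by
    have : 0 ≤ |m| * C + E * (|m| * C) + E * (|m| * (C + |m| * C ^ 2)) := by positivity
    linarith
  have hD3 : E * (|m| * C) ≤ D := by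
    have : 0 ≤ |m| * C + E + E * (|m| * (C + |m| * C ^ 2)) := by positivity
    linarith
  have hD4 : E * (|m| * (C + |m| * C ^ 2)) ≤ D := by
    have : 0 ≤ |m| * C + E + E * (|m| * C) := by positivity
    linarith
  have hD0 : 0 ≤ D := by positivity
  have main : ∀ t ∈ Set.Icc (0 : ℝ) 1, ∀ x : ι → ℝ, ∀ v B : ℝ, |v| ≤ B → E * B ≤ D →
      |Real.exp (m * j.U t x) * v| ≤ D * Real.exp (D * ∑ i, |x i|) := by
    intro t ht x v B hv hB
    have hB0 : 0 ≤ B := (abs_nonneg v).trans hv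
    rw [abs_mul, abs_of_pos (Real.exp_pos _)]
    calc Real.exp (m * j.U t x) * |v|
        ≤ (E * Real.exp (|m| * C * ∑ i, |x i|)) * B := by
          gcongr
          exact hC.exp_le m ht x
      _ = (E * B) * Real.exp (|m| * C * ∑ i, |x i|) := by ring
      _ ≤ _ := by gcongr
  have sub := @Set.Ioo_subset_Icc_self ℝ _ 0 1
  refine ⟨D, hD0, ?_, ?_, ?_, ?_⟩
  · intro t ht x
    simpa [Jet.expJet] using main t ht x 1 1 (by simp) (by simpa using hD2)
  · intro t ht x
    refine main t (sub ht) x _ (|m| * C) ?_ hD3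
    rw [abs_mul]; gcongr; exact hC.Ut t ht x
  · intro t ht x i
    refine main t (sub ht) x _ (|m| * C) ?_ hD3
    rw [abs_mul]; gcongr; exact hC.Ui t ht x i
  · intro t ht x i
    refine main t (sub ht) x _ (|m| * (C + |m| * C ^ 2)) ?_ hD4
    rw [abs_mul]; gcongr
    refine (abs_add_le _ _).trans ?_
    rw [abs_mul, abs_pow]
    gcongr
    · exact hC.Uii t ht x i
    · exact hC.Ui t ht x i

lemma Jet.LinBound.expBound {j : Jet ι} {C : ℝ} (hC : j.LinBound C) : j.ExpBound (C + 1) := by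
  have h0 := hC.nonneg
  have hs : ∀ x : ι → ℝ, 0 ≤ ∑ i, |x i| := fun x => by positivity
  have main : ∀ {v : ℝ} {x : ι → ℝ}, |v| ≤ C * (1 + ∑ i, |x i|) →
      |v| ≤ (C + 1) * Real.exp ((C + 1) * ∑ i, |x i|) := by
    intro v x h
    have hx := hs x
    refine h.trans ?_
    have h1 : 1 + ∑ i, |x i| ≤ Real.exp ((C + 1) * ∑ i, |x i|) := by
      have h2 := Real.add_one_le_exp ((C + 1) * ∑ i, |x i|)
      have := mul_nonneg h0 hx
      linarith
    have := Real.exp_nonneg ((C + 1) * ∑ i, |x i|)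
    nlinarith
  have main' : ∀ {v : ℝ} {x : ι → ℝ}, |v| ≤ C → |v| ≤ C * (1 + ∑ i, |x i|) := by
    intro v x h
    have := mul_nonneg h0 (hs x)
    linarith
  exact ⟨by linarith, fun t ht x => main (hC.U t ht x), fun t ht x => main (main' (hC.Ut t ht x)),
    fun t ht x i => main (main' (hC.Ui t ht x i)), fun t ht x i => main (main' (hC.Uii t ht x i))⟩

/-- The tilted mean of `X` under the noise of one level. -/
def Jet.tilt (j : Jet ι) (m : ℝ) (α d : ι → ℝ) (X : ℝ → (ι → ℝ) → ℝ) (t : ℝ) (x : ι → ℝ) : ℝ :=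
  tmean (gaussPi ι) m (fun ξ => j.U t (shift α d t x ξ)) (fun ξ => X t (shift α d t x ξ))

/-- The jet of the log-exponential mean over the noise of one level. -/
def Jet.step (j : Jet ι) (m : ℝ) (α d : ι → ℝ) : Jet ι where
  U t x := lme (gaussPi ι) m (fun ξ => j.U t (shift α d t x ξ))
  Ut t x := j.tilt m α d (fun t x =>
    j.Ut t x + 1 / 2 * ∑ i, d i * (j.Uii i t x + m * j.Ui i t x ^ 2)) t x
  Ui i t x := j.tilt m α d (j.Ui i) t x
  Uii i t x := j.tilt m α d (fun t x => j.Uii i t x + m * j.Ui i t x ^ 2) t x -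
    m * j.tilt m α d (j.Ui i) t x ^ 2

lemma Jet.step_zero (j : Jet ι) (α d : ι → ℝ) : j.step 0 α d = j.avg α d := by
  simp [Jet.step, Jet.avg, Jet.tilt, tmean_zero, lme_zero]

lemma Jet.step_of_ne (j : Jet ι) {m : ℝ} (hm : m ≠ 0) (α d : ι → ℝ) :
    j.step m α d = ((j.expJet m).avg α d).logJet m := by
  have pull : ∀ (f g : (ι → ℝ) → ℝ), ∫ ξ, Real.exp (m * f ξ) * (m * g ξ) ∂(gaussPi ι) =
      m * ∫ ξ, Real.exp (m * f ξ) * g ξ ∂(gaussPi ι) := by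
    intro f g
    rw [← integral_const_mul]
    congr 1; ext ξ; ring
  have cancel : ∀ a b : ℝ, 1 / m * (m * a / b) = a / b := by intro a b; field_simp
  simp only [Jet.step, Jet.logJet, Jet.avg, Jet.expJet, Jet.tilt, tmean, lme_of_ne hm, pull]
  congr 1
  · ext t x
    have : ∀ ξ, Real.exp (m * j.U t (shift α d t x ξ)) * (m * j.Ut t (shift α d t x ξ)) +
        1 / 2 * ∑ i, d i * (Real.exp (m * j.U t (shift α d t x ξ)) *
          (m * (j.Uii i t (shift α d t x ξ) + m * j.Ui i t (shift α d t x ξ) ^ 2))) =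
        Real.exp (m * j.U t (shift α d t x ξ)) * (m * (j.Ut t (shift α d t x ξ) +
          1 / 2 * ∑ i, d i * (j.Uii i t (shift α d t x ξ) +
            m * j.Ui i t (shift α d t x ξ) ^ 2))) := by
      intro ξ
      simp only [mul_add, Finset.mul_sum]
      congr 1
      refine Finset.sum_congr rfl fun i _ => by ring
    simp_rw [this, pull, cancel]
  · ext i t x
    rw [cancel]
  · ext i t x
    rw [mul_sub, cancel]
    field_simp

lemma Jet.Regular.integrable_exp {j : Jet ι} (hj : j.Regular) {C : ℝ} (hC : j.LinBound C)
    (m : ℝ) (α d : ι → ℝ) {t : ℝ} (ht : t ∈ Set.Icc (0 : ℝ) 1) (x : ι → ℝ) :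
    Integrable (fun ξ => Real.exp (m * j.U t (shift α d t x ξ))) (gaussPi ι) := by
  obtain ⟨C', hC'⟩ := hC.expJet m
  exact integrable_shift ht x ((hj.expJet m).measurable ht) hC'.nonneg (hC'.U t ht)

lemma Jet.Regular.step {j : Jet ι} (hj : j.Regular) {C : ℝ} (hC : j.LinBound C) (m : ℝ)
    {α d : ι → ℝ} (hα : NoiseProfile α d) : (j.step m α d).Regular := by
  by_cases hm : m = 0
  · subst hm
    rw [Jet.step_zero]
    exact hj.avg hC.expBound hα
  · rw [Jet.step_of_ne j hm]
    obtain ⟨C', hC'⟩ := hC.expJet m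
    refine ((hj.expJet m).avg hC' hα).logJet m fun t ht x => ?_
    exact integral_exp_pos (hj.integrable_exp hC m α d ht x)

lemma Jet.LinBound.step {j : Jet ι} (hj : j.Regular) {C : ℝ} (hC : j.LinBound C) {m : ℝ}
    (hm : 0 ≤ m) (α d : ι → ℝ) : ∃ C', (j.step m α d).LinBound C' := by
  have h0 := hC.nonneg
  obtain ⟨A, hA, hs⟩ := exists_sum_abs_shift_le α d
  have sub := @Set.Ioo_subset_Icc_self ℝ _ 0 1
  let k : (ι → ℝ) → ℝ := fun ξ => C * A * ∑ i, |ξ i|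
  have hk : Integrable k (gaussPi ι) := by
    refine integrable_of_expBound (C := 1) (D := C * A) (by fun_prop) fun ξ => ?_
    have h1 := Real.add_one_le_exp (1 * ∑ i, |ξ i|)
    have : (0 : ℝ) ≤ ∑ i, |ξ i| := by positivity
    simp only [k]
    rw [abs_of_nonneg (by positivity)]
    gcongr
    linarith
  have hek : Integrable (fun ξ => Real.exp (m * k ξ)) (gaussPi ι) := by
    simp only [k, ← mul_assoc]; exact integrable_gaussPi_exp_sum_abs _
  set M := lme (gaussPi ι) m k with hM
  have hM0 : 0 ≤ M := (integral_nonneg fun ξ => by positivity).trans (integral_le_lme hm hk hek)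
  set B := C + m * C ^ 2 with hB
  set D := (C + M) + (C + 1 / 2 * ∑ i, |d i| * B) + (B + m * C ^ 2) with hD
  have hB0 : 0 ≤ B := by positivity
  have p1 : 0 ≤ 1 / 2 * ∑ i, |d i| * B := by positivity
  have p2 : 0 ≤ m * C ^ 2 := by positivity
  have bB : ∀ t ∈ Set.Ioo (0 : ℝ) 1, ∀ x i, |j.Uii i t x + m * j.Ui i t x ^ 2| ≤ B := by
    intro t ht x i
    refine (abs_add_le _ _).trans ?_
    rw [abs_mul, abs_of_nonneg hm, abs_pow]
    exact add_le_add (hC.Uii t ht x i)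
      (mul_le_mul_of_nonneg_left (pow_le_pow_left₀ (abs_nonneg _) (hC.Ui t ht x i) 2) hm)
  have bi : ∀ t ∈ Set.Ioo (0 : ℝ) 1, ∀ x i, |j.tilt m α d (j.Ui i) t x| ≤ C := fun t ht x i =>
    abs_tmean_le (hj.integrable_exp hC m α d (sub ht) x) fun ξ => hC.Ui t ht _ i
  refine ⟨D, by positivity, ?_, ?_, ?_, ?_⟩
  · intro t ht x
    have := abs_lme_le (μ := gaussPi ι) hm (c := C * (1 + ∑ i, |x i|)) hk hek
      (v := fun ξ => j.U t (shift α d t x ξ))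
      (integrable_shift ht x (hj.measurable ht) (by linarith) (hC.expBound.U t ht))
      (hj.integrable_exp hC m α d ht x) (fun ξ => by
        refine (hC.U t ht _).trans ?_
        have := hs t ht x ξ
        simp only [k]
        calc C * (1 + ∑ i, |shift α d t x ξ i|)
            ≤ C * (1 + (∑ i, |x i| + A * ∑ i, |ξ i|)) := by gcongr
          _ = _ := by ring)
    refine this.trans ?_
    have hx : (0 : ℝ) ≤ ∑ i, |x i| := by positivity
    rw [← hM]
    nlinarith
  · intro t ht x
    have : |(j.step m α d).Ut t x| ≤ C + 1 / 2 * ∑ i, |d i| * B := by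
      refine abs_tmean_le (hj.integrable_exp hC m α d (sub ht) x) fun ξ => ?_
      refine (abs_add_le _ _).trans (add_le_add (hC.Ut t ht _) ?_)
      rw [abs_mul, abs_of_pos (by norm_num : (0 : ℝ) < 1 / 2)]
      gcongr
      refine (Finset.abs_sum_le_sum_abs _ _).trans (Finset.sum_le_sum fun i _ => ?_)
      rw [abs_mul]
      exact mul_le_mul_of_nonneg_left (bB t ht _ i) (abs_nonneg _)
    linarith
  · intro t ht x i
    refine (bi t ht x i).trans ?_
    linarith
  · intro t ht x i
    have h1 : |j.tilt m α d (fun t x => j.Uii i t x + m * j.Ui i t x ^ 2) t x| ≤ B :=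
      abs_tmean_le (hj.integrable_exp hC m α d (sub ht) x) fun ξ => bB t ht _ i
    have h2 : |m * j.tilt m α d (j.Ui i) t x ^ 2| ≤ m * C ^ 2 := by
      rw [abs_mul, abs_of_nonneg hm, abs_pow]
      exact mul_le_mul_of_nonneg_left
        (pow_le_pow_left₀ (abs_nonneg _) (bi t ht x i) 2) hm
    have h3 := abs_sub (j.tilt m α d (fun t x => j.Uii i t x + m * j.Ui i t x ^ 2) t x)
      (m * j.tilt m α d (j.Ui i) t x ^ 2)
    simp only [Jet.step]
    linarith

end Calculus
end GaussianSpinGlass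
end

noncomputable section

namespace GaussianSpinGlass

section Calculus
variable {ι : Type*} [Fintype ι] [DecidableEq ι]

lemma Jet.Regular.integrable_exp_mul {j : Jet ι} (hj : j.Regular) {C : ℝ} (hC : j.LinBound C)
    (m : ℝ) (α d : ι → ℝ) {t : ℝ} (ht : t ∈ Set.Icc (0 : ℝ) 1) (x : ι → ℝ)
    {X : (ι → ℝ) → ℝ} (hm : Measurable X) {B : ℝ} (hX : ∀ x, |X x| ≤ B) :
    Integrable (fun ξ => Real.exp (m * j.U t (shift α d t x ξ)) * X (shift α d t x ξ))
      (gaussPi ι) := by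
  have h := hj.integrable_exp hC m α d ht x
  refine (h.mul_const B).mono' (h.1.mul
    (hm.comp (measurable_shift_right α d t x)).aestronglyMeasurable) (ae_of_all _ fun ξ => ?_)
  rw [norm_mul, Real.norm_of_nonneg (Real.exp_nonneg _)]
  exact mul_le_mul_of_nonneg_left (hX _) (Real.exp_nonneg _)

lemma Jet.step_heat {j : Jet ι} (hj : j.Regular) {C : ℝ} (hC : j.LinBound C) {m : ℝ}
    (hm : 0 ≤ m) (α d r : ι → ℝ) {t : ℝ} (ht : t ∈ Set.Ioo (0 : ℝ) 1) (x : ι → ℝ) :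
    (j.step m α d).Ut t x + 1 / 2 * ∑ i, (r i - d i) * (j.step m α d).Uii i t x =
      j.tilt m α d (fun t x => (j.Ut t x + 1 / 2 * ∑ i, r i * j.Uii i t x) +
        m / 2 * ∑ i, r i * j.Ui i t x ^ 2) t x -
      m / 2 * ∑ i, (r i - d i) * (j.step m α d).Ui i t x ^ 2 := by
  have sub := @Set.Ioo_subset_Icc_self ℝ _ 0 1
  have h0 := hC.nonneg
  have bB : ∀ x i, |j.Uii i t x + m * j.Ui i t x ^ 2| ≤ C + m * C ^ 2 := by
    intro x i
    refine (abs_add_le _ _).trans ?_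
    rw [abs_mul, abs_of_nonneg hm, abs_pow]
    exact add_le_add (hC.Uii t ht x i)
      (mul_le_mul_of_nonneg_left (pow_le_pow_left₀ (abs_nonneg _) (hC.Ui t ht x i) 2) hm)
  have hmi := fun i => hj.meas_i t ht i
  have hmii := fun i => hj.meas_ii t ht i
  have i1 := hj.integrable_exp_mul hC m α d (sub ht) x (hj.meas_t t ht) (hC.Ut t ht)
  have i2 := fun i => hj.integrable_exp_mul hC m α d (sub ht) x
    ((hmii i).add (((hmi i).pow_const 2).const_mul m)) (fun x => bB x i)
  have i3 : ∀ c : ι → ℝ, ∀ i ∈ Finset.univ, Integrable (fun ξ =>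
      Real.exp (m * j.U t (shift α d t x ξ)) *
      (c i * (j.Uii i t (shift α d t x ξ) + m * j.Ui i t (shift α d t x ξ) ^ 2))) (gaussPi ι) := by
    intro c i _
    refine ((i2 i).const_mul (c i)).congr (ae_of_all _ fun ξ => ?_)
    simp only [Pi.add_apply]
    ring
  have key : ∀ c : ι → ℝ, j.tilt m α d (fun t x => j.Ut t x +
      1 / 2 * ∑ i, c i * (j.Uii i t x + m * j.Ui i t x ^ 2)) t x =
      j.tilt m α d j.Ut t x + 1 / 2 * ∑ i, c i *
        j.tilt m α d (fun t x => j.Uii i t x + m * j.Ui i t x ^ 2) t x := by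
    intro c
    simp only [Jet.tilt]
    rw [tmean_add i1, tmean_const_mul, tmean_sum _ (i3 c)]
    · simp_rw [tmean_const_mul]
    · have := (integrable_finsetSum _ (i3 c)).const_mul (1 / 2)
      refine this.congr (ae_of_all _ fun ξ => ?_)
      simp only [← Finset.mul_sum]
      ring
  have e1 : (fun t x => (j.Ut t x + 1 / 2 * ∑ i, r i * j.Uii i t x) +
        m / 2 * ∑ i, r i * j.Ui i t x ^ 2) = fun t x => j.Ut t x +
      1 / 2 * ∑ i, r i * (j.Uii i t x + m * j.Ui i t x ^ 2) := by
    ext t x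
    rw [add_assoc]
    congr 1
    simp only [mul_add, Finset.sum_add_distrib, Finset.mul_sum]
    congr 1
    exact Finset.sum_congr rfl fun i _ => by ring
  rw [e1, key r]
  have e2 := key d
  simp only [Jet.step] at e2 ⊢
  rw [e2]
  simp only [Finset.mul_sum]
  rw [add_assoc, ← Finset.sum_add_distrib, add_sub_assoc, ← Finset.sum_sub_distrib]
  congr 1
  exact Finset.sum_congr rfl fun i _ => by ring

variable {Z : Type*} [MeasurableSpace Z]

/-- The exponent `x · w(z) + a(z) + t b(z)`. -/
def energy (w : ι → Z → ℝ) (a b : Z → ℝ) (t : ℝ) (x : ι → ℝ) (z : Z) : ℝ :=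
  ∑ i, x i * w i z + a z + t * b z

/-- Measurability and almost sure boundedness of the data of a model. -/
structure BoundedModel (ν : Measure Z) (w : ι → Z → ℝ) (a b : Z → ℝ) (R : ℝ) : Prop where
  meas_w : ∀ i, Measurable (w i)
  meas_a : Measurable a
  meas_b : Measurable b
  nonneg : 0 ≤ R
  bd_w : ∀ᵐ z ∂ν, ∀ i, |w i z| ≤ R
  bd_a : ∀ᵐ z ∂ν, |a z| ≤ R
  bd_b : ∀ᵐ z ∂ν, |b z| ≤ R

/-- The jet of the partition function. -/
def partitionJet (ν : Measure Z) (w : ι → Z → ℝ) (a b : Z → ℝ) : Jet ι where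
  U t x := ∫ z, Real.exp (energy w a b t x z) ∂ν
  Ut t x := ∫ z, Real.exp (energy w a b t x z) * b z ∂ν
  Ui i t x := ∫ z, Real.exp (energy w a b t x z) * w i z ∂ν
  Uii i t x := ∫ z, Real.exp (energy w a b t x z) * w i z ^ 2 ∂ν

/-- The jet of the free energy. -/
def freeEnergyJet (ν : Measure Z) (w : ι → Z → ℝ) (a b : Z → ℝ) : Jet ι :=
  (partitionJet ν w a b).logJet 1

variable {ν : Measure Z} {w : ι → Z → ℝ} {a b : Z → ℝ} {R : ℝ}

lemma BoundedModel.measurable_energy (h : BoundedModel ν w a b R) (t : ℝ) :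
    Measurable (fun p : (ι → ℝ) × Z => energy w a b t p.1 p.2) := by
  have := h.meas_w
  have := h.meas_a
  have := h.meas_b
  unfold energy
  fun_prop

lemma BoundedModel.measurable_energy_right (h : BoundedModel ν w a b R) (t : ℝ) (x : ι → ℝ) :
    Measurable (energy w a b t x) := by
  have := h.meas_w
  have := h.meas_a
  have := h.meas_b
  unfold energy
  fun_prop

lemma BoundedModel.abs_energy_le (h : BoundedModel ν w a b R) :
    ∀ᵐ z ∂ν, ∀ t x, |energy w a b t x z| ≤ R * ∑ i, |x i| + R + |t| * R := by
  filter_upwards [h.bd_w, h.bd_a, h.bd_b] with z h1 h2 h3 t x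
  have h0 := h.nonneg
  unfold energy
  refine (abs_add_le _ _).trans (add_le_add ((abs_add_le _ _).trans (add_le_add ?_ h2)) ?_)
  · refine (Finset.abs_sum_le_sum_abs _ _).trans ?_
    rw [Finset.mul_sum]
    refine Finset.sum_le_sum fun i _ => ?_
    rw [abs_mul, mul_comm]
    exact mul_le_mul_of_nonneg_right (h1 i) (abs_nonneg _)
  · rw [abs_mul]; exact mul_le_mul_of_nonneg_left h3 (abs_nonneg _)

variable [IsFiniteMeasure ν]

lemma BoundedModel.integrable (h : BoundedModel ν w a b R) (t : ℝ) (x : ι → ℝ) {X : Z → ℝ}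
    (hX : Measurable X) {B : ℝ} (hB : ∀ᵐ z ∂ν, |X z| ≤ B) :
    Integrable (fun z => Real.exp (energy w a b t x z) * X z) ν := by
  refine Integrable.mono' (integrable_const (Real.exp (R * ∑ i, |x i| + R + |t| * R) * B))
    ((h.measurable_energy_right t x).exp.mul hX).aestronglyMeasurable ?_
  filter_upwards [h.abs_energy_le, hB] with z h1 h2
  rw [norm_mul, Real.norm_of_nonneg (Real.exp_nonneg _)]
  exact mul_le_mul (Real.exp_le_exp.2 ((le_abs_self _).trans (h1 t x))) h2 (abs_nonneg _)
    (Real.exp_nonneg _)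

lemma BoundedModel.integrable_exp (h : BoundedModel ν w a b R) (t : ℝ) (x : ι → ℝ) :
    Integrable (fun z => Real.exp (energy w a b t x z)) ν := by
  simpa using h.integrable t x (X := fun _ => 1) measurable_const (B := 1) (by simp)

lemma BoundedModel.measurable_integral (h : BoundedModel ν w a b R) (t : ℝ) {X : Z → ℝ}
    (hX : Measurable X) :
    Measurable (fun x => ∫ z, Real.exp (energy w a b t x z) * X z ∂ν) := by
  have : StronglyMeasurable (fun p : (ι → ℝ) × Z => Real.exp (energy w a b t p.1 p.2) * X p.2) :=
    ((h.measurable_energy t).exp.mul (hX.comp measurable_snd)).stronglyMeasurable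
  exact this.integral_prod_right.measurable

lemma BoundedModel.hasFDerivAt (h : BoundedModel ν w a b R) (t : ℝ) (x : ι → ℝ) :
    HasFDerivAt (fun p : ℝ × (ι → ℝ) => (partitionJet ν w a b).U p.1 p.2)
      (spaceTimeForm ((partitionJet ν w a b).Ut t x) (fun i => (partitionJet ν w a b).Ui i t x))
      (t, x) := by
  have h0 := h.nonneg
  have ib : Integrable (fun z => Real.exp (energy w a b t x z) * b z) ν :=
    h.integrable t x h.meas_b h.bd_b
  have iw : ∀ i, Integrable (fun z => Real.exp (energy w a b t x z) * w i z) ν := fun i =>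
    h.integrable t x (h.meas_w i) (h.bd_w.mono fun z hz => hz i)
  have hd : ∀ z, ∀ p : ℝ × (ι → ℝ), HasFDerivAt
      (fun p : ℝ × (ι → ℝ) => Real.exp (energy w a b p.1 p.2 z))
      (spaceTimeForm (Real.exp (energy w a b p.1 p.2 z) * b z)
        (fun i => Real.exp (energy w a b p.1 p.2 z) * w i z)) p := by
    intro z p
    rw [← smul_spaceTimeForm]
    refine HasFDerivAt.exp ?_
    have e : (fun p : ℝ × (ι → ℝ) => energy w a b p.1 p.2 z) =
        fun p => spaceTimeForm (b z) (fun i => w i z) p + a z := by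
      ext p
      rw [spaceTimeForm_apply, energy]
      simp_rw [mul_comm (w _ z)]
      ring
    rw [e]
    exact (ContinuousLinearMap.hasFDerivAt _).add_const _
  let card : ℝ := Fintype.card ι
  have key := hasFDerivAt_integral_of_dominated_of_fderiv_le (𝕜 := ℝ) (μ := ν)
    (F := fun (p : ℝ × (ι → ℝ)) z => Real.exp (energy w a b p.1 p.2 z))
    (F' := fun p z => spaceTimeForm (Real.exp (energy w a b p.1 p.2 z) * b z)
        (fun i => Real.exp (energy w a b p.1 p.2 z) * w i z)) (x₀ := (t, x))
    (s := {p | ∑ i, |p.2 i| < ∑ i, |x i| + 1 ∧ |p.1| < |t| + 1})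
    (bound := fun _ => Real.exp (R * (∑ i, |x i| + 1) + R + (|t| + 1) * R) * (R + card * R))
    ?_ ?_ ?_ ?_ ?_ ?_ ?_
  · rw [integral_spaceTimeForm ib iw] at key
    exact key
  · have o1 : IsOpen {p : ℝ × (ι → ℝ) | ∑ i, |p.2 i| < ∑ i, |x i| + 1} :=
      isOpen_lt (by fun_prop) (by fun_prop)
    have o2 : IsOpen {p : ℝ × (ι → ℝ) | |p.1| < |t| + 1} :=
      isOpen_lt (by fun_prop) (by fun_prop)
    exact (o1.inter o2).mem_nhds (by simp)
  · exact Eventually.of_forall fun p =>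
      (h.measurable_energy_right p.1 p.2).exp.aestronglyMeasurable
  · exact h.integrable_exp t x
  · simp only [spaceTimeForm]
    exact ((ib.1.smul_const _).add (Finset.aestronglyMeasurable_fun_sum _ fun i _ =>
      (iw i).1.smul_const _))
  · filter_upwards [h.abs_energy_le, h.bd_w, h.bd_b] with z h1 h2 h3 p hp
    refine (norm_spaceTimeForm_le _ _).trans ?_
    simp_rw [abs_mul, abs_of_pos (Real.exp_pos _)]
    rw [← Finset.mul_sum, ← mul_add]
    have : |b z| + ∑ i, |w i z| ≤ R + card * R := by
      refine add_le_add h3 ((Finset.sum_le_sum fun i _ => h2 i).trans ?_)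
      simp [card]
    refine mul_le_mul (Real.exp_le_exp.2 ((le_abs_self _).trans ((h1 p.1 p.2).trans ?_))) this
      (by positivity) (Real.exp_nonneg _)
    gcongr
    · exact hp.1.le
    · exact hp.2.le
  · exact integrable_const _
  · exact ae_of_all _ fun z p _ => hd z p

lemma energy_update (t : ℝ) (x : ι → ℝ) (i : ι) (s : ℝ) (z : Z) :
    energy w a b t (Function.update x i s) z = energy w a b t x z + (s - x i) * w i z := by
  have e : ∀ k, Function.update x i s k * w k z =
      Function.update (fun k => x k * w k z) i (s * w i z) k := by
    intro k
    by_cases hk : k = i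
    · subst hk; simp
    · simp [Function.update_of_ne hk]
  simp only [energy, e]
  rw [Finset.sum_update_of_mem (Finset.mem_univ i),
    ← Finset.add_sum_erase _ (fun k => x k * w k z) (Finset.mem_univ i),
    Finset.sdiff_singleton_eq_erase]
  ring

lemma BoundedModel.hasDerivAt (h : BoundedModel ν w a b R) (t : ℝ) (x : ι → ℝ) (i : ι) :
    HasDerivAt (fun s => (partitionJet ν w a b).Ui i t (Function.update x i s))
      ((partitionJet ν w a b).Uii i t x) (x i) := by
  have h0 := h.nonneg
  have hw := h.meas_w i
  have key := hasDerivAt_integral_of_dominated_loc_of_deriv_le (𝕜 := ℝ) (μ := ν)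
    (F := fun s z => Real.exp (energy w a b t (Function.update x i s) z) * w i z)
    (F' := fun s z => Real.exp (energy w a b t (Function.update x i s) z) * w i z ^ 2)
    (x₀ := x i) (s := Metric.ball (x i) 1)
    (bound := fun _ => Real.exp (R * (∑ i, |x i| + (|x i| + 1)) + R + |t| * R) * R ^ 2)
    (Metric.ball_mem_nhds _ one_pos) ?_ ?_ ?_ ?_ ?_ ?_
  · simpa [partitionJet] using key.2
  · exact Eventually.of_forall fun s =>
      ((h.measurable_energy_right t _).exp.mul hw).aestronglyMeasurable
  · exact h.integrable t _ hw (h.bd_w.mono fun z hz => hz i)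
  · exact ((h.measurable_energy_right t _).exp.mul (hw.pow_const 2)).aestronglyMeasurable
  · filter_upwards [h.abs_energy_le, h.bd_w] with z h1 h2 s hs
    rw [norm_mul, Real.norm_of_nonneg (Real.exp_nonneg _), norm_pow, Real.norm_eq_abs]
    refine mul_le_mul (Real.exp_le_exp.2 ((le_abs_self _).trans ((h1 t _).trans ?_)))
      (pow_le_pow_left₀ (abs_nonneg _) (h2 i) 2) (by positivity) (Real.exp_nonneg _)
    gcongr
    refine (sum_abs_update_le x i s).trans ?_
    gcongr
    have := abs_sub_abs_le_abs_sub s (x i)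
    rw [Metric.mem_ball, Real.dist_eq] at hs
    linarith
  · exact integrable_const _
  · refine ae_of_all _ fun z s _ => ?_
    simp only [energy_update]
    have h1 : HasDerivAt (fun s => energy w a b t x z + (s - x i) * w i z) (w i z) s := by
      simpa using (((hasDerivAt_id s).sub_const (x i)).mul_const (w i z)).const_add
        (energy w a b t x z)
    refine (h1.exp.mul_const (w i z)).congr_deriv ?_
    ring

lemma BoundedModel.regular (h : BoundedModel ν w a b R) : (partitionJet ν w a b).Regular where
  cont := fun p _ => (h.hasFDerivAt p.1 p.2).continuousAt.continuousWithinAt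
  hasFDeriv := fun t _ x => h.hasFDerivAt t x
  hasDeriv := fun t _ x i => h.hasDerivAt t x i
  meas_t := fun t _ => h.measurable_integral t h.meas_b
  meas_i := fun t _ i => h.measurable_integral t (h.meas_w i)
  meas_ii := fun t _ i => h.measurable_integral t ((h.meas_w i).pow_const 2)

variable [NeZero ν]

lemma BoundedModel.partition_pos (h : BoundedModel ν w a b R) (t : ℝ) (x : ι → ℝ) :
    0 < (partitionJet ν w a b).U t x :=
  integral_exp_pos (h.integrable_exp t x)

lemma BoundedModel.freeEnergy_regular (h : BoundedModel ν w a b R) :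
    (freeEnergyJet ν w a b).Regular :=
  h.regular.logJet 1 fun t _ x => h.partition_pos t x

lemma BoundedModel.abs_gibbs_le (h : BoundedModel ν w a b R) (t : ℝ) (x : ι → ℝ) {X : Z → ℝ}
    {B : ℝ} (hB : ∀ᵐ z ∂ν, |X z| ≤ B) :
    |(∫ z, Real.exp (energy w a b t x z) * X z ∂ν) / (partitionJet ν w a b).U t x| ≤ B := by
  have h0 := h.partition_pos t x
  rw [abs_div, abs_of_pos h0, div_le_iff₀ h0, ← Real.norm_eq_abs]
  simp only [partitionJet]
  rw [← integral_const_mul]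
  refine norm_integral_le_of_norm_le ((h.integrable_exp t x).const_mul B) ?_
  filter_upwards [hB] with z hz
  rw [norm_mul, Real.norm_of_nonneg (Real.exp_nonneg _), mul_comm]
  exact mul_le_mul_of_nonneg_right hz (Real.exp_nonneg _)

lemma BoundedModel.freeEnergy_linBound (h : BoundedModel ν w a b R) :
    ∃ C, (freeEnergyJet ν w a b).LinBound C := by
  have h0 := h.nonneg
  set L := |Real.log (ν.real Set.univ)|
  have hν : 0 < ν.real Set.univ := by
    rw [measureReal_def]
    exact ENNReal.toReal_pos (NeZero.ne _) (measure_ne_top _ _)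
  refine ⟨L + 2 * R + 2 * R ^ 2, by positivity, ?_, ?_, ?_, ?_⟩
  · intro t ht x
    have hx : (0 : ℝ) ≤ ∑ i, |x i| := by positivity
    set c := R * ∑ i, |x i| + R + |t| * R with hc
    have htR : |t| * R ≤ R := by
      rw [abs_of_nonneg ht.1]; exact mul_le_of_le_one_left h0 ht.2
    have up : (partitionJet ν w a b).U t x ≤ Real.exp c * ν.real Set.univ := by
      have : (partitionJet ν w a b).U t x ≤ ∫ _, Real.exp c ∂ν := by
        refine integral_mono_ae (h.integrable_exp t x) (integrable_const _) ?_
        filter_upwards [h.abs_energy_le] with z hz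
        exact Real.exp_le_exp.2 ((le_abs_self _).trans (hz t x))
      rw [integral_const, smul_eq_mul, mul_comm] at this
      exact this
    have lo : Real.exp (-c) * ν.real Set.univ ≤ (partitionJet ν w a b).U t x := by
      have : ∫ _, Real.exp (-c) ∂ν ≤ (partitionJet ν w a b).U t x := by
        refine integral_mono_ae (integrable_const _) (h.integrable_exp t x) ?_
        filter_upwards [h.abs_energy_le] with z hz
        exact Real.exp_le_exp.2 (abs_le.1 (hz t x)).1
      rw [integral_const, smul_eq_mul, mul_comm] at this
      exact this
    have up' := Real.log_le_log (h.partition_pos t x) up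
    have lo' := Real.log_le_log (by positivity) lo
    rw [Real.log_mul (Real.exp_ne_zero _) hν.ne', Real.log_exp] at up' lo'
    have hL := abs_le.1 (le_refl L)
    have : |(freeEnergyJet ν w a b).U t x| ≤ c + L := by
      simp only [freeEnergyJet, Jet.logJet, div_one, one_mul]
      rw [abs_le]; constructor <;> linarith [hL.1, hL.2]
    refine this.trans ?_
    have hL0 : 0 ≤ L := abs_nonneg _
    rw [hc]
    nlinarith [mul_nonneg hL0 hx, mul_nonneg h0 hx, mul_nonneg (sq_nonneg R) hx, sq_nonneg R]
  · intro t _ x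
    have := h.abs_gibbs_le t x h.bd_b
    simp only [freeEnergyJet, Jet.logJet, div_one, one_mul]
    refine this.trans ?_
    have : 0 ≤ L + R + 2 * R ^ 2 := by positivity
    linarith
  · intro t _ x i
    have := h.abs_gibbs_le t x (h.bd_w.mono fun z hz => hz i)
    simp only [freeEnergyJet, Jet.logJet, div_one, one_mul]
    refine this.trans ?_
    have : 0 ≤ L + R + 2 * R ^ 2 := by positivity
    linarith
  · intro t _ x i
    have h1 := h.abs_gibbs_le t x (h.bd_w.mono fun z hz => hz i)
    have h2 := h.abs_gibbs_le t x (X := fun z => w i z ^ 2) (B := R ^ 2)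
      (h.bd_w.mono fun z hz => by rw [abs_pow]; exact pow_le_pow_left₀ (abs_nonneg _) (hz i) 2)
    simp only [freeEnergyJet, Jet.logJet, div_one, one_mul]
    refine (abs_sub _ _).trans ?_
    have h3 := pow_le_pow_left₀ (abs_nonneg _) h1 2
    rw [abs_pow]
    have : 0 ≤ L + 2 * R := by positivity
    have h4 : ∀ u v : ℝ, u ≤ R ^ 2 → v ≤ R ^ 2 → u + v ≤ L + 2 * R + 2 * R ^ 2 := by
      intro u v hu hv; linarith
    exact h4 _ _ h2 h3

lemma BoundedModel.freeEnergy_heat (h : BoundedModel ν w a b R) {r : ι → ℝ}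
    (hb : ∀ z, b z = -(1 / 2) * ∑ i, r i * w i z ^ 2) (t : ℝ) (x : ι → ℝ) :
    (freeEnergyJet ν w a b).Ut t x + 1 / 2 * ∑ i, r i * (freeEnergyJet ν w a b).Uii i t x =
      -(1 / 2) * ∑ i, r i * (freeEnergyJet ν w a b).Ui i t x ^ 2 := by
  have i2 : ∀ i, Integrable (fun z => Real.exp (energy w a b t x z) * w i z ^ 2) ν := fun i =>
    h.integrable t x ((h.meas_w i).pow_const 2) (B := R ^ 2)
      (h.bd_w.mono fun z hz => by rw [abs_pow]; exact pow_le_pow_left₀ (abs_nonneg _) (hz i) 2)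
  have e : (partitionJet ν w a b).Ut t x =
      -(1 / 2) * ∑ i, r i * (partitionJet ν w a b).Uii i t x := by
    simp only [partitionJet]
    simp_rw [← integral_const_mul]
    rw [← integral_finsetSum _ fun i _ => (i2 i).const_mul (r i), ← integral_const_mul]
    congr 1
    ext z
    rw [hb z, Finset.mul_sum, Finset.mul_sum, Finset.mul_sum]
    exact Finset.sum_congr rfl fun i _ => by ring
  simp only [freeEnergyJet, Jet.logJet, div_one, one_mul]
  rw [e]
  simp only [Finset.mul_sum, Finset.sum_div]
  rw [← Finset.sum_add_distrib]
  exact Finset.sum_congr rfl fun i _ => by ring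

end Calculus
end GaussianSpinGlass
end

noncomputable section

namespace GaussianSpinGlass

instance (N : ℕ) : IsProbabilityMeasure (spinMeasure N) := by unfold spinMeasure; infer_instance

instance (N : ℕ) : IsProbabilityMeasure (couplingMeasure N) := by
  unfold couplingMeasure; infer_instance

section Means
variable {Ω : Type*} [MeasurableSpace Ω] {μ : Measure Ω} {m : ℝ}
  {v w X Y : Ω → ℝ}

lemma exp_tmean_mul_integral_le [NeZero μ]
    (hev : Integrable (fun ω => Real.exp (m * v ω)) μ)
    (hew : Integrable (fun ω => Real.exp (m * w ω)) μ)
    (h : Integrable (fun ω => Real.exp (m * v ω) * (w ω - v ω)) μ) :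
    Real.exp (m * tmean μ m v (fun ω => w ω - v ω)) * ∫ ω, Real.exp (m * v ω) ∂μ ≤
      ∫ ω, Real.exp (m * w ω) ∂μ := by
  set T := tmean μ m v (fun ω => w ω - v ω) with hT
  have hI := integral_exp_pos hev
  have hTI : ∫ ω, Real.exp (m * v ω) * (w ω - v ω) ∂μ = T * ∫ ω, Real.exp (m * v ω) ∂μ := by
    rw [hT, tmean, div_mul_cancel₀ _ hI.ne']
  have h1 : ∫ ω, Real.exp (m * T) * (Real.exp (m * v ω) + m * (Real.exp (m * v ω) * (w ω - v ω))
      - m * T * Real.exp (m * v ω)) ∂μ ≤ ∫ ω, Real.exp (m * w ω) ∂μ := by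
    refine integral_mono (((hev.add (h.const_mul m)).sub (hev.const_mul _)).const_mul _) hew
      fun ω => ?_
    have h2 := Real.add_one_le_exp (m * (w ω - v ω) - m * T)
    have h3 : Real.exp (m * w ω) = Real.exp (m * T) * Real.exp (m * v ω) *
        Real.exp (m * (w ω - v ω) - m * T) := by
      rw [← Real.exp_add, ← Real.exp_add]; congr 1; ring
    rw [h3, mul_assoc (Real.exp (m * T))]
    refine mul_le_mul_of_nonneg_left ?_ (Real.exp_nonneg _)
    calc _ = Real.exp (m * v ω) * (m * (w ω - v ω) - m * T + 1) := by ring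
      _ ≤ _ := mul_le_mul_of_nonneg_left h2 (Real.exp_nonneg _)
  have ha : Integrable (fun ω => Real.exp (m * v ω) + m * (Real.exp (m * v ω) * (w ω - v ω)))
      μ := hev.add (h.const_mul m)
  rw [integral_const_mul, integral_sub ha (hev.const_mul _),
    integral_add hev (h.const_mul m), integral_const_mul, integral_const_mul, hTI] at h1
  calc _ = Real.exp (m * T) * (∫ ω, Real.exp (m * v ω) ∂μ +
      m * (T * ∫ ω, Real.exp (m * v ω) ∂μ) - m * T * ∫ ω, Real.exp (m * v ω) ∂μ) := by ring
    _ ≤ _ := h1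

lemma tmean_sub_le_lme_sub [IsProbabilityMeasure μ] (hm : 0 ≤ m) (hv : Integrable v μ)
    (hw : Integrable w μ)
    (hev : Integrable (fun ω => Real.exp (m * v ω)) μ)
    (hew : Integrable (fun ω => Real.exp (m * w ω)) μ)
    (h : Integrable (fun ω => Real.exp (m * v ω) * (w ω - v ω)) μ) :
    tmean μ m v (fun ω => w ω - v ω) ≤ lme μ m w - lme μ m v := by
  rcases hm.eq_or_lt with rfl | hm
  · rw [tmean_zero, lme_zero, lme_zero, integral_sub hw hv]
  · have hI := integral_exp_pos hev
    have h4 := Real.log_le_log (by positivity) (exp_tmean_mul_integral_le hev hew h)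
    rw [Real.log_mul (Real.exp_ne_zero _) hI.ne', Real.log_exp] at h4
    rw [lme_of_ne hm.ne', lme_of_ne hm.ne', ← mul_sub]
    calc _ = 1 / m * (m * tmean μ m v (fun ω => w ω - v ω)) := by field_simp
      _ ≤ _ := by gcongr; linarith

lemma sq_tmean_le [NeZero μ] (hev : Integrable (fun ω => Real.exp (m * v ω)) μ)
    (h1 : Integrable (fun ω => Real.exp (m * v ω) * X ω) μ)
    (h2 : Integrable (fun ω => Real.exp (m * v ω) * X ω ^ 2) μ) :
    tmean μ m v X ^ 2 ≤ tmean μ m v (fun ω => X ω ^ 2) := by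
  set T := tmean μ m v X with hT
  have h0 : 0 ≤ tmean μ m v (fun ω => (X ω - T) ^ 2) := tmean_nonneg fun ω => sq_nonneg _
  have e : (fun ω => (X ω - T) ^ 2) = fun ω => (X ω ^ 2 - 2 * T * X ω) + T ^ 2 := by
    ext ω; ring
  have i3 : Integrable (fun ω => Real.exp (m * v ω) * (2 * T * X ω)) μ := by
    refine (h1.const_mul (2 * T)).congr (ae_of_all _ fun ω => ?_); ring
  rw [e, tmean_add, tmean_sub h2 i3, tmean_const_mul, tmean_const hev, ← hT] at h0
  · nlinarith
  · refine (h2.sub i3).congr (ae_of_all _ fun ω => ?_)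
    simp only [Pi.sub_apply]; ring
  · exact hev.mul_const _

lemma tendsto_lme [IsProbabilityMeasure μ] {vn : ℕ → Ω → ℝ} {lo hi : Ω → ℝ} (hm : 0 ≤ m) (hmeas : ∀ n, Measurable (vn n))
    (hlo : Integrable lo μ) (hhi : Integrable hi μ)
    (hehi : Integrable (fun ω => Real.exp (m * hi ω)) μ)
    (h1 : ∀ n ω, lo ω ≤ vn n ω) (h2 : ∀ n ω, vn n ω ≤ hi ω)
    (hlim : ∀ ω, Tendsto (fun n => vn n ω) atTop (𝓝 (v ω)))
    (hev : Integrable (fun ω => Real.exp (m * v ω)) μ) :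
    Tendsto (fun n => lme μ m (vn n)) atTop (𝓝 (lme μ m v)) := by
  by_cases hm0 : m = 0
  · subst hm0
    simp only [lme_zero]
    refine tendsto_integral_of_dominated_convergence (fun ω => |lo ω| + |hi ω|)
      (fun n => (hmeas n).aestronglyMeasurable) (hlo.abs.add hhi.abs)
      (fun n => ae_of_all _ fun ω => ?_) (ae_of_all _ hlim)
    rw [Real.norm_eq_abs, abs_le]
    have := h1 n ω
    have := h2 n ω
    constructor
    · linarith [neg_abs_le (lo ω), abs_nonneg (hi ω)]
    · linarith [le_abs_self (hi ω), abs_nonneg (lo ω)]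
  · simp only [lme_of_ne hm0]
    refine Tendsto.const_mul _ (Tendsto.log ?_ (integral_exp_pos hev).ne')
    refine tendsto_integral_of_dominated_convergence (fun ω => Real.exp (m * hi ω))
      (fun n => ((hmeas n).const_mul m).exp.aestronglyMeasurable) hehi
      (fun n => ae_of_all _ fun ω => ?_) (ae_of_all _ fun ω => ((hlim ω).const_mul m).rexp)
    rw [Real.norm_of_nonneg (Real.exp_nonneg _)]
    exact Real.exp_le_exp.2 (mul_le_mul_of_nonneg_left (h2 n ω) hm)

end Means

variable {N : ℕ}

/-! ### Functions of subquadratic growth -/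

/-- Measurable functions that are `o(|y|²)` at infinity up to a constant. -/
structure SubQuad (f : Spins N → ℝ) : Prop where
  meas : Measurable f
  bound : ∀ η > 0, ∃ C, 0 ≤ C ∧ ∀ y, |f y| ≤ C + η * ∑ i, y i ^ 2

lemma integrable_of_expSq {f : Spins N → ℝ} (hm : AEStronglyMeasurable f (spinMeasure N))
    {A κ : ℝ} (hκ : κ < 1 / 2) (h : ∀ y, |f y| ≤ A * Real.exp (κ * ∑ i, y i ^ 2)) :
    Integrable f (spinMeasure N) :=
  ((integrable_gaussPi_exp_sum_sq hκ).const_mul A).mono' hm (ae_of_all _ h)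

lemma exp_mul_quad_bound {N : ℕ} (c : ℝ) {C D u X : ℝ} (hD : 0 ≤ D) {y : Spins N}
    (hu : |u| ≤ C + 1 / (4 * (|c| + 1)) * ∑ i, y i ^ 2)
    (hX : |X| ≤ D + 1 / 8 * ∑ i, y i ^ 2) :
    |Real.exp (c * u) * X| ≤ Real.exp (|c| * C) * (D + 1) * Real.exp (3 / 8 * ∑ i, y i ^ 2) := by
  set S := ∑ i, y i ^ 2
  have hS : 0 ≤ S := Finset.sum_nonneg fun i _ => sq_nonneg _
  have h1 : Real.exp (c * u) ≤ Real.exp (|c| * C) * Real.exp (1 / 4 * S) := by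
    rw [← Real.exp_add]
    gcongr
    calc c * u ≤ |c| * |u| := by rw [← abs_mul]; exact le_abs_self _
      _ ≤ |c| * (C + 1 / (4 * (|c| + 1)) * S) := by gcongr
      _ = |c| * C + (|c| / (|c| + 1)) * (1 / 4 * S) := by
          have : |c| + 1 ≠ 0 := by positivity
          field_simp
      _ ≤ |c| * C + 1 * (1 / 4 * S) := by
          gcongr
          rw [div_le_one (by positivity)]; linarith
      _ = _ := by ring
  have h2 : |X| ≤ (D + 1) * Real.exp (1 / 8 * S) := by
    have e := Real.add_one_le_exp (1 / 8 * S)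
    have e1 : 1 ≤ Real.exp (1 / 8 * S) := Real.one_le_exp (by positivity)
    nlinarith
  rw [abs_mul, abs_of_pos (Real.exp_pos _)]
  calc _ ≤ (Real.exp (|c| * C) * Real.exp (1 / 4 * S)) * ((D + 1) * Real.exp (1 / 8 * S)) := by
        gcongr
    _ = Real.exp (|c| * C) * (D + 1) * (Real.exp (1 / 4 * S) * Real.exp (1 / 8 * S)) := by ring
    _ = _ := by rw [← Real.exp_add]; congr 2; ring

lemma SubQuad.integrable_exp_mul {f X : Spins N → ℝ} (hf : SubQuad f) (hX : SubQuad X) (c : ℝ) :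
    Integrable (fun y => Real.exp (c * f y) * X y) (spinMeasure N) := by
  obtain ⟨C, -, h1⟩ := hf.bound (1 / (4 * (|c| + 1))) (by positivity)
  obtain ⟨D, hD, h2⟩ := hX.bound (1 / 8) (by positivity)
  exact integrable_of_expSq ((hf.meas.const_mul c).exp.mul hX.meas).aestronglyMeasurable
    (by norm_num) fun y => exp_mul_quad_bound c hD (h1 y) (h2 y)

lemma SubQuad.const (c : ℝ) : SubQuad (fun _ : Spins N => c) :=
  ⟨measurable_const, fun η hη => ⟨|c|, abs_nonneg _, fun y => by
    have : 0 ≤ ∑ i, y i ^ 2 := Finset.sum_nonneg fun i _ => sq_nonneg _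
    have := mul_nonneg hη.le this
    linarith⟩⟩

lemma SubQuad.integrable_exp {f : Spins N → ℝ} (hf : SubQuad f) (c : ℝ) :
    Integrable (fun y => Real.exp (c * f y)) (spinMeasure N) := by
  simpa using hf.integrable_exp_mul (SubQuad.const 1) c

lemma SubQuad.integrable {f : Spins N → ℝ} (hf : SubQuad f) : Integrable f (spinMeasure N) := by
  simpa using (SubQuad.const (N := N) 0).integrable_exp_mul hf 0

lemma integrable_sum_sq (N : ℕ) (c : ℝ) :
    Integrable (fun y : Spins N => c * ∑ i, y i ^ 2) (spinMeasure N) := by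
  refine integrable_of_expSq (A := |c| * 4) (κ := 1 / 4)
    (Measurable.aestronglyMeasurable (by fun_prop)) (by norm_num) fun y => ?_
  have hS : 0 ≤ ∑ i, y i ^ 2 := Finset.sum_nonneg fun i _ => sq_nonneg _
  rw [abs_mul, abs_of_nonneg hS, mul_assoc]
  gcongr
  have := Real.add_one_le_exp (1 / 4 * ∑ i, y i ^ 2)
  linarith

lemma integrable_exp_sum_sq (N : ℕ) {c : ℝ} (hc : c < 1 / 2) :
    Integrable (fun y : Spins N => Real.exp (c * ∑ i, y i ^ 2)) (spinMeasure N) :=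
  integrable_gaussPi_exp_sum_sq hc

/-! ### Growth of functions of the fields -/

/-- `∑_{b=1}^a |g^b|²`. -/
def fieldSq (a : ℕ) (g : Fields N) : ℝ := ∑ b ∈ Finset.range a, ∑ i, g (b + 1) i ^ 2

lemma fieldSq_nonneg (a : ℕ) (g : Fields N) : 0 ≤ fieldSq a g :=
  Finset.sum_nonneg fun _ _ => Finset.sum_nonneg fun _ _ => sq_nonneg _

lemma fieldSq_update (a : ℕ) (g : Fields N) (y : Spins N) :
    fieldSq (a + 1) (Function.update g (a + 1) y) = fieldSq a g + ∑ i, y i ^ 2 := by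
  rw [fieldSq, Finset.sum_range_succ, fieldSq]
  congr 1
  · refine Finset.sum_congr rfl fun b hb => ?_
    rw [Function.update_of_ne]
    have := Finset.mem_range.1 hb
    omega
  · simp

section Growth
variable {P : Type*} {M : P → ℝ}

/-- Subquadratic growth in the fields `g^1, …, g^a`, uniform with respect to a parameter. -/
structure Growth (M : P → ℝ) (a : ℕ) (f : P → Fields N → ℝ) : Prop where
  meas : ∀ p, Measurable (f p)
  bound : ∀ η > 0, ∃ C, 0 ≤ C ∧ ∀ p g, |f p g| ≤ C * (1 + M p) + η * fieldSq a g

lemma measurable_updateField (a : ℕ) (g : Fields N) :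
    Measurable (fun y : Spins N => Function.update g a y) := measurable_update g

lemma Growth.section_bound {a : ℕ} {f : P → Fields N → ℝ} (hf : Growth M (a + 1) f) {η : ℝ}
    (hη : 0 < η) : ∃ C, 0 ≤ C ∧ ∀ p g y, |f p (Function.update g (a + 1) y)| ≤
      (C * (1 + M p) + η * fieldSq a g) + η * ∑ i, y i ^ 2 := by
  obtain ⟨C, hC, h⟩ := hf.bound η hη
  refine ⟨C, hC, fun p g y => ?_⟩
  have := h p (Function.update g (a + 1) y)
  rw [fieldSq_update, mul_add] at this
  linarith

lemma Growth.subQuad (hM : ∀ p, 0 ≤ M p) {a : ℕ} {f : P → Fields N → ℝ}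
    (hf : Growth M (a + 1) f) (p : P) (g : Fields N) :
    SubQuad (fun y => f p (Function.update g (a + 1) y)) := by
  refine ⟨(hf.meas p).comp (measurable_updateField _ g), fun η hη => ?_⟩
  obtain ⟨C, hC, h⟩ := hf.section_bound hη
  refine ⟨C * (1 + M p) + η * fieldSq a g, ?_, fun y => h p g y⟩
  have := hM p
  have := fieldSq_nonneg a g
  positivity

lemma Growth.const_add (hM : ∀ p, 0 ≤ M p) (a : ℕ) (c : ℝ) :
    Growth (N := N) M a (fun _ _ => c) :=
  ⟨fun _ => measurable_const, fun η hη => ⟨|c|, abs_nonneg _, fun p g => by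
    have := mul_nonneg (abs_nonneg c) (hM p)
    have := mul_nonneg hη.le (fieldSq_nonneg a g)
    linarith⟩⟩

lemma Growth.add {a : ℕ} {f k : P → Fields N → ℝ} (hf : Growth M a f) (hk : Growth M a k) :
    Growth M a (fun p g => f p g + k p g) := by
  refine ⟨fun p => (hf.meas p).add (hk.meas p), fun η hη => ?_⟩
  obtain ⟨C, hC, h1⟩ := hf.bound (η / 2) (by positivity)
  obtain ⟨D, hD, h2⟩ := hk.bound (η / 2) (by positivity)
  refine ⟨C + D, by positivity, fun p g => (abs_add_le _ _).trans ?_⟩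
  have := h1 p g
  have := h2 p g
  linarith

lemma Growth.of_abs_le {a : ℕ} {f k : P → Fields N → ℝ} (hk : Growth M a k)
    (hf : ∀ p, Measurable (f p)) (h : ∀ p g, |f p g| ≤ |k p g|) : Growth M a f :=
  ⟨hf, fun η hη => by
    obtain ⟨C, hC, h1⟩ := hk.bound η hη
    exact ⟨C, hC, fun p g => (h p g).trans (h1 p g)⟩⟩

lemma Growth.abs {a : ℕ} {f : P → Fields N → ℝ} (hf : Growth M a f) :
    Growth M a (fun p g => |f p g|) :=
  hf.of_abs_le (fun p => (hf.meas p).abs) fun p g => by simp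

lemma Growth.const_mul {a : ℕ} {f : P → Fields N → ℝ} (hf : Growth M a f) (c : ℝ) :
    Growth M a (fun p g => c * f p g) := by
  refine ⟨fun p => (hf.meas p).const_mul c, fun η hη => ?_⟩
  obtain ⟨C, hC, h1⟩ := hf.bound (η / (|c| + 1)) (by positivity)
  refine ⟨|c| * C, by positivity, fun p g => ?_⟩
  rw [abs_mul]
  have hs := fieldSq_nonneg a g
  calc |c| * |f p g| ≤ |c| * (C * (1 + M p) + η / (|c| + 1) * fieldSq a g) := by
        gcongr; exact h1 p g
    _ = |c| * C * (1 + M p) + (|c| / (|c| + 1)) * (η * fieldSq a g) := by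
        have : |c| + 1 ≠ 0 := by positivity
        field_simp
    _ ≤ |c| * C * (1 + M p) + 1 * (η * fieldSq a g) := by
        gcongr
        rw [div_le_one (by positivity)]; linarith
    _ = _ := by ring

/-- Measurability of the integral over one level. -/
lemma measurable_integral_update {Θ : Type*} [MeasurableSpace Θ] (a : ℕ)
    {F : Θ × Fields N → ℝ} (hF : Measurable F) :
    Measurable (fun q : Θ × Fields N => ∫ y, F (q.1, Function.update q.2 a y) ∂(spinMeasure N)) := by
  have hu : Measurable (fun r : (Θ × Fields N) × Spins N =>
      ((r.1.1, Function.update r.1.2 a r.2) : Θ × Fields N)) := by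
    refine (measurable_fst.comp measurable_fst).prodMk ?_
    exact measurable_update'.comp ((measurable_snd.comp measurable_fst).prodMk measurable_snd)
  exact ((hF.comp hu).stronglyMeasurable.integral_prod_right').measurable

lemma measurable_lme_update {Θ : Type*} [MeasurableSpace Θ] (a : ℕ) (m : ℝ)
    {F : Θ × Fields N → ℝ} (hF : Measurable F) :
    Measurable (fun q : Θ × Fields N =>
      lme (spinMeasure N) m (fun y => F (q.1, Function.update q.2 a y))) := by
  by_cases hm : m = 0
  · subst hm
    simp only [lme_zero]
    exact measurable_integral_update a hF
  · simp only [lme_of_ne hm]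
    exact ((measurable_integral_update a (hF.const_mul m).exp).log).const_mul _

lemma measurable_tmean_update {Θ : Type*} [MeasurableSpace Θ] (a : ℕ) (m : ℝ)
    {F X : Θ × Fields N → ℝ} (hF : Measurable F) (hX : Measurable X) :
    Measurable (fun q : Θ × Fields N =>
      tmean (spinMeasure N) m (fun y => F (q.1, Function.update q.2 a y))
        (fun y => X (q.1, Function.update q.2 a y))) := by
  simp only [tmean]
  exact (measurable_integral_update a ((hF.const_mul m).exp.mul hX)).div
    (measurable_integral_update a (hF.const_mul m).exp)

lemma measurable_lme_field (a : ℕ) (m : ℝ) {F : Fields N → ℝ} (hF : Measurable F) :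
    Measurable (fun g => lme (spinMeasure N) m (fun y => F (Function.update g a y))) :=
  (measurable_lme_update (Θ := Unit) a m (hF.comp measurable_snd)).comp
    (measurable_const (a := ()) |>.prodMk measurable_id)

lemma measurable_tmean_field (a : ℕ) (m : ℝ) {F X : Fields N → ℝ} (hF : Measurable F)
    (hX : Measurable X) :
    Measurable (fun g => tmean (spinMeasure N) m (fun y => F (Function.update g a y))
      (fun y => X (Function.update g a y))) :=
  (measurable_tmean_update (Θ := Unit) a m (hF.comp measurable_snd) (hX.comp measurable_snd)).comp
    (measurable_const (a := ()) |>.prodMk measurable_id)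

lemma Growth.lme (hM : ∀ p, 0 ≤ M p) {a : ℕ} {f : P → Fields N → ℝ} (hf : Growth M (a + 1) f)
    {m : ℝ} (hm : 0 ≤ m) : Growth M a (fun p g =>
      lme (spinMeasure N) m (fun y => f p (Function.update g (a + 1) y))) := by
  refine ⟨fun p => measurable_lme_field (a + 1) m (hf.meas p), fun η hη => ?_⟩
  set η' := min η (1 / (4 * (m + 1))) with hη'
  have hη'0 : 0 < η' := lt_min hη (by positivity)
  obtain ⟨C, hC, h⟩ := hf.section_bound hη'0
  have hk := integrable_sum_sq N η'
  have hek : Integrable (fun y : Spins N => Real.exp (m * (η' * ∑ i, y i ^ 2)))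
      (spinMeasure N) := by
    simp_rw [← mul_assoc]
    refine integrable_exp_sum_sq N ?_
    calc m * η' ≤ m * (1 / (4 * (m + 1))) := by gcongr; exact min_le_right _ _
      _ = (m / (m + 1)) * (1 / 4) := by
          have : m + 1 ≠ 0 := by positivity
          field_simp
      _ ≤ 1 * (1 / 4) := by
          gcongr
          rw [div_le_one (by positivity)]; linarith
      _ < 1 / 2 := by norm_num
  set L := GaussianSpinGlass.lme (spinMeasure N) m (fun y => η' * ∑ i, y i ^ 2)
  refine ⟨C + |L|, by positivity, fun p g => ?_⟩
  have hs := hf.subQuad hM p g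
  have := abs_lme_le hm hk hek hs.integrable (hs.integrable_exp m) (h p g)
  refine this.trans ?_
  have h1 : η' * fieldSq a g ≤ η * fieldSq a g :=
    mul_le_mul_of_nonneg_right (min_le_left _ _) (fieldSq_nonneg a g)
  have h2 : 0 ≤ |L| * M p := mul_nonneg (abs_nonneg _) (hM p)
  linarith [le_abs_self L]

lemma Growth.tmean (hM : ∀ p, 0 ≤ M p) {a : ℕ} {f X : P → Fields N → ℝ}
    (hf : Growth M (a + 1) f) (hX : Growth M (a + 1) X)
    {m : ℝ} (hm : 0 ≤ m) : Growth M a (fun p g =>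
      tmean (spinMeasure N) m (fun y => f p (Function.update g (a + 1) y))
        (fun y => X p (Function.update g (a + 1) y))) := by
  have hfX := hf.add hX.abs
  have hbd := (hfX.lme hM hm).add ((hf.lme hM hm).const_mul (-1))
  refine hbd.of_abs_le (fun p => measurable_tmean_field (a + 1) m (hf.meas p) (hX.meas p))
    fun p g => ?_
  have s1 := hf.subQuad hM p g
  have s2 := hX.subQuad hM p g
  have s3 := hX.abs.subQuad hM p g
  have s4 := hfX.subQuad hM p g
  have h1 := tmean_sub_le_lme_sub hm s1.integrable s4.integrable (s1.integrable_exp m)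
    (s4.integrable_exp m) (by simpa using s1.integrable_exp_mul s3 m)
  simp only [add_sub_cancel_left] at h1
  refine le_trans ?_ (le_trans h1 (le_trans (le_abs_self _) (le_of_eq ?_)))
  · rw [abs_le]
    constructor
    · have := tmean_mono (m := m) (X := fun y => -1 * |X p (Function.update g (a + 1) y)|)
        (Y := fun y => X p (Function.update g (a + 1) y))
        (by refine ((s1.integrable_exp_mul s3 m).const_mul (-1)).congr (ae_of_all _ fun y => ?_)
            ring)
        (s1.integrable_exp_mul s2 m) fun y => by
          have := neg_abs_le (X p (Function.update g (a + 1) y)); linarith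
      rw [tmean_const_mul] at this
      linarith
    · exact tmean_mono (s1.integrable_exp_mul s2 m) (s1.integrable_exp_mul s3 m)
        fun y => le_abs_self _
  · congr 1; ring

end Growth

end GaussianSpinGlass
end

noncomputable section

namespace GaussianSpinGlass

variable {N : ℕ}

/-! ### Nested averages -/

/-- The logarithm of `Z_a`, with `n` levels above `a` to be averaged, where `u = log Z_K`. -/
def nestLog (m : ℕ → ℝ) (u : Fields N → ℝ) : ℕ → ℕ → Fields N → ℝ
  | _, 0 => u
  | a, n + 1 => fun g => lme (spinMeasure N) (m (a + 1))
      (fun y => nestLog m u (a + 1) n (Function.update g (a + 1) y))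

/-- `E_{a+1} f_{a+1} ⋯ E_{a+n} f_{a+n} X`, where `v a = log Z_a`. -/
def tiltLevels (m : ℕ → ℝ) (v : ℕ → Fields N → ℝ) (X : Fields N → ℝ) : ℕ → ℕ → Fields N → ℝ
  | _, 0 => X
  | a, n + 1 => fun g => tmean (spinMeasure N) (m (a + 1))
      (fun y => v (a + 1) (Function.update g (a + 1) y))
      (fun y => tiltLevels m v X (a + 1) n (Function.update g (a + 1) y))

/-- The function does not depend on the fields of the levels above `a`. -/
def IndepAbove (a : ℕ) (f : Fields N → ℝ) : Prop :=
  ∀ c > a, ∀ g y, f (Function.update g c y) = f g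

lemma IndepAbove.mono {a b : ℕ} (hab : a ≤ b) {f : Fields N → ℝ} (h : IndepAbove a f) :
    IndepAbove b f := fun c hc => h c (lt_of_le_of_lt hab hc)

lemma IndepAbove.mul {a : ℕ} {f k : Fields N → ℝ} (hf : IndepAbove a f) (hk : IndepAbove a k) :
    IndepAbove a (fun g => f g * k g) := fun c hc g y => by simp only [hf c hc g y, hk c hc g y]

lemma IndepAbove.comp_update {a : ℕ} {f : Fields N → ℝ} (h : IndepAbove (a + 1) f) {c : ℕ}
    (hc : a < c) (g : Fields N) (y y' : Spins N) :
    f (Function.update (Function.update g c y) (a + 1) y') = f (Function.update g (a + 1) y') := by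
  rcases (Nat.succ_le_of_lt hc).eq_or_lt with rfl | hc'
  · rw [Nat.succ_eq_add_one, Function.update_idem]
  · rw [Function.update_comm (show c ≠ a + 1 from (Nat.ne_of_lt hc').symm)]
    exact h c hc' _ _

lemma IndepAbove.nestLog (m : ℕ → ℝ) {u : Fields N → ℝ} (n : ℕ) :
    ∀ a, IndepAbove (a + n) u → IndepAbove a (nestLog m u a n) := by
  induction n with
  | zero => exact fun a h => h
  | succ n ih =>
    intro a h c hc g y
    have := ih (a + 1) (by rwa [show a + 1 + n = a + (n + 1) by ring])
    simp only [GaussianSpinGlass.nestLog, this.comp_update hc]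

lemma IndepAbove.tiltLevels (m : ℕ → ℝ) {v : ℕ → Fields N → ℝ} {X : Fields N → ℝ} (n : ℕ) :
    ∀ a, (∀ b, a < b → b ≤ a + n → IndepAbove b (v b)) → IndepAbove (a + n) X →
      IndepAbove a (tiltLevels m v X a n) := by
  induction n with
  | zero => exact fun a _ h => h
  | succ n ih =>
    intro a hv h c hc g y
    have h1 := ih (a + 1) (fun b h1 h2 => hv b (by omega) (by omega))
      (by rwa [show a + 1 + n = a + (n + 1) by ring])
    have h2 := hv (a + 1) (by omega) (by omega)
    simp only [GaussianSpinGlass.tiltLevels, h1.comp_update hc, h2.comp_update hc]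

lemma measurable_nestLog {Θ : Type*} [MeasurableSpace Θ] (m : ℕ → ℝ) {u : Θ × Fields N → ℝ}
    (hu : Measurable u) (n : ℕ) :
    ∀ a, Measurable (fun q : Θ × Fields N => nestLog m (fun g => u (q.1, g)) a n q.2) := by
  induction n with
  | zero => exact fun a => hu
  | succ n ih => exact fun a => measurable_lme_update (a + 1) (m (a + 1)) (ih (a + 1))

lemma measurable_tiltLevels {Θ : Type*} [MeasurableSpace Θ] (m : ℕ → ℝ)
    {v : ℕ → Θ × Fields N → ℝ} {X : Θ × Fields N → ℝ} (hv : ∀ a, Measurable (v a))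
    (hX : Measurable X) (n : ℕ) :
    ∀ a, Measurable (fun q : Θ × Fields N =>
      tiltLevels m (fun b g => v b (q.1, g)) (fun g => X (q.1, g)) a n q.2) := by
  induction n with
  | zero => exact fun a => hX
  | succ n ih => exact fun a => measurable_tmean_update (a + 1) (m (a + 1)) (hv _) (ih (a + 1))

section Growth
variable {P : Type*} {M : P → ℝ} {K : ℕ} {m : ℕ → ℝ} {v : P → ℕ → Fields N → ℝ}
  {X Y : P → Fields N → ℝ}

lemma Growth.nestLog (hM : ∀ p, 0 ≤ M p) (hm : ∀ b < K, 0 ≤ m (b + 1))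
    {u : P → Fields N → ℝ} (hu : Growth M K u) (n : ℕ) :
    ∀ a, a + n = K → Growth M a (fun p => nestLog m (u p) a n) := by
  induction n with
  | zero => intro a ha; rw [show a = K by omega]; exact hu
  | succ n ih => exact fun a ha => (ih (a + 1) (by omega)).lme hM (hm a (by omega))

/-- Uniform growth bounds for all the functions `log Z_a`. -/
structure LevelGrowth (K : ℕ) (m : ℕ → ℝ) (M : P → ℝ) (v : P → ℕ → Fields N → ℝ) : Prop where
  M_nonneg : ∀ p, 0 ≤ M p
  m_nonneg : ∀ b < K, 0 ≤ m (b + 1)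
  growth : ∀ a ≤ K, Growth M a (fun p => v p a)

lemma LevelGrowth.tilt (h : LevelGrowth K m M v) (n : ℕ) :
    ∀ a, a + n ≤ K → Growth M (a + n) X →
      Growth M a (fun p => tiltLevels m (v p) (X p) a n) := by
  induction n with
  | zero => exact fun a _ hX => hX
  | succ n ih =>
    intro a ha hX
    exact (h.growth (a + 1) (by omega)).tmean h.M_nonneg
      (ih (a + 1) (by omega) (by rwa [show a + 1 + n = a + (n + 1) by ring]))
      (h.m_nonneg a (by omega))

lemma LevelGrowth.integrable_exp_mul (h : LevelGrowth K m M v) {a : ℕ} (ha : a < K)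
    (hX : Growth M (a + 1) X) (p : P) (g : Fields N) :
    Integrable (fun y => Real.exp (m (a + 1) * v p (a + 1) (Function.update g (a + 1) y)) *
      X p (Function.update g (a + 1) y)) (spinMeasure N) :=
  ((h.growth (a + 1) (by omega)).subQuad h.M_nonneg p g).integrable_exp_mul
    (hX.subQuad h.M_nonneg p g) _

lemma LevelGrowth.integrable_exp (h : LevelGrowth K m M v) {a : ℕ} (ha : a < K)
    (p : P) (g : Fields N) :
    Integrable (fun y => Real.exp (m (a + 1) * v p (a + 1) (Function.update g (a + 1) y)))
      (spinMeasure N) :=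
  ((h.growth (a + 1) (by omega)).subQuad h.M_nonneg p g).integrable_exp _

lemma LevelGrowth.tilt_add (h : LevelGrowth K m M v) (n : ℕ) :
    ∀ a, a + n ≤ K → Growth M (a + n) X → Growth M (a + n) Y → ∀ p g,
      tiltLevels m (v p) (fun g => X p g + Y p g) a n g =
        tiltLevels m (v p) (X p) a n g + tiltLevels m (v p) (Y p) a n g := by
  induction n with
  | zero => intros; rfl
  | succ n ih =>
    intro a ha hX hY p g
    rw [show a + (n + 1) = a + 1 + n by ring] at hX hY
    simp only [tiltLevels, ih (a + 1) (by omega) hX hY p]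
    exact tmean_add (h.integrable_exp_mul (by omega) (h.tilt n (a + 1) (by omega) hX) p g)
      (h.integrable_exp_mul (by omega) (h.tilt n (a + 1) (by omega) hY) p g)

lemma tiltLevels_const_mul (m : ℕ → ℝ) (v : ℕ → Fields N → ℝ) (X : Fields N → ℝ) (c : ℝ) (n : ℕ) :
    ∀ a g, tiltLevels m v (fun g => c * X g) a n g = c * tiltLevels m v X a n g := by
  induction n with
  | zero => intros; rfl
  | succ n ih =>
    intro a g
    simp only [tiltLevels, ih (a + 1), tmean_const_mul]

lemma LevelGrowth.tilt_const (h : LevelGrowth K m M v) (c : ℝ) (n : ℕ) :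
    ∀ a, a + n ≤ K → ∀ p g, tiltLevels m (v p) (fun _ => c) a n g = c := by
  induction n with
  | zero => intros; rfl
  | succ n ih =>
    intro a ha p g
    simp only [tiltLevels, ih (a + 1) (by omega) p]
    exact tmean_const (h.integrable_exp (by omega) p g) c

lemma Growth.sum (hM : ∀ p, 0 ≤ M p) {κ : Type*} {a : ℕ} (s : Finset κ)
    {X : κ → P → Fields N → ℝ} (hX : ∀ k ∈ s, Growth M a (X k)) :
    Growth M a (fun p g => ∑ k ∈ s, X k p g) := by
  classical
  induction s using Finset.induction_on with
  | empty => simpa using Growth.const_add hM a 0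
  | insert k s hk ih =>
    simp only [Finset.sum_insert hk]
    exact (hX k (by simp)).add (ih fun k' h => hX k' (by simp [h]))

lemma LevelGrowth.tilt_sum (h : LevelGrowth K m M v) {κ : Type*} (s : Finset κ)
    {X : κ → P → Fields N → ℝ} {n a : ℕ} (ha : a + n ≤ K)
    (hX : ∀ k ∈ s, Growth M (a + n) (X k)) (p : P) (g : Fields N) :
    tiltLevels m (v p) (fun g => ∑ k ∈ s, X k p g) a n g =
      ∑ k ∈ s, tiltLevels m (v p) (X k p) a n g := by
  classical
  induction s using Finset.induction_on with
  | empty => simpa using h.tilt_const 0 n a ha p g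
  | insert k s hk ih =>
    simp only [Finset.sum_insert hk]
    rw [← ih fun k' h => hX k' (by simp [h])]
    exact h.tilt_add n a ha (hX k (by simp))
      (Growth.sum h.M_nonneg s fun k' h => hX k' (by simp [h])) p g

lemma tiltLevels_nonneg (m : ℕ → ℝ) (v : ℕ → Fields N → ℝ) {X : Fields N → ℝ}
    (hX : ∀ g, 0 ≤ X g) (n : ℕ) : ∀ a g, 0 ≤ tiltLevels m v X a n g := by
  induction n with
  | zero => exact fun a g => hX g
  | succ n ih => exact fun a g => tmean_nonneg fun y => ih (a + 1) _

lemma LevelGrowth.sq_tilt_le (h : LevelGrowth K m M v) (n : ℕ) :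
    ∀ a, a + n ≤ K → Growth M (a + n) X → Growth M (a + n) Y → (∀ p g, X p g ^ 2 ≤ Y p g) →
      ∀ p g, tiltLevels m (v p) (X p) a n g ^ 2 ≤ tiltLevels m (v p) (Y p) a n g := by
  induction n with
  | zero => exact fun a _ _ _ hXY p g => hXY p g
  | succ n ih =>
    intro a ha hX hY hXY p g
    rw [show a + (n + 1) = a + 1 + n by ring] at hX hY
    have gX := h.tilt n (a + 1) (by omega) hX
    have gY := h.tilt n (a + 1) (by omega) hY
    have hsq := ih (a + 1) (by omega) hX hY hXY
    have gX2 : Growth M (a + 1) (fun p g => tiltLevels m (v p) (X p) (a + 1) n g ^ 2) :=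
      gY.of_abs_le (fun p => (gX.meas p).pow_const 2) fun p g => by
        rw [abs_of_nonneg (sq_nonneg _)]
        exact (hsq p g).trans (le_abs_self _)
    refine (sq_tmean_le (h.integrable_exp (by omega) p g)
      (h.integrable_exp_mul (by omega) gX p g) (h.integrable_exp_mul (by omega) gX2 p g)).trans ?_
    exact tmean_mono (h.integrable_exp_mul (by omega) gX2 p g)
      (h.integrable_exp_mul (by omega) gY p g) fun y => hsq p _

lemma SubQuad.tendsto_tmean {f : ℕ → Spins N → ℝ} {f' : Spins N → ℝ} {X : ℕ → Spins N → ℝ}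
    {X' : Spins N → ℝ} {m : ℝ} (hf : ∀ n, Measurable (f n)) (hX : ∀ n, Measurable (X n))
    (hfb : ∀ η > 0, ∃ C, 0 ≤ C ∧ ∀ n y, |f n y| ≤ C + η * ∑ i, y i ^ 2)
    (hXb : ∀ η > 0, ∃ C, 0 ≤ C ∧ ∀ n y, |X n y| ≤ C + η * ∑ i, y i ^ 2)
    (hf' : ∀ y, Tendsto (fun n => f n y) atTop (𝓝 (f' y)))
    (hX' : ∀ y, Tendsto (fun n => X n y) atTop (𝓝 (X' y)))
    (he : Integrable (fun y => Real.exp (m * f' y)) (spinMeasure N)) :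
    Tendsto (fun n => tmean (spinMeasure N) m (f n) (X n)) atTop
      (𝓝 (tmean (spinMeasure N) m f' X')) := by
  obtain ⟨C, -, h1⟩ := hfb (1 / (4 * (|m| + 1))) (by positivity)
  obtain ⟨D, hD, h2⟩ := hXb (1 / 8) (by positivity)
  have hI : ∀ A : ℝ, Integrable (fun y : Spins N => A * Real.exp (3 / 8 * ∑ i, y i ^ 2))
      (spinMeasure N) := fun A => (integrable_exp_sum_sq N (by norm_num)).const_mul A
  refine Tendsto.div ?_ ?_ (integral_exp_pos he).ne'
  · exact tendsto_integral_of_dominated_convergence _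
      (fun n => (((hf n).const_mul m).exp.mul (hX n)).aestronglyMeasurable) (hI _)
      (fun n => ae_of_all _ fun y => exp_mul_quad_bound m hD (h1 n y) (h2 n y))
      (ae_of_all _ fun y => ((hf' y).const_mul m).rexp.mul (hX' y))
  · refine tendsto_integral_of_dominated_convergence _
      (fun n => ((hf n).const_mul m).exp.aestronglyMeasurable)
      (hI (Real.exp (|m| * C) * (1 + 1)))
      (fun n => ae_of_all _ fun y => ?_)
      (ae_of_all _ fun y => ((hf' y).const_mul m).rexp)
    have := exp_mul_quad_bound m (X := 1) zero_le_one (h1 n y) (by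
      have : 0 ≤ ∑ i, y i ^ 2 := Finset.sum_nonneg fun i _ => sq_nonneg _
      rw [abs_one]; linarith)
    simpa using this

lemma Growth.section_bound_seq {a : ℕ} {f : P → Fields N → ℝ} (hM : ∀ p, 0 ≤ M p)
    (hf : Growth M (a + 1) f) (p : ℕ → P) {B : ℝ} (hB : ∀ n, M (p n) ≤ B) (g : Fields N) :
    ∀ η > 0, ∃ C, 0 ≤ C ∧ ∀ n y, |f (p n) (Function.update g (a + 1) y)| ≤
      C + η * ∑ i, y i ^ 2 := by
  intro η hη
  obtain ⟨C, hC, h⟩ := hf.section_bound hη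
  have hB0 : 0 ≤ B := (hM (p 0)).trans (hB 0)
  have hs := fieldSq_nonneg a g
  refine ⟨C * (1 + B) + η * fieldSq a g, by positivity, fun n y => (h _ g y).trans ?_⟩
  gcongr
  exact hB n

lemma LevelGrowth.tendsto_tilt (h : LevelGrowth K m M v) {p : ℕ → P} {p' : P} {B : ℝ}
    (hB : ∀ n, M (p n) ≤ B)
    (hv : ∀ a ≤ K, ∀ g, Tendsto (fun n => v (p n) a g) atTop (𝓝 (v p' a g))) (k : ℕ) :
    ∀ a, a + k ≤ K → Growth M (a + k) X →
      (∀ g, Tendsto (fun n => X (p n) g) atTop (𝓝 (X p' g))) →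
      ∀ g, Tendsto (fun n => tiltLevels m (v (p n)) (X (p n)) a k g) atTop
        (𝓝 (tiltLevels m (v p') (X p') a k g)) := by
  induction k with
  | zero => exact fun a _ _ hX g => hX g
  | succ k ih =>
    intro a ha hX hlim g
    rw [show a + (k + 1) = a + 1 + k by ring] at hX
    have gX := h.tilt k (a + 1) (by omega) hX
    have gv := h.growth (a + 1) (by omega)
    have hu := measurable_updateField (a + 1) g
    exact SubQuad.tendsto_tmean (fun n => (gv.meas _).comp hu) (fun n => (gX.meas _).comp hu)
      (gv.section_bound_seq h.M_nonneg p hB g) (gX.section_bound_seq h.M_nonneg p hB g)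
      (fun y => hv (a + 1) (by omega) _) (fun y => ih (a + 1) (by omega) hX hlim _)
      (h.integrable_exp (by omega) p' g)

end Growth

end GaussianSpinGlass
end

noncomputable section

namespace GaussianSpinGlass

variable {N : ℕ}

/-! ### Averages over several levels -/

lemma levelsAvg_mul {φ F : Fields N → ℝ} (n : ℕ) :
    ∀ a, IndepAbove a φ → ∀ g, levelsAvg a n (fun g => φ g * F g) g = φ g * levelsAvg a n F g := by
  induction n with
  | zero => intros; rfl
  | succ n ih =>
    intro a hφ g
    simp only [levelsAvg, levelAvg]
    rw [← integral_const_mul]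
    congr 1
    ext y
    rw [ih (a + 1) (hφ.mono (Nat.le_succ a)), hφ _ (Nat.lt_succ_self a)]

lemma levelsAvg_const {φ : Fields N → ℝ} (n : ℕ) :
    ∀ a, IndepAbove a φ → ∀ g, levelsAvg a n φ g = φ g := by
  induction n with
  | zero => intros; rfl
  | succ n ih =>
    intro a hφ g
    simp only [levelsAvg, levelAvg, ih (a + 1) (hφ.mono (Nat.le_succ a)),
      hφ _ (Nat.lt_succ_self a)]
    simp

lemma levelsAvg_add (F : Fields N → ℝ) (n k : ℕ) :
    ∀ a, levelsAvg a (n + k) F = levelsAvg a n (levelsAvg (a + n) k F) := by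
  induction n with
  | zero => intro a; simp [levelsAvg]
  | succ n ih =>
    intro a
    rw [show n + 1 + k = (n + k) + 1 by ring]
    simp only [levelsAvg]
    rw [ih (a + 1), show a + 1 + n = a + (n + 1) by ring]

/-- The normalized weight `exp (m v) / E_a exp (m v)`. -/
def expWeight (m : ℕ → ℝ) (v : ℕ → Fields N → ℝ) (a : ℕ) (g : Fields N) : ℝ :=
  Real.exp (m a * v a g) / ∫ y, Real.exp (m a * v a (Function.update g a y)) ∂(spinMeasure N)

lemma IndepAbove.expWeight (m : ℕ → ℝ) {v : ℕ → Fields N → ℝ} {a : ℕ} (h : IndepAbove a (v a)) :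
    IndepAbove a (expWeight m v a) := by
  intro c hc g y
  simp only [GaussianSpinGlass.expWeight, h c hc g y]
  congr 2
  ext y'
  rw [Function.update_comm (show c ≠ a by omega), h c hc]

lemma levelAvg_expWeight_mul (m : ℕ → ℝ) (v : ℕ → Fields N → ℝ) (X : Fields N → ℝ) (a : ℕ)
    (g : Fields N) :
    levelAvg a (fun g => expWeight m v a g * X g) g =
      tmean (spinMeasure N) (m a) (fun y => v a (Function.update g a y))
        (fun y => X (Function.update g a y)) := by
  simp only [levelAvg, expWeight, tmean, Function.update_idem]
  rw [← integral_div]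
  congr 1
  ext y
  ring

lemma levelsAvg_prod_expWeight (m : ℕ → ℝ) {v : ℕ → Fields N → ℝ} {X : Fields N → ℝ} (n : ℕ) :
    ∀ a, (∀ b, a < b → b ≤ a + n → IndepAbove b (v b)) → ∀ g,
      levelsAvg a n (fun g => (∏ b ∈ Finset.Ioc a (a + n), expWeight m v b g) * X g) g =
        tiltLevels m v X a n g := by
  induction n with
  | zero => intro a _ g; simp [levelsAvg, tiltLevels]
  | succ n ih =>
    intro a hv g
    have e : (fun g => (∏ b ∈ Finset.Ioc a (a + (n + 1)), expWeight m v b g) * X g) =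
        fun g => expWeight m v (a + 1) g *
          ((∏ b ∈ Finset.Ioc (a + 1) (a + 1 + n), expWeight m v b g) * X g) := by
      ext g
      rw [show a + (n + 1) = a + 1 + n by ring, ← Finset.prod_Ioc_consecutive _
        (Nat.le_succ a) (Nat.le_add_right (a + 1) n), Nat.Ioc_succ_singleton,
        Finset.prod_singleton, mul_assoc]
    rw [e]
    simp only [levelsAvg, tiltLevels]
    rw [← levelAvg_expWeight_mul]
    simp only [levelAvg]
    congr 1
    ext y
    rw [levelsAvg_mul n (a + 1) ((hv (a + 1) (by omega) (by omega)).expWeight m),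
      ih (a + 1) (fun b h1 h2 => hv b (by omega) (by omega))]

lemma levelPow_exp (m : ℝ) (a : ℕ) (v : Fields N → ℝ) (g : Fields N)
    (hI : Integrable (fun y => Real.exp (m * v (Function.update g a y))) (spinMeasure N)) :
    levelPow m a (fun g => Real.exp (v g)) g =
      Real.exp (lme (spinMeasure N) m (fun y => v (Function.update g a y))) := by
  by_cases hm : m = 0
  · subst hm
    simp [levelPow, levelAvg, lme_zero]
  · simp only [levelPow, hm, if_false, lme_of_ne hm, levelAvg, ← Real.exp_mul, mul_comm _ m]
    rw [Real.rpow_def_of_pos (integral_exp_pos hI), mul_comm]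

/-! ### The cut-off model -/

section Model
variable (β h lam : ℝ) (x : OrderParameter) (S : Set (Spins N)) (t : ℝ) (J : Couplings N)

/-- The interpolating partition function with the spins restricted to `S`. -/
def cutZ (g : Fields N) : ℝ := ∫ z in S, boltzmann β h lam x t J g z ∂(spinMeasure N)

/-- `log Z_a` with the spins restricted to `S`. -/
def cutLog (a : ℕ) : Fields N → ℝ :=
  nestLog x.m (fun g => Real.log (cutZ β h lam x S t J g)) a (x.K - a)

/-- The Boltzmann state with the spins restricted to `S`. -/
def cutState (g : Fields N) (O : Spins N → ℝ) : ℝ :=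
  (∫ z in S, O z * boltzmann β h lam x t J g z ∂(spinMeasure N)) / cutZ β h lam x S t J g

/-- The states `ω̃_a` with the spins restricted to `S`. -/
def cutTilt (a : ℕ) (g : Fields N) (O : Spins N → ℝ) : ℝ :=
  tiltLevels x.m (cutLog β h lam x S t J) (fun g => cutState β h lam x S t J g O) a (x.K - a) g

lemma cutLog_last (g : Fields N) :
    cutLog β h lam x S t J x.K g = Real.log (cutZ β h lam x S t J g) := by
  simp [cutLog, nestLog]

lemma cutLog_of_lt {a : ℕ} (ha : a < x.K) (g : Fields N) :
    cutLog β h lam x S t J a g = lme (spinMeasure N) (x.m (a + 1))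
      (fun y => cutLog β h lam x S t J (a + 1) (Function.update g (a + 1) y)) := by
  simp only [cutLog]
  rw [show x.K - a = (x.K - (a + 1)) + 1 by omega]
  rfl

lemma boltzmann_update {c : ℕ} (hc : x.K < c) (g : Fields N) (y z : Spins N) :
    boltzmann β h lam x t J (Function.update g c y) z = boltzmann β h lam x t J g z := by
  have e : ∑ a ∈ Finset.range x.K, Real.sqrt (x.q (a + 1) - x.q a) *
      ∑ i, Function.update g c y (a + 1) i * z i = ∑ a ∈ Finset.range x.K,
        Real.sqrt (x.q (a + 1) - x.q a) * ∑ i, g (a + 1) i * z i := by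
    refine Finset.sum_congr rfl fun a ha => ?_
    rw [Function.update_of_ne]
    have := Finset.mem_range.1 ha
    omega
  simp only [boltzmann, e]

lemma indepAbove_cutZ : IndepAbove x.K (cutZ β h lam x S t J) := fun c hc g y => by
  simp only [cutZ, boltzmann_update β h lam x t J hc]

lemma indepAbove_cutState (O : Spins N → ℝ) :
    IndepAbove x.K (fun g => cutState β h lam x S t J g O) := fun c hc g y => by
  simp only [cutState, boltzmann_update β h lam x t J hc, indepAbove_cutZ β h lam x S t J c hc g y]

lemma indepAbove_cutLog {a : ℕ} (ha : a ≤ x.K) : IndepAbove a (cutLog β h lam x S t J a) := by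
  refine IndepAbove.nestLog x.m (x.K - a) a ?_
  rw [Nat.add_sub_cancel' ha]
  exact fun c hc g y => by simp only [indepAbove_cutZ β h lam x S t J c hc g y]

lemma indepAbove_cutTilt {a : ℕ} (ha : a ≤ x.K) (O : Spins N → ℝ) :
    IndepAbove a (fun g => cutTilt β h lam x S t J a g O) := by
  refine IndepAbove.tiltLevels x.m (x.K - a) a
    (fun b _ hb => indepAbove_cutLog β h lam x S t J (by omega)) ?_
  rw [Nat.add_sub_cancel' ha]
  exact indepAbove_cutState β h lam x S t J O

/-- Positivity and integrability conditions under which the nested averages make sense. -/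
structure WellPosed : Prop where
  pos : ∀ g, 0 < cutZ β h lam x S t J g
  int_exp : ∀ a < x.K, ∀ g, Integrable (fun y => Real.exp (x.m (a + 1) *
    cutLog β h lam x S t J (a + 1) (Function.update g (a + 1) y))) (spinMeasure N)
  int_log : ∀ a < x.K, ∀ g, Integrable (fun y =>
    cutLog β h lam x S t J (a + 1) (Function.update g (a + 1) y)) (spinMeasure N)

variable {β h lam x t J}

lemma cutZ_univ (g : Fields N) : cutZ β h lam x Set.univ t J g = interpZ β h lam x t J g := by
  simp [cutZ, interpZ]

lemma cutState_univ (g : Fields N) (O : Spins N → ℝ) :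
    cutState β h lam x Set.univ t J g O = state β h lam x t J g O := by
  simp [cutState, state, cutZ_univ]

lemma WellPosed.levelZ_eq (H : WellPosed β h lam x (Set.univ : Set (Spins N)) t J)
    {a : ℕ} (ha : a ≤ x.K) :
    levelZ β h lam x t J a = fun g => Real.exp (cutLog β h lam x Set.univ t J a g) := by
  have key : ∀ n a, a + n = x.K → levelZAux β h lam x t J a n =
      fun g => Real.exp (cutLog β h lam x (Set.univ : Set (Spins N)) t J a g) := by
    intro n
    induction n with
    | zero =>
      intro a ha
      rw [show a = x.K by omega]
      ext g
      rw [cutLog_last, Real.exp_log (H.pos g), cutZ_univ]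
      rfl
    | succ n ih =>
      intro a ha
      ext g
      simp only [levelZAux]
      rw [ih (a + 1) (by omega), levelPow_exp _ _ _ _ (H.int_exp a (by omega) g),
        cutLog_of_lt β h lam x _ t J (by omega : a < x.K)]
  exact key _ a (Nat.add_sub_cancel' ha)

lemma WellPosed.weight_eq (H : WellPosed β h lam x (Set.univ : Set (Spins N)) t J)
    {a : ℕ} (ha : a ≤ x.K) (g : Fields N) :
    weight β h lam x t J a g = expWeight x.m (cutLog β h lam x Set.univ t J) a g := by
  simp only [weight, expWeight, levelAvg, H.levelZ_eq ha, ← Real.exp_mul, mul_comm _ (x.m a)]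

lemma WellPosed.levelState_eq (H : WellPosed β h lam x (Set.univ : Set (Spins N)) t J)
    {a : ℕ} (ha : a ≤ x.K) (g : Fields N) (O : Spins N → ℝ) :
    levelState β h lam x t J a g O = cutTilt β h lam x Set.univ t J a g O := by
  rw [cutTilt, ← levelsAvg_prod_expWeight x.m (x.K - a) a
    (fun b _ hb => indepAbove_cutLog β h lam x _ t J (by omega)) g, levelState]
  congr 1
  ext g'
  rw [Nat.add_sub_cancel' ha, cutState_univ]
  congr 1
  refine Finset.prod_congr rfl fun b hb => H.weight_eq (Finset.mem_Ioc.1 hb).2 g'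

lemma WellPosed.bracket_inner_eq (H : WellPosed β h lam x (Set.univ : Set (Spins N)) t J)
    {a : ℕ} (ha : a ≤ x.K) {R : Fields N → ℝ}
    (hR : IndepAbove a R) (g : Fields N) :
    levelsAvg 0 x.K (fun g => (∏ b ∈ Finset.Ioc 0 a, weight β h lam x t J b g) * R g) g =
      tiltLevels x.m (cutLog β h lam x Set.univ t J) R 0 a g := by
  have e : (fun g => (∏ b ∈ Finset.Ioc 0 a, weight β h lam x t J b g) * R g) =
      fun g => (∏ b ∈ Finset.Ioc 0 (0 + a), expWeight x.m (cutLog β h lam x Set.univ t J) b g)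
        * R g := by
    ext g
    rw [zero_add]
    congr 1
    exact Finset.prod_congr rfl fun b hb =>
      H.weight_eq ((Finset.mem_Ioc.1 hb).2.trans ha) g
  rw [e]
  conv_lhs => rw [← Nat.add_sub_cancel' ha]
  rw [levelsAvg_add, zero_add]
  rw [← levelsAvg_prod_expWeight x.m a 0
    (fun b _ hb => indepAbove_cutLog β h lam x _ t J (by omega)) g, zero_add]
  congr 1
  ext g'
  refine levelsAvg_const _ a (IndepAbove.mul ?_ hR) g'
  intro c hc g y
  refine Finset.prod_congr rfl fun b hb => ?_
  have hb' := (Finset.mem_Ioc.1 hb).2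
  exact (indepAbove_cutLog β h lam x _ t J (hb'.trans ha)).expWeight x.m c (by omega) g y

end Model

end GaussianSpinGlass
end

noncomputable section

namespace GaussianSpinGlass

variable {N : ℕ}

/-! ### Bounds for the Boltzmann factor -/

lemma OrderParameter.m_nonneg (x : OrderParameter) {a : ℕ} (ha : a ≤ x.K + 1) : 0 ≤ x.m a := by
  induction a with
  | zero => rw [x.m_zero]
  | succ a ih => exact (ih (by omega)).trans (x.m_mono a (by omega))

/-- `|z|²`. -/
def spinSq (z : Spins N) : ℝ := ∑ i, z i ^ 2

lemma spinSq_nonneg (z : Spins N) : 0 ≤ spinSq z := Finset.sum_nonneg fun _ _ => sq_nonneg _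

/-- `∑ J_{ij}²`. -/
def couplingSq (J : Couplings N) : ℝ := ∑ i, ∑ j, J i j ^ 2

lemma couplingSq_nonneg (J : Couplings N) : 0 ≤ couplingSq J :=
  Finset.sum_nonneg fun _ _ => Finset.sum_nonneg fun _ _ => sq_nonneg _

/-- The cube `[-(n+1), n+1]^N`. -/
def box (n : ℕ) : Set (Spins N) := {z | ∀ i, |z i| ≤ n + 1}

lemma measurableSet_box (n : ℕ) : MeasurableSet (box n : Set (Spins N)) := by
  have : (box n : Set (Spins N)) = ⋂ i, {z : Spins N | |z i| ≤ (n : ℝ) + 1} := by ext z; simp [box]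
  rw [this]
  exact MeasurableSet.iInter fun i => measurableSet_le (by fun_prop) measurable_const

lemma box_mono : Monotone (box : ℕ → Set (Spins N)) := fun n k hnk z hz i =>
  (hz i).trans (by gcongr)

lemma iUnion_box : ⋃ n, (box n : Set (Spins N)) = Set.univ := by
  refine Set.eq_univ_of_forall fun z => ?_
  obtain ⟨n, hn⟩ := exists_nat_ge (∑ i, |z i|)
  refine Set.mem_iUnion.2 ⟨n, fun i => ?_⟩
  have : |z i| ≤ ∑ i, |z i| :=
    Finset.single_le_sum (f := fun i => |z i|) (fun _ _ => abs_nonneg _) (Finset.mem_univ i)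
  linarith

lemma spinMeasure_box_zero_ne : spinMeasure N (box 0) ≠ 0 := by
  have e : (box 0 : Set (Spins N)) = Set.univ.pi fun _ => Set.Icc (-1 : ℝ) 1 := by
    ext z; simp [box, abs_le, Pi.le_def, forall_and]
  rw [e, spinMeasure, Measure.pi_pi]
  refine Finset.prod_ne_zero_iff.2 fun i _ h0 => ?_
  have := gaussianReal_absolutelyContinuous' 0 one_ne_zero h0
  rw [Real.volume_Icc] at this
  norm_num at this

section Model
variable (β h lam : ℝ) (x : OrderParameter)

/-- The exponent of the interpolating Boltzmann factor. -/
def expo (t : ℝ) (J : Couplings N) (g : Fields N) (z : Spins N) : ℝ :=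
  β * Real.sqrt (t / (2 * N)) * (∑ i, ∑ j, J i j * z i * z j)
    - t * (β ^ 2 / (4 * N)) * (∑ i, z i ^ 2) ^ 2
    + β * Real.sqrt (1 - t) *
        ∑ a ∈ Finset.range x.K, Real.sqrt (x.q (a + 1) - x.q a) * ∑ i, g (a + 1) i * z i
    + (1 - t) * (-(β ^ 2 * x.Q) / 2) * ∑ i, z i ^ 2
    + β * h * ∑ i, z i + lam / 2 * ∑ i, z i ^ 2

lemma boltzmann_eq (t : ℝ) (J : Couplings N) (g : Fields N) (z : Spins N) :
    boltzmann β h lam x t J g z = Real.exp (expo β h lam x t J g z) := rfl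

lemma abs_coupling_term_le {t : ℝ} (ht : 0 ≤ t) (J : Couplings N) (z : Spins N) :
    |β * Real.sqrt (t / (2 * N)) * (∑ i, ∑ j, J i j * z i * z j)| ≤
      couplingSq J + t * (β ^ 2 / (8 * N)) * spinSq z ^ 2 := by
  set c := β * Real.sqrt (t / (2 * N)) with hc
  have hc2 : c ^ 2 / 4 = t * (β ^ 2 / (8 * N)) := by
    rw [hc, mul_pow, Real.sq_sqrt (by positivity)]
    rcases Nat.eq_zero_or_pos N with rfl | hN
    · simp
    · have : (N : ℝ) ≠ 0 := by positivity
      field_simp; ring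
  rw [← hc2]
  have e : spinSq z ^ 2 = ∑ i, ∑ j, z i ^ 2 * z j ^ 2 := by
    rw [spinSq, sq, Finset.sum_mul_sum]
  rw [e, couplingSq, Finset.mul_sum, Finset.mul_sum, ← Finset.sum_add_distrib]
  refine (Finset.abs_sum_le_sum_abs _ _).trans (Finset.sum_le_sum fun i _ => ?_)
  rw [Finset.mul_sum, Finset.mul_sum, ← Finset.sum_add_distrib]
  refine (Finset.abs_sum_le_sum_abs _ _).trans (Finset.sum_le_sum fun j _ => ?_)
  rw [abs_le]
  constructor
  · nlinarith [sq_nonneg (J i j + c / 2 * (z i * z j))]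
  · nlinarith [sq_nonneg (J i j - c / 2 * (z i * z j))]

lemma abs_field_term_le {η : ℝ} (hη : 0 < η) {t : ℝ} (ht : t ∈ Set.Icc (0 : ℝ) 1) (g : Fields N)
    (z : Spins N) :
    |β * Real.sqrt (1 - t) *
        ∑ a ∈ Finset.range x.K, Real.sqrt (x.q (a + 1) - x.q a) * ∑ i, g (a + 1) i * z i| ≤
      η * fieldSq x.K g +
        (∑ a ∈ Finset.range x.K, β ^ 2 * (x.q (a + 1) - x.q a) / (4 * η)) * spinSq z := by
  rw [Finset.mul_sum, fieldSq, Finset.mul_sum, Finset.sum_mul, ← Finset.sum_add_distrib]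
  refine (Finset.abs_sum_le_sum_abs _ _).trans (Finset.sum_le_sum fun a ha => ?_)
  have hq : 0 ≤ x.q (a + 1) - x.q a := sub_nonneg.2 (x.q_mono a (Finset.mem_range.1 ha))
  rw [spinSq, Finset.mul_sum, Finset.mul_sum, Finset.mul_sum, Finset.mul_sum,
    ← Finset.sum_add_distrib]
  refine (Finset.abs_sum_le_sum_abs _ _).trans (Finset.sum_le_sum fun i _ => ?_)
  have h1 : Real.sqrt (1 - t) ≤ 1 := by
    rw [Real.sqrt_le_one]; linarith [ht.1]
  have h0 := Real.sqrt_nonneg (1 - t)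
  set s := Real.sqrt (x.q (a + 1) - x.q a)
  have hs : s ^ 2 = x.q (a + 1) - x.q a := Real.sq_sqrt hq
  have hs0 : 0 ≤ s := Real.sqrt_nonneg _
  rw [← hs]
  have e : η * g (a + 1) i ^ 2 + β ^ 2 * s ^ 2 / (4 * η) * z i ^ 2 =
      |β| * s * |g (a + 1) i| * |z i| +
        (2 * η * |g (a + 1) i| - |β| * s * |z i|) ^ 2 / (4 * η) := by
    rw [← sq_abs (g (a + 1) i), ← sq_abs β, ← sq_abs (z i)]
    field_simp
    ring
  rw [e]
  have h2 : 0 ≤ (2 * η * |g (a + 1) i| - |β| * s * |z i|) ^ 2 / (4 * η) := by positivity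
  have h3 : |β * Real.sqrt (1 - t) * (s * (g (a + 1) i * z i))| =
      Real.sqrt (1 - t) * (|β| * s * |g (a + 1) i| * |z i|) := by
    simp only [abs_mul, abs_of_nonneg h0, abs_of_nonneg hs0]; ring
  rw [h3]
  have h4 : 0 ≤ |β| * s * |g (a + 1) i| * |z i| := by positivity
  nlinarith

lemma abs_expo_add_le {η : ℝ} (hη : 0 < η) : ∃ D, 0 ≤ D ∧ ∀ t ∈ Set.Icc (0 : ℝ) 1,
    ∀ (J : Couplings N) (g : Fields N) (z : Spins N),
      |expo β h lam x t J g z + t * (β ^ 2 / (4 * N)) * spinSq z ^ 2| ≤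
        couplingSq J + t * (β ^ 2 / (8 * N)) * spinSq z ^ 2 + η * fieldSq x.K g
          + D * (1 + spinSq z) := by
  set D₁ := ∑ a ∈ Finset.range x.K, β ^ 2 * (x.q (a + 1) - x.q a) / (4 * η)
  have hD₁ : 0 ≤ D₁ := Finset.sum_nonneg fun a ha => by
    have hq : 0 ≤ x.q (a + 1) - x.q a := sub_nonneg.2 (x.q_mono a (Finset.mem_range.1 ha))
    positivity
  refine ⟨D₁ + |β ^ 2 * x.Q / 2| + |β * h| * (N + 1) + |lam / 2|, by positivity,
    fun t ht J g z => ?_⟩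
  have p1 := abs_coupling_term_le β ht.1 J z
  have p2 := abs_field_term_le β x hη ht g z
  have hs := spinSq_nonneg z
  have p3 : |(1 - t) * (-(β ^ 2 * x.Q) / 2) * spinSq z| ≤ |β ^ 2 * x.Q / 2| * spinSq z := by
    rw [abs_mul, abs_mul, abs_of_nonneg hs, abs_of_nonneg (by linarith [ht.2] : 0 ≤ 1 - t),
      neg_div, abs_neg]
    gcongr
    exact mul_le_of_le_one_left (abs_nonneg _) (by linarith [ht.1])
  have p4 : |β * h * ∑ i, z i| ≤ |β * h| * (N + 1) * (1 + spinSq z) := by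
    rw [abs_mul, mul_assoc]
    gcongr
    have : |∑ i, z i| ≤ ∑ i, (1 + z i ^ 2) := by
      refine (Finset.abs_sum_le_sum_abs _ _).trans (Finset.sum_le_sum fun i _ => ?_)
      nlinarith [sq_nonneg (|z i| - 1), sq_abs (z i), abs_nonneg (z i)]
    rw [Finset.sum_add_distrib] at this
    simp only [Finset.sum_const, Finset.card_univ, Fintype.card_fin, nsmul_eq_mul, mul_one] at this
    have hN : (0 : ℝ) ≤ N := Nat.cast_nonneg N
    have e : ∑ i, z i ^ 2 = spinSq z := rfl
    rw [e] at this
    nlinarith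
  have p5 : |lam / 2 * spinSq z| ≤ |lam / 2| * spinSq z := by
    rw [abs_mul, abs_of_nonneg hs]
  have e : expo β h lam x t J g z + t * (β ^ 2 / (4 * N)) * spinSq z ^ 2 =
      β * Real.sqrt (t / (2 * N)) * (∑ i, ∑ j, J i j * z i * z j) +
      β * Real.sqrt (1 - t) *
        ∑ a ∈ Finset.range x.K, Real.sqrt (x.q (a + 1) - x.q a) * ∑ i, g (a + 1) i * z i
      + (1 - t) * (-(β ^ 2 * x.Q) / 2) * spinSq z
      + β * h * ∑ i, z i + lam / 2 * spinSq z := by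
    simp only [expo, spinSq]; ring
  rw [e]
  have A := abs_add_le (β * Real.sqrt (t / (2 * N)) * (∑ i, ∑ j, J i j * z i * z j) +
      β * Real.sqrt (1 - t) *
        ∑ a ∈ Finset.range x.K, Real.sqrt (x.q (a + 1) - x.q a) * ∑ i, g (a + 1) i * z i
      + (1 - t) * (-(β ^ 2 * x.Q) / 2) * spinSq z
      + β * h * ∑ i, z i) (lam / 2 * spinSq z)
  have B := abs_add_le (β * Real.sqrt (t / (2 * N)) * (∑ i, ∑ j, J i j * z i * z j) +
      β * Real.sqrt (1 - t) *
        ∑ a ∈ Finset.range x.K, Real.sqrt (x.q (a + 1) - x.q a) * ∑ i, g (a + 1) i * z i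
      + (1 - t) * (-(β ^ 2 * x.Q) / 2) * spinSq z) (β * h * ∑ i, z i)
  have C := abs_add_le (β * Real.sqrt (t / (2 * N)) * (∑ i, ∑ j, J i j * z i * z j) +
      β * Real.sqrt (1 - t) *
        ∑ a ∈ Finset.range x.K, Real.sqrt (x.q (a + 1) - x.q a) * ∑ i, g (a + 1) i * z i)
      ((1 - t) * (-(β ^ 2 * x.Q) / 2) * spinSq z)
  have D := abs_add_le (β * Real.sqrt (t / (2 * N)) * (∑ i, ∑ j, J i j * z i * z j))
      (β * Real.sqrt (1 - t) *
        ∑ a ∈ Finset.range x.K, Real.sqrt (x.q (a + 1) - x.q a) * ∑ i, g (a + 1) i * z i)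
  have q1 : 0 ≤ |β ^ 2 * x.Q / 2| := abs_nonneg _
  have q2 : 0 ≤ |lam / 2| := abs_nonneg _
  have key : (D₁ + |β ^ 2 * x.Q / 2| + |β * h| * (N + 1) + |lam / 2|) * (1 + spinSq z) =
      D₁ * spinSq z + |β ^ 2 * x.Q / 2| * spinSq z + |β * h| * (N + 1) * (1 + spinSq z) +
        |lam / 2| * spinSq z + (D₁ + |β ^ 2 * x.Q / 2| + |lam / 2|) := by ring
  rw [key]
  linarith

/-- On the unit cube the exponent is bounded by `C (1 + |J|²) + η ∑ |g|²`. -/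
lemma abs_expo_le_of_mem_box (n : ℕ) {η : ℝ} (hη : 0 < η) : ∃ C, 0 ≤ C ∧ ∀ t ∈ Set.Icc (0 : ℝ) 1,
    ∀ (J : Couplings N) (g : Fields N), ∀ z ∈ (box n : Set (Spins N)),
      |expo β h lam x t J g z| ≤ C * (1 + couplingSq J) + η * fieldSq x.K g := by
  obtain ⟨D, hD, H⟩ := abs_expo_add_le (N := N) β h lam x hη
  set r : ℝ := N * (n + 1) ^ 2
  refine ⟨1 + β ^ 2 / (8 * N) * r ^ 2 + β ^ 2 / (4 * N) * r ^ 2 + D * (1 + r), by positivity,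
    fun t ht J g z hz => ?_⟩
  have hs := spinSq_nonneg z
  have hr : spinSq z ≤ r := by
    have : spinSq z ≤ ∑ i : Fin N, ((n : ℝ) + 1) ^ 2 := Finset.sum_le_sum fun i _ => by
      rw [← sq_abs]; exact pow_le_pow_left₀ (abs_nonneg _) (hz i) 2
    simpa [r] using this
  have h2 : spinSq z ^ 2 ≤ r ^ 2 := pow_le_pow_left₀ hs hr 2
  have h1 := H t ht J g z
  have hJ := couplingSq_nonneg J
  have b1 : t * (β ^ 2 / (8 * N)) * spinSq z ^ 2 ≤ β ^ 2 / (8 * N) * r ^ 2 :=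
    mul_le_mul (mul_le_of_le_one_left (by positivity) ht.2) h2 (by positivity) (by positivity)
  have b2 : t * (β ^ 2 / (4 * N)) * spinSq z ^ 2 ≤ β ^ 2 / (4 * N) * r ^ 2 :=
    mul_le_mul (mul_le_of_le_one_left (by positivity) ht.2) h2 (by positivity) (by positivity)
  have b20 : 0 ≤ t * (β ^ 2 / (4 * N)) * spinSq z ^ 2 := by
    have := ht.1; positivity
  have b3 : D * (1 + spinSq z) ≤ D * (1 + r) := by gcongr
  have c1 : 0 ≤ (β ^ 2 / (8 * N) * r ^ 2 + β ^ 2 / (4 * N) * r ^ 2 + D * (1 + r)) * couplingSq J := by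
    positivity
  rw [abs_le] at h1 ⊢
  constructor <;> nlinarith [h1.1, h1.2]

/-- For `t` bounded away from `0` the quartic term dominates. -/
lemma expo_add_le (hβ : β ≠ 0) (hN : 1 ≤ N) {t₁ : ℝ} (ht₁ : 0 < t₁) {η : ℝ} (hη : 0 < η) :
    ∃ C, 0 ≤ C ∧ ∀ t ∈ Set.Icc t₁ 1, ∀ (J : Couplings N) (g : Fields N) (z : Spins N),
      expo β h lam x t J g z + t₁ * (β ^ 2 / (16 * N)) * spinSq z ^ 2 ≤
        C * (1 + couplingSq J) + η * fieldSq x.K g := by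
  obtain ⟨D, hD, H⟩ := abs_expo_add_le (N := N) β h lam x hη
  have hN0 : (0 : ℝ) < N := by exact_mod_cast hN
  set c := t₁ * (β ^ 2 / (16 * N)) with hc
  have hc0 : 0 < c := by positivity
  refine ⟨1 + D + D ^ 2 / (4 * c), by positivity, fun t ht J g z => ?_⟩
  have h1 := (abs_le.1 (H t ⟨ht₁.le.trans ht.1, ht.2⟩ J g z)).2
  have hJ := couplingSq_nonneg J
  have e : t * (β ^ 2 / (4 * N)) * spinSq z ^ 2 - t * (β ^ 2 / (8 * N)) * spinSq z ^ 2 =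
      2 * (t * (β ^ 2 / (16 * N)) * spinSq z ^ 2) := by field_simp; ring
  have e2 : c * spinSq z ^ 2 ≤ t * (β ^ 2 / (16 * N)) * spinSq z ^ 2 := by
    rw [hc]; gcongr; exact ht.1
  have e3 : D * spinSq z ≤ c * spinSq z ^ 2 + D ^ 2 / (4 * c) := by
    have : c * spinSq z ^ 2 + D ^ 2 / (4 * c) - D * spinSq z =
        (2 * c * spinSq z - D) ^ 2 / (4 * c) := by field_simp; ring
    have h0 : 0 ≤ (2 * c * spinSq z - D) ^ 2 / (4 * c) := by positivity
    linarith
  have c1 : 0 ≤ (D + D ^ 2 / (4 * c)) * couplingSq J := by positivity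
  nlinarith

end Model

end GaussianSpinGlass
end

noncomputable section

namespace GaussianSpinGlass

variable {N : ℕ}

section Measurability
variable (β h lam : ℝ) (x : OrderParameter)

lemma measurable_expo : Measurable (fun r : ((ℝ × Couplings N) × Fields N) × Spins N =>
    expo β h lam x r.1.1.1 r.1.1.2 r.1.2 r.2) := by
  unfold expo
  fun_prop

lemma measurable_expo_right (t : ℝ) (J : Couplings N) (g : Fields N) :
    Measurable (expo β h lam x t J g) := by
  unfold expo
  fun_prop

lemma measurable_cut_integral (S : Set (Spins N)) {O : Spins N → ℝ} (hO : Measurable O) :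
    Measurable (fun q : (ℝ × Couplings N) × Fields N =>
      ∫ z in S, O z * boltzmann β h lam x q.1.1 q.1.2 q.2 z ∂(spinMeasure N)) := by
  simp only [boltzmann_eq]
  have : Measurable (fun r : ((ℝ × Couplings N) × Fields N) × Spins N =>
      O r.2 * Real.exp (expo β h lam x r.1.1.1 r.1.1.2 r.1.2 r.2)) :=
    (hO.comp measurable_snd).mul (measurable_expo β h lam x).exp
  exact this.stronglyMeasurable.integral_prod_right'.measurable

lemma measurable_cutZ (S : Set (Spins N)) :
    Measurable (fun q : (ℝ × Couplings N) × Fields N => cutZ β h lam x S q.1.1 q.1.2 q.2) := by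
  simpa [cutZ] using measurable_cut_integral β h lam x S (O := fun _ => 1) measurable_const

lemma measurable_cutState (S : Set (Spins N)) {O : Spins N → ℝ} (hO : Measurable O) :
    Measurable (fun q : (ℝ × Couplings N) × Fields N =>
      cutState β h lam x S q.1.1 q.1.2 q.2 O) :=
  (measurable_cut_integral β h lam x S hO).div (measurable_cutZ β h lam x S)

lemma measurable_cutLog (S : Set (Spins N)) (a : ℕ) :
    Measurable (fun q : (ℝ × Couplings N) × Fields N =>
      cutLog β h lam x S q.1.1 q.1.2 a q.2) := by
  have := measurable_nestLog x.m (u := fun q : (ℝ × Couplings N) × Fields N =>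
    Real.log (cutZ β h lam x S q.1.1 q.1.2 q.2)) (measurable_cutZ β h lam x S).log (x.K - a) a
  exact this

lemma measurable_tilt_cutLog (S : Set (Spins N)) {X : (ℝ × Couplings N) × Fields N → ℝ}
    (hX : Measurable X) (a n : ℕ) :
    Measurable (fun q : (ℝ × Couplings N) × Fields N =>
      tiltLevels x.m (cutLog β h lam x S q.1.1 q.1.2) (fun g => X (q.1, g)) a n q.2) := by
  have := measurable_tiltLevels x.m (v := fun b (q : (ℝ × Couplings N) × Fields N) =>
    cutLog β h lam x S q.1.1 q.1.2 b q.2) (X := X)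
    (fun b => measurable_cutLog β h lam x S b) hX n a
  exact this

lemma measurable_cutTilt (S : Set (Spins N)) {O : Spins N → ℝ} (hO : Measurable O) (a : ℕ) :
    Measurable (fun q : (ℝ × Couplings N) × Fields N =>
      cutTilt β h lam x S q.1.1 q.1.2 a q.2 O) := by
  have := measurable_tilt_cutLog β h lam x S
    (X := fun q => cutState β h lam x S q.1.1 q.1.2 q.2 O)
    (measurable_cutState β h lam x S hO) a (x.K - a)
  exact this

lemma measurable_prodMk_field (t : ℝ) (J : Couplings N) :
    Measurable (fun g : Fields N => (((t, J), g) : (ℝ × Couplings N) × Fields N)) := by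
  fun_prop

end Measurability

/-- Measurable observables of growth at most `|z|⁴`. -/
def PolyBdd (O : Spins N → ℝ) : Prop :=
  Measurable O ∧ ∃ c, 0 ≤ c ∧ ∀ z, |O z| ≤ c * (1 + spinSq z ^ 2)

lemma PolyBdd.const_mul {O : Spins N → ℝ} (hO : PolyBdd O) (c : ℝ) :
    PolyBdd (fun z => c * O z) := by
  obtain ⟨hm, b, hb, h⟩ := hO
  refine ⟨hm.const_mul c, |c| * b, by positivity, fun z => ?_⟩
  rw [abs_mul, mul_assoc]
  exact mul_le_mul_of_nonneg_left (h z) (abs_nonneg _)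

lemma polyBdd_one : PolyBdd (fun _ : Spins N => 1) :=
  ⟨measurable_const, 1, zero_le_one, fun z => by
    have := sq_nonneg (spinSq z); rw [abs_one]; linarith⟩

lemma sq_le_spinSq (z : Spins N) (i : Fin N) : z i ^ 2 ≤ spinSq z :=
  Finset.single_le_sum (f := fun i => z i ^ 2) (fun _ _ => sq_nonneg _) (Finset.mem_univ i)

lemma polyBdd_sq_mul_sq (i j : Fin N) : PolyBdd (fun z : Spins N => (z i * z j) ^ 2) := by
  refine ⟨by fun_prop, 1, zero_le_one, fun z => ?_⟩
  have h1 := sq_le_spinSq z i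
  have h2 := sq_le_spinSq z j
  have h3 : z i ^ 2 * z j ^ 2 ≤ spinSq z * spinSq z :=
    mul_le_mul h1 h2 (sq_nonneg _) (spinSq_nonneg z)
  beta_reduce
  rw [abs_of_nonneg (sq_nonneg _), mul_pow]
  nlinarith

lemma polyBdd_sq (i : Fin N) : PolyBdd (fun z : Spins N => z i ^ 2) := by
  refine ⟨by fun_prop, 1, zero_le_one, fun z => ?_⟩
  have h1 := sq_le_spinSq z i
  rw [abs_of_nonneg (sq_nonneg _)]
  nlinarith [sq_nonneg (spinSq z - 1)]

lemma PolyBdd.of_sq {O : Spins N → ℝ} (hm : Measurable O) (h : PolyBdd (fun z => O z ^ 2)) :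
    PolyBdd O := by
  obtain ⟨-, c, hc, h⟩ := h
  refine ⟨hm, 1 + c, by positivity, fun z => ?_⟩
  have h1 := h z
  rw [abs_of_nonneg (sq_nonneg _)] at h1
  have h2 := sq_nonneg (spinSq z)
  nlinarith [sq_nonneg (|O z| - 1), sq_abs (O z), abs_nonneg (O z)]

section Family
variable (β h lam : ℝ) (x : OrderParameter) {P : Type*}

/-- A family of cut-off models with uniform bounds. -/
structure CutFamily (S : P → Set (Spins N)) (t : P → ℝ) (J : P → Couplings N) (θ : ℝ) : Prop where
  meas : ∀ p, MeasurableSet (S p)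
  sub : ∀ p, box 0 ⊆ S p
  ht : ∀ p, t p ∈ Set.Icc (0 : ℝ) 1
  hθ : 0 < θ
  up : ∀ η > 0, ∃ C, 0 ≤ C ∧ ∀ p g, ∀ z ∈ S p,
    expo β h lam x (t p) (J p) g z + θ * spinSq z ^ 2 ≤
      C * (1 + couplingSq (J p)) + η * fieldSq x.K g

lemma neZero_restrict {S : Set (Spins N)} (hS : box 0 ⊆ S) :
    NeZero ((spinMeasure N).restrict S) := by
  refine ⟨fun h0 => spinMeasure_box_zero_ne (N := N) ?_⟩
  rw [Measure.restrict_eq_zero] at h0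
  exact measure_mono_null hS h0

lemma cutState_eq_tmean (S : Set (Spins N)) (t : ℝ) (J : Couplings N) (g : Fields N)
    (O : Spins N → ℝ) : cutState β h lam x S t J g O =
      tmean ((spinMeasure N).restrict S) 1 (expo β h lam x t J g) O := by
  simp [cutState, cutZ, tmean, boltzmann_eq, mul_comm]

variable {β h lam x} {S : P → Set (Spins N)} {t : P → ℝ} {J : P → Couplings N} {θ : ℝ}

lemma CutFamily.integrable_exp (F : CutFamily β h lam x S t J θ) {θ' : ℝ} (h' : θ' ≤ θ) (p : P)
    (g : Fields N) :
    Integrable (fun z => Real.exp (expo β h lam x (t p) (J p) g z + θ' * spinSq z ^ 2))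
      ((spinMeasure N).restrict (S p)) := by
  obtain ⟨C, -, hC⟩ := F.up 1 one_pos
  refine Integrable.mono' (integrable_const
    (Real.exp (C * (1 + couplingSq (J p)) + 1 * fieldSq x.K g))) ?_ ?_
  · have := measurable_expo_right β h lam x (t p) (J p) g
    refine Measurable.aestronglyMeasurable ?_
    unfold spinSq
    fun_prop
  · refine ae_restrict_of_forall_mem (F.meas p) fun z hz => ?_
    rw [Real.norm_of_nonneg (Real.exp_nonneg _)]
    refine Real.exp_le_exp.2 (le_trans ?_ (hC p g z hz))
    gcongr

lemma CutFamily.integrable (F : CutFamily β h lam x S t J θ) (p : P) (g : Fields N)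
    {O : Spins N → ℝ} (hO : PolyBdd O) :
    Integrable (fun z => Real.exp (expo β h lam x (t p) (J p) g z) * O z)
      ((spinMeasure N).restrict (S p)) := by
  obtain ⟨hm, c, hc, hb⟩ := hO
  have hθ := F.hθ
  refine ((F.integrable_exp le_rfl p g).const_mul (c * (1 + 1 / θ))).mono'
    (((measurable_expo_right β h lam x (t p) (J p) g).exp.mul hm).aestronglyMeasurable)
    (ae_of_all _ fun z => ?_)
  rw [norm_mul, Real.norm_of_nonneg (Real.exp_nonneg _), Real.exp_add]
  have h1 : 1 + spinSq z ^ 2 ≤ (1 + 1 / θ) * Real.exp (θ * spinSq z ^ 2) := by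
    have e := Real.add_one_le_exp (θ * spinSq z ^ 2)
    have s := sq_nonneg (spinSq z)
    calc 1 + spinSq z ^ 2 ≤ (1 + 1 / θ) * (θ * spinSq z ^ 2 + 1) := by
          have : (1 + 1 / θ) * (θ * spinSq z ^ 2 + 1) =
            1 + spinSq z ^ 2 + (1 / θ + θ * spinSq z ^ 2) := by field_simp; ring
          have : 0 ≤ 1 / θ + θ * spinSq z ^ 2 := by positivity
          linarith
      _ ≤ _ := by gcongr
  calc _ ≤ Real.exp (expo β h lam x (t p) (J p) g z) * (c * (1 + spinSq z ^ 2)) :=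
        mul_le_mul_of_nonneg_left (hb z) (Real.exp_nonneg _)
    _ ≤ Real.exp (expo β h lam x (t p) (J p) g z) *
        (c * ((1 + 1 / θ) * Real.exp (θ * spinSq z ^ 2))) := by gcongr
    _ = _ := by ring

lemma CutFamily.integrable_boltzmann (F : CutFamily β h lam x S t J θ) (p : P) (g : Fields N) :
    Integrable (fun z => Real.exp (expo β h lam x (t p) (J p) g z))
      ((spinMeasure N).restrict (S p)) := by
  simpa using F.integrable p g polyBdd_one

lemma CutFamily.growth_log_integral (F : CutFamily β h lam x S t J θ) {θ' : ℝ} (h0 : 0 ≤ θ')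
    (h' : θ' ≤ θ) : Growth (fun p => couplingSq (J p)) x.K (fun p g =>
      Real.log (∫ z in S p, Real.exp (expo β h lam x (t p) (J p) g z + θ' * spinSq z ^ 2)
        ∂(spinMeasure N))) := by
  refine ⟨fun p => ?_, fun η hη => ?_⟩
  · have hm : Measurable (fun r : Fields N × Spins N =>
        Real.exp (expo β h lam x (t p) (J p) r.1 r.2 + θ' * spinSq r.2 ^ 2)) := by
      unfold expo spinSq; fun_prop
    exact (hm.stronglyMeasurable.integral_prod_right').measurable.log
  · obtain ⟨C, hC, hup⟩ := F.up η hη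
    obtain ⟨C', hC', hlo⟩ := abs_expo_le_of_mem_box (N := N) β h lam x 0 hη
    set L := |Real.log ((spinMeasure N).real (box 0))|
    have hb : 0 < (spinMeasure N).real (box 0) :=
      ENNReal.toReal_pos spinMeasure_box_zero_ne (measure_ne_top _ _)
    refine ⟨C + C' + L, by positivity, fun p g => ?_⟩
    have hJ := couplingSq_nonneg (J p)
    have hf := mul_nonneg hη.le (fieldSq_nonneg x.K g)
    have hInt := F.integrable_exp h' p g
    have := neZero_restrict (F.sub p)
    set I := ∫ z in S p, Real.exp (expo β h lam x (t p) (J p) g z + θ' * spinSq z ^ 2)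
        ∂(spinMeasure N)
    have hI : 0 < I := integral_exp_pos hInt
    set A := C * (1 + couplingSq (J p)) + η * fieldSq x.K g
    set A' := C' * (1 + couplingSq (J p)) + η * fieldSq x.K g
    have hA : 0 ≤ A := by positivity
    have up : I ≤ Real.exp A := by
      have h1 : I ≤ ∫ _ in S p, Real.exp A ∂(spinMeasure N) := by
        refine setIntegral_mono_on hInt (integrable_const _) (F.meas p) fun z hz => ?_
        refine Real.exp_le_exp.2 (le_trans ?_ (hup p g z hz))
        gcongr
      rw [setIntegral_const, smul_eq_mul] at h1
      exact h1.trans (mul_le_of_le_one_left (Real.exp_nonneg _) measureReal_le_one)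
    have lo : (spinMeasure N).real (box 0) * Real.exp (-A') ≤ I := by
      have h1 : ∫ z in box 0, Real.exp (expo β h lam x (t p) (J p) g z + θ' * spinSq z ^ 2)
          ∂(spinMeasure N) ≤ I :=
        setIntegral_mono_set hInt (ae_of_all _ fun z => Real.exp_nonneg _)
          (ae_of_all _ (F.sub p))
      have h2 : ∫ _ in box 0, Real.exp (-A') ∂(spinMeasure N) ≤
          ∫ z in box 0, Real.exp (expo β h lam x (t p) (J p) g z + θ' * spinSq z ^ 2)
          ∂(spinMeasure N) := by
        refine setIntegral_mono_on (integrable_const _)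
          (hInt.mono_measure (Measure.restrict_mono (F.sub p) le_rfl)) (measurableSet_box 0)
          fun z hz => ?_
        refine Real.exp_le_exp.2 ?_
        have := (abs_le.1 (hlo (t p) (F.ht p) (J p) g z hz)).1
        have : 0 ≤ θ' * spinSq z ^ 2 := by positivity
        linarith
      rw [setIntegral_const, smul_eq_mul] at h2
      exact h2.trans h1
    have up' := Real.log_le_log hI up
    have lo' := Real.log_le_log (by positivity) lo
    rw [Real.log_exp] at up'
    rw [Real.log_mul hb.ne' (Real.exp_ne_zero _), Real.log_exp] at lo'
    have hL : -L ≤ Real.log ((spinMeasure N).real (box 0)) := neg_abs_le _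
    have hL0 : 0 ≤ L := abs_nonneg _
    have q1 : 0 ≤ L * couplingSq (J p) := by positivity
    have q2 : 0 ≤ C * (1 + couplingSq (J p)) := by positivity
    have q3 : 0 ≤ C' * (1 + couplingSq (J p)) := by positivity
    rw [abs_le]
    constructor <;> nlinarith

lemma CutFamily.growth_log (F : CutFamily β h lam x S t J θ) :
    Growth (fun p => couplingSq (J p)) x.K
      (fun p g => Real.log (cutZ β h lam x (S p) (t p) (J p) g)) := by
  simpa [cutZ, boltzmann_eq] using F.growth_log_integral le_rfl F.hθ.le

lemma CutFamily.levelGrowth (F : CutFamily β h lam x S t J θ) :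
    LevelGrowth x.K x.m (fun p => couplingSq (J p))
      (fun p => cutLog β h lam x (S p) (t p) (J p)) where
  M_nonneg := fun p => couplingSq_nonneg _
  m_nonneg := fun b hb => x.m_nonneg (by omega)
  growth := fun a ha => Growth.nestLog (fun p => couplingSq_nonneg _)
    (fun b hb => x.m_nonneg (by omega)) F.growth_log (x.K - a) a (Nat.add_sub_cancel' ha)

lemma CutFamily.cutZ_pos (F : CutFamily β h lam x S t J θ) (p : P) (g : Fields N) :
    0 < cutZ β h lam x (S p) (t p) (J p) g := by
  have := neZero_restrict (F.sub p)
  exact integral_exp_pos (F.integrable_boltzmann p g)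

lemma CutFamily.wellPosed (F : CutFamily β h lam x S t J θ) (p : P) :
    WellPosed β h lam x (S p) (t p) (J p) where
  pos := F.cutZ_pos p
  int_exp := fun _ ha g => F.levelGrowth.integrable_exp ha p g
  int_log := fun a ha g => ((F.levelGrowth.growth (a + 1) ha).subQuad
    F.levelGrowth.M_nonneg p g).integrable

lemma abs_tmean_le_of_quartic {μ : Measure (Spins N)} [NeZero μ] {v O : Spins N → ℝ} {c θ : ℝ}
    (hc : 0 ≤ c) (hθ : 0 < θ) (hO : PolyBdd O) (hb : ∀ z, |O z| ≤ c * (1 + spinSq z ^ 2))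
    (iθ : Integrable (fun z => Real.exp (v z + θ * spinSq z ^ 2)) μ)
    (i1 : Integrable (fun z => Real.exp (v z)) μ)
    (i2 : ∀ {O : Spins N → ℝ}, PolyBdd O → Integrable (fun z => Real.exp (v z) * O z) μ) :
    |tmean μ 1 v O| ≤ c + c / θ * (Real.log (∫ z, Real.exp (v z + θ * spinSq z ^ 2) ∂μ) +
      -1 * Real.log (∫ z, Real.exp (v z) ∂μ)) := by
  have h4 : PolyBdd (fun z : Spins N => spinSq z ^ 2) :=
    ⟨by unfold spinSq; fun_prop, 1, zero_le_one, fun z => by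
      rw [abs_of_nonneg (sq_nonneg _)]; linarith⟩
  have i1' : Integrable (fun z => Real.exp (1 * v z)) μ := by simpa using i1
  have i2' : ∀ {O : Spins N → ℝ}, PolyBdd O → Integrable (fun z => Real.exp (1 * v z) * O z) μ :=
    fun hO => by simpa using i2 hO
  have jen := exp_tmean_mul_integral_le (μ := μ) (m := 1) (v := v)
    (w := fun z => v z + θ * spinSq z ^ 2) i1' (by simpa using iθ)
    (by simpa using i2 (h4.const_mul θ))
  simp only [add_sub_cancel_left, tmean_const_mul, one_mul] at jen
  have hZ : 0 < ∫ z, Real.exp (v z) ∂μ := integral_exp_pos i1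
  have jen' := Real.log_le_log (by positivity) jen
  rw [Real.log_mul (Real.exp_ne_zero _) hZ.ne', Real.log_exp] at jen'
  generalize hTd : tmean μ 1 v (fun z => spinSq z ^ 2) = T at jen'
  have hT : |tmean μ 1 v O| ≤ c * (1 + T) := by
    have e : c * (1 + T) = tmean μ 1 v (fun z => c * (1 + spinSq z ^ 2)) := by
      rw [tmean_const_mul, tmean_add (by simpa using i1) (i2' h4), tmean_const i1', hTd]
    have hP : PolyBdd (fun z : Spins N => c * (1 + spinSq z ^ 2)) :=
      ⟨by unfold spinSq; fun_prop, c, hc, fun z => by rw [abs_of_nonneg (by positivity)]⟩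
    rw [e, abs_le]
    constructor
    · have := tmean_mono (i2' (hP.const_mul (-1))) (i2' hO) fun z => by
        have := (abs_le.1 (hb z)).1; linarith
      rw [tmean_const_mul] at this
      linarith
    · exact tmean_mono (i2' hO) (i2' hP) fun z => (abs_le.1 (hb z)).2
  refine hT.trans ?_
  have h5 : θ * T ≤ Real.log (∫ z, Real.exp (v z + θ * spinSq z ^ 2) ∂μ) +
      -1 * Real.log (∫ z, Real.exp (v z) ∂μ) := by linarith
  calc c * (1 + T) = c + c / θ * (θ * T) := by field_simp
    _ ≤ _ := by gcongr

lemma CutFamily.growth_state (F : CutFamily β h lam x S t J θ) {O : Spins N → ℝ}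
    (hO : PolyBdd O) : Growth (fun p => couplingSq (J p)) x.K
      (fun p g => cutState β h lam x (S p) (t p) (J p) g O) := by
  have hM : ∀ p, 0 ≤ couplingSq (J p) := fun p => couplingSq_nonneg _
  obtain ⟨hm, c, hc, hb⟩ := id hO
  have hθ := F.hθ
  have hk := ((Growth.const_add (N := N) hM x.K c).add
    (((F.growth_log_integral hθ.le le_rfl).add (F.growth_log.const_mul (-1))).const_mul (c / θ)))
  refine hk.of_abs_le (fun p => ?_) fun p g => le_trans ?_ (le_abs_self _)
  · have := (measurable_cutState β h lam x (S p) hm).comp (measurable_prodMk_field (t p) (J p))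
    exact this
  · have := neZero_restrict (F.sub p)
    rw [cutState_eq_tmean]
    simp only [cutZ, boltzmann_eq]
    exact abs_tmean_le_of_quartic hc hθ hO hb (F.integrable_exp le_rfl p g)
      (F.integrable_boltzmann p g) (F.integrable p g)

lemma CutFamily.growth_tilt (F : CutFamily β h lam x S t J θ) {O : Spins N → ℝ}
    (hO : PolyBdd O) {a : ℕ} (ha : a ≤ x.K) : Growth (fun p => couplingSq (J p)) a
      (fun p g => cutTilt β h lam x (S p) (t p) (J p) a g O) :=
  F.levelGrowth.tilt (x.K - a) a (by omega)
    (by rw [Nat.add_sub_cancel' ha]; exact F.growth_state hO)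

lemma CutFamily.cutState_sum (F : CutFamily β h lam x S t J θ) {κ : Type*} (s : Finset κ)
    (c : κ → ℝ) {O : κ → Spins N → ℝ} (hO : ∀ k, PolyBdd (O k)) (p : P) (g : Fields N) :
    cutState β h lam x (S p) (t p) (J p) g (fun z => ∑ k ∈ s, c k * O k z) =
      ∑ k ∈ s, c k * cutState β h lam x (S p) (t p) (J p) g (O k) := by
  simp only [cutState_eq_tmean]
  rw [tmean_sum]
  · simp only [tmean_const_mul]
  · intro k _
    simpa using F.integrable p g ((hO k).const_mul (c k))

lemma CutFamily.cutTilt_sum (F : CutFamily β h lam x S t J θ) {κ : Type*} (s : Finset κ)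
    (c : κ → ℝ) {O : κ → Spins N → ℝ} (hO : ∀ k, PolyBdd (O k)) (p : P) {a : ℕ} (ha : a ≤ x.K)
    (g : Fields N) :
    cutTilt β h lam x (S p) (t p) (J p) a g (fun z => ∑ k ∈ s, c k * O k z) =
      ∑ k ∈ s, c k * cutTilt β h lam x (S p) (t p) (J p) a g (O k) := by
  simp only [cutTilt, F.cutState_sum s c hO]
  have e := F.levelGrowth.tilt_sum (X := fun k p g =>
      c k * cutState β h lam x (S p) (t p) (J p) g (O k)) s (a := a) (n := x.K - a) (by omega)
    (fun k _ => by rw [Nat.add_sub_cancel' ha]; exact (F.growth_state (hO k)).const_mul (c k)) p g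
  rw [e]
  simp only [tiltLevels_const_mul]

lemma CutFamily.sq_cutTilt_le (F : CutFamily β h lam x S t J θ) {O : Spins N → ℝ}
    (hO : Measurable O) (hO2 : PolyBdd (fun z => O z ^ 2)) (p : P) {a : ℕ} (ha : a ≤ x.K)
    (g : Fields N) :
    cutTilt β h lam x (S p) (t p) (J p) a g O ^ 2 ≤
      cutTilt β h lam x (S p) (t p) (J p) a g (fun z => O z ^ 2) := by
  have hO1 := PolyBdd.of_sq hO hO2
  refine F.levelGrowth.sq_tilt_le (X := fun p g => cutState β h lam x (S p) (t p) (J p) g O)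
    (Y := fun p g => cutState β h lam x (S p) (t p) (J p) g (fun z => O z ^ 2))
    (x.K - a) a (by omega) (by rw [Nat.add_sub_cancel' ha]; exact F.growth_state hO1)
    (by rw [Nat.add_sub_cancel' ha]; exact F.growth_state hO2) (fun p g => ?_) p g
  have := neZero_restrict (F.sub p)
  simp only [cutState_eq_tmean]
  exact sq_tmean_le (by simpa using F.integrable_boltzmann p g)
    (by simpa using F.integrable p g hO1) (by simpa using F.integrable p g hO2)

lemma CutFamily.cutTilt_one (F : CutFamily β h lam x S t J θ) (p : P) {a : ℕ} (ha : a ≤ x.K)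
    (g : Fields N) : cutTilt β h lam x (S p) (t p) (J p) a g (fun _ => 1) = 1 := by
  have := neZero_restrict (F.sub p)
  have e : ∀ g, cutState β h lam x (S p) (t p) (J p) g (fun _ => 1) = 1 := fun g => by
    rw [cutState_eq_tmean]
    exact tmean_const (by simpa using F.integrable_boltzmann p g) 1
  simp only [cutTilt, e]
  exact F.levelGrowth.tilt_const 1 _ a (by omega) p g

lemma cutFamily_box (n : ℕ) : CutFamily β h lam x (P := Set.Icc (0 : ℝ) 1 × Couplings N)
    (fun _ => box n) (fun p => p.1) (fun p => p.2) 1 where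
  meas := fun _ => measurableSet_box n
  sub := fun _ => box_mono (Nat.zero_le n)
  ht := fun p => p.1.2
  hθ := one_pos
  up := fun η hη => by
    obtain ⟨C, hC, H⟩ := abs_expo_le_of_mem_box (N := N) β h lam x n hη
    set r : ℝ := N * (n + 1) ^ 2
    refine ⟨C + r ^ 2, by positivity, fun p g z hz => ?_⟩
    have hs := spinSq_nonneg z
    have hr : spinSq z ≤ r := by
      have : spinSq z ≤ ∑ i : Fin N, ((n : ℝ) + 1) ^ 2 := Finset.sum_le_sum fun i _ => by
        rw [← sq_abs]; exact pow_le_pow_left₀ (abs_nonneg _) (hz i) 2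
      simpa [r] using this
    have h2 : spinSq z ^ 2 ≤ r ^ 2 := pow_le_pow_left₀ hs hr 2
    have h1 := (abs_le.1 (H p.1 p.1.2 p.2 g z hz)).2
    have : 0 ≤ r ^ 2 * couplingSq p.2 := mul_nonneg (sq_nonneg _) (couplingSq_nonneg _)
    linarith

/-- Cut-off sets containing the unit cube. -/
abbrev CutSet (N : ℕ) := {S : Set (Spins N) // MeasurableSet S ∧ box 0 ⊆ S}

lemma cutFamily_pos (hβ : β ≠ 0) (hN : 1 ≤ N) {t₁ : ℝ} (ht₁ : 0 < t₁) :
    CutFamily β h lam x (P := CutSet N × Set.Icc t₁ 1 × Couplings N)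
      (fun p => p.1) (fun p => p.2.1) (fun p => p.2.2) (t₁ * (β ^ 2 / (16 * N))) where
  meas := fun p => p.1.2.1
  sub := fun p => p.1.2.2
  ht := fun p => ⟨ht₁.le.trans p.2.1.2.1, p.2.1.2.2⟩
  hθ := by
    have hN0 : (0 : ℝ) < N := by exact_mod_cast hN
    positivity
  up := fun η hη => by
    obtain ⟨C, hC, H⟩ := expo_add_le (N := N) β h lam x hβ hN ht₁ hη
    exact ⟨C, hC, fun p g z _ => H p.2.1 p.2.1.2 p.2.2 g z⟩

end Family

end GaussianSpinGlass
end

noncomputable section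

namespace GaussianSpinGlass

variable {N : ℕ}

/-! ### Removal of the cut-off -/

lemma integrable_couplingSq : Integrable (couplingSq : Couplings N → ℝ) (couplingMeasure N) := by
  unfold couplingSq
  refine integrable_finsetSum _ fun i _ => ?_
  have h1 : Integrable (fun v : Fin N → ℝ => ∑ j, v j ^ 2)
      (Measure.pi fun _ : Fin N => gaussianReal 0 1) := by
    have := integrable_sum_sq N 1
    simp only [one_mul] at this
    exact this
  exact integrable_comp_eval (μ := fun _ : Fin N => Measure.pi fun _ : Fin N => gaussianReal 0 1)
    (i := i) (f := fun v : Fin N → ℝ => ∑ j, v j ^ 2) h1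

lemma integrable_of_abs_le_couplingSq {f : Couplings N → ℝ} (hf : Measurable f) {C : ℝ}
    (h : ∀ J, |f J| ≤ C * (1 + couplingSq J)) : Integrable f (couplingMeasure N) :=
  (((integrable_const 1).add integrable_couplingSq).const_mul C).mono' hf.aestronglyMeasurable
    (ae_of_all _ h)

lemma fieldSq_zero (g : Fields N) : fieldSq 0 g = 0 := by simp [fieldSq]

lemma Growth.exists_bound {P : Type*} {M : P → ℝ} {f : P → Fields N → ℝ} (hf : Growth M 0 f) :
    ∃ C, 0 ≤ C ∧ ∀ p g, |f p g| ≤ C * (1 + M p) := by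
  obtain ⟨C, hC, h⟩ := hf.bound 1 one_pos
  exact ⟨C, hC, fun p g => by simpa [fieldSq_zero] using h p g⟩

section Model
variable {β h lam : ℝ} {x : OrderParameter} {t : ℝ} {J : Couplings N}

lemma cutLog_mono {S S' : Set (Spins N)} (hS : S ⊆ S') (H : WellPosed β h lam x S t J)
    (H' : WellPosed β h lam x S' t J)
    (hI : ∀ g, IntegrableOn (boltzmann β h lam x t J g) S' (spinMeasure N)) {a : ℕ}
    (ha : a ≤ x.K) : ∀ g, cutLog β h lam x S t J a g ≤ cutLog β h lam x S' t J a g := by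
  induction ha using Nat.decreasingInduction with
  | self =>
    intro g
    rw [cutLog_last, cutLog_last]
    exact Real.log_le_log (H.pos g) (setIntegral_mono_set (hI g)
      (ae_of_all _ fun z => Real.exp_nonneg _) (ae_of_all _ hS))
  | of_succ a ha ih =>
    intro g
    rw [cutLog_of_lt _ _ _ _ _ _ _ ha, cutLog_of_lt _ _ _ _ _ _ _ ha]
    exact lme_mono (x.m_nonneg (by omega)) (fun y => ih _) (H.int_log a ha g)
      (H'.int_log a ha g) (H.int_exp a ha g) (H'.int_exp a ha g)

lemma measurable_cutLog_update (S : Set (Spins N)) (t : ℝ) (J : Couplings N) (a b : ℕ)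
    (g : Fields N) : Measurable (fun y => cutLog β h lam x S t J a (Function.update g b y)) := by
  have := (measurable_cutLog β h lam x S a).comp
    ((measurable_prodMk_field t J).comp (measurable_updateField b g))
  exact this

lemma wellPosed_box (n : ℕ) (ht : t ∈ Set.Icc (0 : ℝ) 1) (J : Couplings N) :
    WellPosed β h lam x (box n) t J :=
  (cutFamily_box n).wellPosed (⟨t, ht⟩, J)

lemma integrableOn_boltzmann_box (n : ℕ) (ht : t ∈ Set.Icc (0 : ℝ) 1) (J : Couplings N)
    (g : Fields N) : IntegrableOn (boltzmann β h lam x t J g) (box n) (spinMeasure N) :=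
  (cutFamily_box (N := N) n).integrable_boltzmann (⟨t, ht⟩, J) g

lemma tendsto_cutLog (ht : t ∈ Set.Icc (0 : ℝ) 1) (H : WellPosed β h lam x Set.univ t J)
    (hI : ∀ g, Integrable (boltzmann β h lam x t J g) (spinMeasure N)) {a : ℕ} (ha : a ≤ x.K) :
    ∀ g, Tendsto (fun n => cutLog β h lam x (box n) t J a g) atTop
      (𝓝 (cutLog β h lam x Set.univ t J a g)) := by
  induction ha using Nat.decreasingInduction with
  | self =>
    intro g
    simp only [cutLog_last]
    refine Tendsto.log ?_ (H.pos g).ne'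
    have := tendsto_setIntegral_of_monotone (μ := spinMeasure N) (f := boltzmann β h lam x t J g)
      (s := box) (fun n => measurableSet_box n) box_mono (by
        rw [iUnion_box, integrableOn_univ]; exact hI g)
    rw [iUnion_box] at this
    exact this
  | of_succ a ha ih =>
    intro g
    simp only [cutLog_of_lt _ _ _ _ _ _ _ ha]
    have H0 := wellPosed_box (β := β) (h := h) (lam := lam) (x := x) 0 ht J
    refine tendsto_lme (x.m_nonneg (by omega)) (fun n => measurable_cutLog_update _ _ _ _ _ _)
      (H0.int_log a ha g) (H.int_log a ha g) (H.int_exp a ha g) (fun n y => ?_) (fun n y => ?_)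
      (fun y => ih _) (H.int_exp a ha g)
    · exact cutLog_mono (box_mono (Nat.zero_le n)) H0 (wellPosed_box n ht J)
        (integrableOn_boltzmann_box n ht J) (by omega) _
    · exact cutLog_mono (Set.subset_univ _) (wellPosed_box n ht J) H
        (fun g => by rw [integrableOn_univ]; exact hI g) (by omega) _

lemma tendsto_cutState (H : WellPosed β h lam x Set.univ t J) {O : Spins N → ℝ} (g : Fields N)
    (hI : Integrable (boltzmann β h lam x t J g) (spinMeasure N))
    (hO : Integrable (fun z => O z * boltzmann β h lam x t J g z) (spinMeasure N)) :
    Tendsto (fun n => cutState β h lam x (box n) t J g O) atTop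
      (𝓝 (cutState β h lam x Set.univ t J g O)) := by
  have key : ∀ f : Spins N → ℝ, Integrable f (spinMeasure N) →
      Tendsto (fun n => ∫ z in box n, f z ∂(spinMeasure N)) atTop
        (𝓝 (∫ z in Set.univ, f z ∂(spinMeasure N))) := by
    intro f hf
    have := tendsto_setIntegral_of_monotone (μ := spinMeasure N) (f := f)
      (s := box) (fun n => measurableSet_box n) box_mono (by
        rw [iUnion_box, integrableOn_univ]; exact hf)
    rwa [iUnion_box] at this
  exact (key _ hO).div (key _ hI) (H.pos g).ne'

/-! ### Two replicas -/

/-- Index set of the one-replica observables in the expansion of `(q₁₂ - q)²`. -/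
abbrev ReplicaIndex (N : ℕ) := (Fin N × Fin N) ⊕ Fin N ⊕ Unit

/-- The observables `z_i z_j`, `z_i` and `1`. -/
def replicaObs : ReplicaIndex N → Spins N → ℝ
  | .inl (i, j) => fun z => z i * z j
  | .inr (.inl i) => fun z => z i
  | .inr (.inr _) => fun _ => 1

/-- The coefficients of `(q₁₂ - q)² = ∑ c_k O_k(z₁) O_k(z₂)`. -/
def replicaCoeff (q : ℝ) : ReplicaIndex N → ℝ
  | .inl _ => (1 / (N : ℝ)) ^ 2
  | .inr (.inl _) => -(2 * q / N)
  | .inr (.inr _) => q ^ 2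

lemma sum_replicaCoeff_mul (q : ℝ) (F : ReplicaIndex N → ℝ) :
    ∑ k, replicaCoeff q k * F k = (1 / (N : ℝ)) ^ 2 * ∑ i, ∑ j, F (.inl (i, j))
      - 2 * q / N * ∑ i, F (.inr (.inl i)) + q ^ 2 * F (.inr (.inr ())) := by
  simp only [Fintype.sum_sum_type, replicaCoeff, Fintype.sum_prod_type, Finset.mul_sum,
    Finset.univ_unique, Finset.sum_singleton]
  simp only [neg_mul, Finset.sum_neg_distrib]
  rw [sub_eq_add_neg, add_assoc]

lemma sq_overlap_sub (q : ℝ) (z₁ z₂ : Spins N) :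
    (overlap z₁ z₂ - q) ^ 2 = ∑ k, replicaCoeff q k * (replicaObs k z₁ * replicaObs k z₂) := by
  rw [sum_replicaCoeff_mul]
  have e : ∑ i, ∑ j, z₁ i * z₁ j * (z₂ i * z₂ j) = (∑ i, z₁ i * z₂ i) ^ 2 := by
    rw [sq, Finset.sum_mul_sum]
    exact Finset.sum_congr rfl fun i _ => Finset.sum_congr rfl fun j _ => by ring
  simp only [replicaObs, e, overlap]
  ring

lemma measurable_replicaObs (k : ReplicaIndex N) : Measurable (replicaObs k) := by
  rcases k with ⟨i, j⟩ | i | _ <;> unfold replicaObs <;> fun_prop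

lemma polyBdd_sq_replicaObs (k : ReplicaIndex N) : PolyBdd (fun z => replicaObs k z ^ 2) := by
  rcases k with ⟨i, j⟩ | i | _
  · exact polyBdd_sq_mul_sq i j
  · exact polyBdd_sq i
  · simpa [replicaObs] using polyBdd_one

lemma polyBdd_replicaObs (k : ReplicaIndex N) : PolyBdd (replicaObs k) :=
  (polyBdd_sq_replicaObs k).of_sq (measurable_replicaObs k)

variable (β h lam x) in
/-- `Ω̃_a((q₁₂ - q_a)²)` with the spins restricted to `S`. -/
def replicaSq (S : Set (Spins N)) (t : ℝ) (J : Couplings N) (a : ℕ) (g : Fields N) : ℝ :=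
  ∑ k, replicaCoeff (x.q a) k * cutTilt β h lam x S t J a g (replicaObs k) ^ 2

variable (β h lam x) in
/-- `E_1 ⋯ E_K (f_1 ⋯ f_a Ω̃_a((q₁₂ - q_a)²))` with the spins restricted to `S`. -/
def cutFluct (S : Set (Spins N)) (t : ℝ) (J : Couplings N) (a : ℕ) : ℝ :=
  tiltLevels x.m (cutLog β h lam x S t J) (replicaSq β h lam x S t J a) 0 a 0

lemma measurable_replicaSq (S : Set (Spins N)) (a : ℕ) :
    Measurable (fun q : (ℝ × Couplings N) × Fields N =>
      replicaSq β h lam x S q.1.1 q.1.2 a q.2) := by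
  unfold replicaSq
  exact Finset.measurable_fun_sum _ fun k _ =>
    ((measurable_cutTilt β h lam x S (measurable_replicaObs k) a).pow_const 2).const_mul _

lemma measurable_cutFluct (S : Set (Spins N)) (a : ℕ) :
    Measurable (fun q : ℝ × Couplings N => cutFluct β h lam x S q.1 q.2 a) := by
  have := measurable_tilt_cutLog β h lam x S
    (X := fun q => replicaSq β h lam x S q.1.1 q.1.2 a q.2) (measurable_replicaSq S a) 0 a
  have e : Measurable (fun q : ℝ × Couplings N => ((q, 0) : (ℝ × Couplings N) × Fields N)) := by
    fun_prop
  have h' := this.comp e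
  simp only [Function.comp_def] at h'
  unfold cutFluct
  exact h'

lemma indepAbove_replicaSq (S : Set (Spins N)) {a : ℕ} (ha : a ≤ x.K) :
    IndepAbove a (replicaSq β h lam x S t J a) := by
  intro c hc g y
  unfold replicaSq
  refine Finset.sum_congr rfl fun k _ => ?_
  have := indepAbove_cutTilt β h lam x S t J ha (replicaObs k) c hc g y
  beta_reduce at this
  rw [this]

section Family
variable {P : Type*} {S : P → Set (Spins N)} {τ : P → ℝ} {𝒥 : P → Couplings N} {θ : ℝ}

lemma CutFamily.replicaSq_eq (F : CutFamily β h lam x S τ 𝒥 θ) (p : P) {a : ℕ} (ha : a ≤ x.K)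
    (g : Fields N) :
    cutTilt β h lam x (S p) (τ p) (𝒥 p) a g (fun z₁ => cutTilt β h lam x (S p) (τ p) (𝒥 p) a g
      (fun z₂ => (overlap z₁ z₂ - x.q a) ^ 2)) = replicaSq β h lam x (S p) (τ p) (𝒥 p) a g := by
  have h1 : ∀ z₁ : Spins N, cutTilt β h lam x (S p) (τ p) (𝒥 p) a g
      (fun z₂ => (overlap z₁ z₂ - x.q a) ^ 2) = ∑ k, (replicaCoeff (x.q a) k *
        cutTilt β h lam x (S p) (τ p) (𝒥 p) a g (replicaObs k)) * replicaObs k z₁ := by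
    intro z₁
    have e : (fun z₂ => (overlap z₁ z₂ - x.q a) ^ 2) = fun z₂ =>
        ∑ k, (replicaCoeff (x.q a) k * replicaObs k z₁) * replicaObs k z₂ := by
      ext z₂
      rw [sq_overlap_sub]
      exact Finset.sum_congr rfl fun k _ => by ring
    rw [e, F.cutTilt_sum Finset.univ _ (fun k => polyBdd_replicaObs k) p ha]
    exact Finset.sum_congr rfl fun k _ => by ring
  simp only [h1]
  rw [F.cutTilt_sum Finset.univ _ (fun k => polyBdd_replicaObs k) p ha, replicaSq]
  exact Finset.sum_congr rfl fun k _ => by ring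

lemma cutTilt_nonneg (S : Set (Spins N)) (t : ℝ) (J : Couplings N) (a : ℕ) (g : Fields N)
    {O : Spins N → ℝ} (hO : ∀ z, 0 ≤ O z) : 0 ≤ cutTilt β h lam x S t J a g O := by
  refine tiltLevels_nonneg _ _ (fun g => ?_) _ _ _
  rw [cutState_eq_tmean]
  exact tmean_nonneg hO

lemma CutFamily.replicaSq_nonneg (F : CutFamily β h lam x S τ 𝒥 θ) (p : P) {a : ℕ} (ha : a ≤ x.K)
    (g : Fields N) : 0 ≤ replicaSq β h lam x (S p) (τ p) (𝒥 p) a g := by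
  rw [← F.replicaSq_eq p ha]
  exact cutTilt_nonneg _ _ _ _ _ fun z₁ => cutTilt_nonneg _ _ _ _ _ fun z₂ => sq_nonneg _

lemma CutFamily.cutFluct_nonneg (F : CutFamily β h lam x S τ 𝒥 θ) (p : P) {a : ℕ} (ha : a ≤ x.K) :
    0 ≤ cutFluct β h lam x (S p) (τ p) (𝒥 p) a :=
  tiltLevels_nonneg _ _ (F.replicaSq_nonneg p ha) _ _ _

lemma CutFamily.growth_sq_cutTilt (F : CutFamily β h lam x S τ 𝒥 θ) {O : Spins N → ℝ}
    (hO : Measurable O) (hO2 : PolyBdd (fun z => O z ^ 2)) {a : ℕ} (ha : a ≤ x.K) :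
    Growth (fun p => couplingSq (𝒥 p)) a
      (fun p g => cutTilt β h lam x (S p) (τ p) (𝒥 p) a g O ^ 2) := by
  have h1 := F.growth_tilt (PolyBdd.of_sq hO hO2) ha
  refine (F.growth_tilt hO2 ha).of_abs_le (fun p => (h1.meas p).pow_const 2) fun p g => ?_
  rw [abs_of_nonneg (sq_nonneg _)]
  exact (F.sq_cutTilt_le hO hO2 p ha g).trans (le_abs_self _)

lemma CutFamily.growth_replicaSq (F : CutFamily β h lam x S τ 𝒥 θ) {a : ℕ} (ha : a ≤ x.K) :
    Growth (fun p => couplingSq (𝒥 p)) a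
      (fun p => replicaSq β h lam x (S p) (τ p) (𝒥 p) a) :=
  Growth.sum (fun _ => couplingSq_nonneg _) Finset.univ fun k _ =>
    (F.growth_sq_cutTilt (measurable_replicaObs k) (polyBdd_sq_replicaObs k) ha).const_mul _

lemma CutFamily.cutFluct_le (F : CutFamily β h lam x S τ 𝒥 θ) {a : ℕ} (ha : a ≤ x.K) :
    ∃ C, 0 ≤ C ∧ ∀ p, |cutFluct β h lam x (S p) (τ p) (𝒥 p) a| ≤ C * (1 + couplingSq (𝒥 p)) := by
  have hg := F.growth_replicaSq ha
  have := F.levelGrowth.tilt (X := fun p => replicaSq β h lam x (S p) (τ p) (𝒥 p) a) a 0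
    (by omega) (by rwa [zero_add])
  obtain ⟨C, hC, h⟩ := this.exists_bound
  exact ⟨C, hC, fun p => h p 0⟩

lemma CutFamily.cutLog_le (F : CutFamily β h lam x S τ 𝒥 θ) :
    ∃ C, 0 ≤ C ∧ ∀ p, |cutLog β h lam x (S p) (τ p) (𝒥 p) 0 0| ≤ C * (1 + couplingSq (𝒥 p)) := by
  obtain ⟨C, hC, h⟩ := (F.levelGrowth.growth 0 (Nat.zero_le _)).exists_bound
  exact ⟨C, hC, fun p => h p 0⟩

lemma CutFamily.tendsto_cutFluct (F : CutFamily β h lam x S τ 𝒥 θ) {p : ℕ → P} {p' : P} {B : ℝ}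
    (hB : ∀ n, couplingSq (𝒥 (p n)) ≤ B)
    (hv : ∀ a ≤ x.K, ∀ g, Tendsto (fun n => cutLog β h lam x (S (p n)) (τ (p n)) (𝒥 (p n)) a g)
      atTop (𝓝 (cutLog β h lam x (S p') (τ p') (𝒥 p') a g)))
    (hs : ∀ k g, Tendsto
      (fun n => cutState β h lam x (S (p n)) (τ (p n)) (𝒥 (p n)) g (replicaObs k))
      atTop (𝓝 (cutState β h lam x (S p') (τ p') (𝒥 p') g (replicaObs k)))) {a : ℕ}
    (ha : a ≤ x.K) :
    Tendsto (fun n => cutFluct β h lam x (S (p n)) (τ (p n)) (𝒥 (p n)) a) atTop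
      (𝓝 (cutFluct β h lam x (S p') (τ p') (𝒥 p') a)) := by
  have hO : ∀ k : ReplicaIndex N, ∀ g, Tendsto
      (fun n => cutTilt β h lam x (S (p n)) (τ (p n)) (𝒥 (p n)) a g (replicaObs k)) atTop
      (𝓝 (cutTilt β h lam x (S p') (τ p') (𝒥 p') a g (replicaObs k))) := fun k =>
    F.levelGrowth.tendsto_tilt hB hv
      (X := fun p g => cutState β h lam x (S p) (τ p) (𝒥 p) g (replicaObs k)) (x.K - a) a
      (by omega) (by rw [Nat.add_sub_cancel' ha]; exact F.growth_state (polyBdd_replicaObs k))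
      (hs k)
  exact F.levelGrowth.tendsto_tilt hB hv (X := fun p => replicaSq β h lam x (S p) (τ p) (𝒥 p) a)
    a 0 (by omega) (by rw [zero_add]; exact F.growth_replicaSq ha)
    (fun g => tendsto_finsetSum _ fun k _ => ((hO k g).pow 2).const_mul _) 0

end Family

/-- The whole space as a cut-off set. -/
def cutUniv : CutSet N := ⟨Set.univ, MeasurableSet.univ, Set.subset_univ _⟩

/-- The cubes as cut-off sets. -/
def cutBox (n : ℕ) : CutSet N := ⟨box n, measurableSet_box n, box_mono (Nat.zero_le n)⟩

lemma integrable_mul_boltzmann (hβ : β ≠ 0) (hN : 1 ≤ N) (ht : t ∈ Set.Ioc (0 : ℝ) 1)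
    (J : Couplings N) (g : Fields N) {O : Spins N → ℝ} (hO : PolyBdd O) :
    Integrable (fun z => O z * boltzmann β h lam x t J g z) (spinMeasure N) := by
  have := (cutFamily_pos (N := N) (h := h) (lam := lam) (x := x) hβ hN ht.1).integrable
    (cutUniv, ⟨t, le_rfl, ht.2⟩, J) g hO
  simp only [cutUniv, Measure.restrict_univ] at this
  simpa only [boltzmann_eq, mul_comm] using this

lemma integrable_boltzmann (hβ : β ≠ 0) (hN : 1 ≤ N) (ht : t ∈ Set.Ioc (0 : ℝ) 1)
    (J : Couplings N) (g : Fields N) :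
    Integrable (boltzmann β h lam x t J g) (spinMeasure N) := by
  simpa only [one_mul] using integrable_mul_boltzmann (h := h) (lam := lam) (x := x) hβ hN ht J g
    polyBdd_one

lemma wellPosed_univ (hβ : β ≠ 0) (hN : 1 ≤ N) (ht : t ∈ Set.Ioc (0 : ℝ) 1)
    (J : Couplings N) : WellPosed β h lam x Set.univ t J :=
  (cutFamily_pos (N := N) (h := h) (lam := lam) (x := x) hβ hN ht.1).wellPosed
    (cutUniv, ⟨t, le_rfl, ht.2⟩, J)

lemma tendsto_cutFluct (hβ : β ≠ 0) (hN : 1 ≤ N) (ht : t ∈ Set.Ioc (0 : ℝ) 1) (J : Couplings N)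
    {a : ℕ} (ha : a ≤ x.K) :
    Tendsto (fun n => cutFluct β h lam x (box n) t J a) atTop
      (𝓝 (cutFluct β h lam x Set.univ t J a)) := by
  have F := cutFamily_pos (N := N) (h := h) (lam := lam) (x := x) hβ hN ht.1
  have H := wellPosed_univ (h := h) (lam := lam) (x := x) hβ hN ht J
  have hI := integrable_boltzmann (h := h) (lam := lam) (x := x) hβ hN ht J
  exact F.tendsto_cutFluct (p := fun n => (cutBox n, ⟨t, le_rfl, ht.2⟩, J))
    (p' := (cutUniv, ⟨t, le_rfl, ht.2⟩, J)) (fun _ => le_refl (couplingSq J))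
    (fun b hb => tendsto_cutLog ⟨ht.1.le, ht.2⟩ H hI hb)
    (fun k g => tendsto_cutState H g (hI g)
      (integrable_mul_boltzmann hβ hN ht J g (polyBdd_replicaObs k))) ha

lemma fluctuation_eq (hβ : β ≠ 0) (hN : 1 ≤ N) (ht : t ∈ Set.Ioc (0 : ℝ) 1) {a : ℕ}
    (ha : a ≤ x.K) : fluctuation β h lam x N a t =
      ∫ J, cutFluct β h lam x Set.univ t J a ∂(couplingMeasure N) := by
  have F := cutFamily_pos (N := N) (h := h) (lam := lam) (x := x) hβ hN ht.1
  let T : Set.Icc t 1 := ⟨t, le_rfl, ht.2⟩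
  unfold fluctuation bracket
  congr 1
  ext J
  have H := wellPosed_univ (h := h) (lam := lam) (x := x) hβ hN ht J
  have e : ∀ g, replicaState β h lam x t J a g (fun z₁ z₂ => (overlap z₁ z₂ - x.q a) ^ 2) =
      replicaSq β h lam x Set.univ t J a g := fun g => by
    simp only [replicaState, H.levelState_eq ha]
    exact F.replicaSq_eq (cutUniv, T, J) ha g
  simp only [e]
  exact H.bracket_inner_eq ha (indepAbove_replicaSq _ ha) 0

end Model

end GaussianSpinGlass
end

noncomputable section

namespace GaussianSpinGlass

variable {N : ℕ}

/-! ### The time derivative of the cut-off model -/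

section General
variable {ι : Type*} [Fintype ι] [DecidableEq ι]

lemma Jet.Regular.hasDerivAt_time {j : Jet ι} (hj : j.Regular) {t : ℝ}
    (ht : t ∈ Set.Ioo (0 : ℝ) 1) (x : ι → ℝ) : HasDerivAt (fun s => j.U s x) (j.Ut t x) t := by
  have h2 : HasDerivAt (fun s : ℝ => (s, x)) (1, 0) t :=
    (hasDerivAt_id t).prodMk (hasDerivAt_const _ x)
  have h3 := (hj.hasFDeriv t ht x).comp_hasDerivAt t h2
  refine h3.congr_deriv ?_
  simp [spaceTimeForm_apply]

lemma Jet.Regular.continuousOn_time {j : Jet ι} (hj : j.Regular) (x : ι → ℝ) :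
    ContinuousOn (fun s => j.U s x) (Set.Icc 0 1) :=
  hj.cont.comp (f := fun s : ℝ => (s, x)) (by fun_prop) fun _ hs => ⟨hs, trivial⟩

lemma exists_boundedModel {Z : Type*} [TopologicalSpace Z] [MeasurableSpace Z] [OpensMeasurableSpace Z]
    {ν : Measure Z} {S : Set Z} (hS : IsCompact S) (hm : MeasurableSet S) {w : ι → Z → ℝ}
    {a b : Z → ℝ} (hw : ∀ i, Continuous (w i)) (ha : Continuous a) (hb : Continuous b) :
    ∃ R, BoundedModel (ν.restrict S) w a b R := by
  choose Cw hCw using fun i => hS.exists_bound_of_continuousOn (hw i).continuousOn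
  obtain ⟨Ca, hCa⟩ := hS.exists_bound_of_continuousOn ha.continuousOn
  obtain ⟨Cb, hCb⟩ := hS.exists_bound_of_continuousOn hb.continuousOn
  have h1 : ∀ i, |Cw i| ≤ ∑ i, |Cw i| := fun i =>
    Finset.single_le_sum (f := fun i => |Cw i|) (fun _ _ => abs_nonneg _) (Finset.mem_univ i)
  have h2 : 0 ≤ ∑ i, |Cw i| := Finset.sum_nonneg fun _ _ => abs_nonneg _
  refine ⟨∑ i, |Cw i| + |Ca| + |Cb|, fun i => (hw i).measurable, ha.measurable, hb.measurable,
    by positivity, ?_, ?_, ?_⟩ <;> refine ae_restrict_of_forall_mem hm fun z hz => ?_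
  · intro i
    refine ((hCw i z hz).trans (le_abs_self _)).trans ?_
    linarith [h1 i, abs_nonneg Ca, abs_nonneg Cb]
  · refine ((hCa z hz).trans (le_abs_self _)).trans ?_
    linarith [abs_nonneg Cb]
  · refine ((hCb z hz).trans (le_abs_self _)).trans ?_
    linarith [abs_nonneg Ca]

lemma integral_gaussPi_comp {κ : Type*} [Fintype κ] {f : κ → ι} (hf : Function.Injective f)
    {F : (κ → ℝ) → ℝ} (hF : Measurable F) :
    ∫ ξ, F (fun k => ξ (f k)) ∂(gaussPi ι) = ∫ y, F y ∂(gaussPi κ) := by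
  have h := measurePreserving_comp_injective hf
  rw [← h.map_eq, integral_map h.measurable.aemeasurable hF.aestronglyMeasurable]

end General

lemma isCompact_box (n : ℕ) : IsCompact (box n : Set (Spins N)) := by
  have e : (box n : Set (Spins N)) = Set.univ.pi fun _ => Set.Icc (-((n : ℝ) + 1)) (n + 1) := by
    ext z; simp [box, abs_le, Pi.le_def, forall_and]
  rw [e]
  exact isCompact_univ_pi fun _ => isCompact_Icc

lemma measurePreserving_curry (κ κ' : Type*) [Fintype κ] [Fintype κ'] :
    MeasurePreserving (fun ξ : κ × κ' → ℝ => fun i j => ξ (i, j)) (gaussPi (κ × κ'))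
      (Measure.pi fun _ : κ => gaussPi κ') := by
  refine ⟨by fun_prop, ?_⟩
  have := Measure.infinitePi_map_curry (ι := κ) (κ := κ') (fun _ _ => gaussianReal 0 1)
  simp only [Measure.infinitePi_eq_pi] at this
  exact this

/-- Index set of the couplings and of the total site field. -/
abbrev NoiseIndex (N : ℕ) := (Fin N × Fin N) ⊕ Fin N

lemma integral_gaussPi_inr {F : Spins N → ℝ} (hF : Measurable F) :
    ∫ ξ : NoiseIndex N → ℝ, F (fun i => ξ (.inr i)) ∂(gaussPi (NoiseIndex N)) =
      ∫ y, F y ∂(spinMeasure N) :=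
  integral_gaussPi_comp Sum.inr_injective hF

lemma integral_gaussPi_inl {F : Couplings N → ℝ} (hF : Measurable F) :
    ∫ ξ : NoiseIndex N → ℝ, F (fun i j => ξ (.inl (i, j))) ∂(gaussPi (NoiseIndex N)) =
      ∫ J, F J ∂(couplingMeasure N) := by
  have h := measurePreserving_curry (Fin N) (Fin N)
  have e := integral_gaussPi_comp (ι := NoiseIndex N) (f := Sum.inl) Sum.inl_injective
    (F := fun ξ : Fin N × Fin N → ℝ => F fun i j => ξ (i, j)) (hF.comp h.measurable)
  rw [e, couplingMeasure, ← h.map_eq, integral_map h.measurable.aemeasurable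
    hF.aestronglyMeasurable]

section Model
variable (β h lam : ℝ) (x : OrderParameter)

/-- The observables coupled to the noises. -/
def noiseObs : NoiseIndex N → Spins N → ℝ
  | .inl (i, j) => fun z => β / Real.sqrt (2 * N) * (z i * z j)
  | .inr i => fun z => β * z i

/-- The coefficients of the heat operator solved by the model at overlap `q`. -/
def heatCoeff (q : ℝ) : NoiseIndex N → ℝ
  | .inl _ => 1
  | .inr _ => -q

/-- The variance profile of a site noise. -/
def siteVar (v : ℝ) : NoiseIndex N → ℝ
  | .inl _ => 0
  | .inr _ => v

/-- The variance profile of the couplings. -/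
def couplingVar : NoiseIndex N → ℝ
  | .inl _ => 1
  | .inr _ => 0

/-- The part of the exponent which depends neither on time nor on the noise. -/
def baseEnergy (z : Spins N) : ℝ :=
  -(β ^ 2 * x.Q) / 2 * spinSq z + β * h * ∑ i, z i + lam / 2 * spinSq z

/-- The coefficient of `t` in the exponent. -/
def driftEnergy (z : Spins N) : ℝ :=
  -(1 / 2) * ∑ k, heatCoeff x.Q k * noiseObs β k z ^ 2

/-- The free energy jet of the cut-off model. -/
def topJet (n : ℕ) : Jet (NoiseIndex N) :=
  freeEnergyJet ((spinMeasure N).restrict (box n)) (noiseObs β) (baseEnergy β h lam x)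
    (driftEnergy β x)

/-- Auxiliary recursion for `levelJet`. -/
def levelJetAux (n : ℕ) : ℕ → ℕ → Jet (NoiseIndex N)
  | _, 0 => topJet β h lam x n
  | a, k + 1 => (levelJetAux n (a + 1) k).step (x.m (a + 1)) (siteVar (x.q (a + 1) - x.q a))
      (siteVar (-(x.q (a + 1) - x.q a)))

/-- The jet of `log Z_a` in the cut-off model. -/
def levelJet (n a : ℕ) : Jet (NoiseIndex N) := levelJetAux β h lam x n a (x.K - a)

/-- The accumulated noise at level `a`. -/
def noisePoint (t : ℝ) (J : Couplings N) (g : Fields N) (a : ℕ) : NoiseIndex N → ℝ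
  | .inl (i, j) => Real.sqrt t * J i j
  | .inr i => Real.sqrt (1 - t) *
      ∑ b ∈ Finset.range a, Real.sqrt (x.q (b + 1) - x.q b) * g (b + 1) i

lemma levelJet_last (n : ℕ) : levelJet (N := N) β h lam x n x.K = topJet β h lam x n := by
  simp [levelJet, levelJetAux]

lemma levelJet_of_lt (n : ℕ) {a : ℕ} (ha : a < x.K) : levelJet (N := N) β h lam x n a =
    (levelJet β h lam x n (a + 1)).step (x.m (a + 1)) (siteVar (x.q (a + 1) - x.q a))
      (siteVar (-(x.q (a + 1) - x.q a))) := by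
  simp only [levelJet]
  rw [show x.K - a = (x.K - (a + 1)) + 1 by omega]
  rfl

lemma continuous_noiseObs (k : NoiseIndex N) : Continuous (noiseObs β k) := by
  rcases k with ⟨i, j⟩ | i <;> unfold noiseObs <;> fun_prop

lemma continuous_baseEnergy : Continuous (baseEnergy (N := N) β h lam x) := by
  unfold baseEnergy spinSq; fun_prop

lemma continuous_driftEnergy : Continuous (driftEnergy (N := N) β x) := by
  have := continuous_noiseObs (N := N) β
  unfold driftEnergy; fun_prop

lemma exists_boundedModel_box (n : ℕ) : ∃ R, BoundedModel ((spinMeasure N).restrict (box n))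
    (noiseObs β) (baseEnergy β h lam x) (driftEnergy β x) R :=
  exists_boundedModel (isCompact_box n) (measurableSet_box n) (continuous_noiseObs β)
    (continuous_baseEnergy β h lam x) (continuous_driftEnergy β x)

instance neZero_restrict_box (n : ℕ) : NeZero ((spinMeasure N).restrict (box n)) :=
  neZero_restrict (box_mono (Nat.zero_le n))

lemma noiseProfile_siteVar {v : ℝ} (hv : 0 ≤ v) :
    NoiseProfile (siteVar v : NoiseIndex N → ℝ) (siteVar (-v)) := by
  refine ⟨fun k => ?_, fun k => ?_⟩ <;> rcases k with k | k <;> simp [siteVar, hv]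

lemma levelJet_regular (n : ℕ) {a : ℕ} (ha : a ≤ x.K) :
    (levelJet (N := N) β h lam x n a).Regular ∧ ∃ C, (levelJet (N := N) β h lam x n a).LinBound C := by
  induction ha using Nat.decreasingInduction with
  | self =>
    rw [levelJet_last]
    obtain ⟨R, hR⟩ := exists_boundedModel_box (N := N) β h lam x n
    exact ⟨hR.freeEnergy_regular, hR.freeEnergy_linBound⟩
  | of_succ a ha ih =>
    obtain ⟨h1, C, h2⟩ := ih
    rw [levelJet_of_lt β h lam x n ha]
    exact ⟨h1.step h2 _ (noiseProfile_siteVar (sub_nonneg.2 (x.q_mono a ha))),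
      h2.step h1 (x.m_nonneg (by omega)) _ _⟩

lemma driftEnergy_eq (z : Spins N) :
    driftEnergy β x z = -(β ^ 2 / (4 * N)) * spinSq z ^ 2 + β ^ 2 * x.Q / 2 * spinSq z := by
  have e : spinSq z ^ 2 = ∑ i, ∑ j, (z i * z j) ^ 2 := by
    rw [spinSq, sq, Finset.sum_mul_sum]
    exact Finset.sum_congr rfl fun i _ => Finset.sum_congr rfl fun j _ => by ring
  simp only [driftEnergy, Fintype.sum_sum_type, Fintype.sum_prod_type, heatCoeff, noiseObs, mul_pow,
    div_pow, Real.sq_sqrt (by positivity : (0 : ℝ) ≤ 2 * N), one_mul]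
  rw [e]
  simp only [mul_pow, ← Finset.mul_sum, spinSq]
  ring

lemma energy_noisePoint {t : ℝ} (ht : t ∈ Set.Icc (0 : ℝ) 1) (J : Couplings N) (g : Fields N)
    (z : Spins N) :
    energy (noiseObs β) (baseEnergy β h lam x) (driftEnergy β x) t (noisePoint x t J g x.K) z =
      expo β h lam x t J g z := by
  have e1 : Real.sqrt (t / (2 * N)) = Real.sqrt t / Real.sqrt (2 * N) := Real.sqrt_div ht.1 _
  have e2 : ∑ i, ∑ j, Real.sqrt t * J i j * (β / Real.sqrt (2 * N) * (z i * z j)) =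
      β * Real.sqrt (t / (2 * N)) * ∑ i, ∑ j, J i j * z i * z j := by
    rw [e1, Finset.mul_sum]
    refine Finset.sum_congr rfl fun i _ => ?_
    rw [Finset.mul_sum]
    exact Finset.sum_congr rfl fun j _ => by ring
  have e3 : ∑ i, (Real.sqrt (1 - t) * ∑ b ∈ Finset.range x.K,
      Real.sqrt (x.q (b + 1) - x.q b) * g (b + 1) i) * (β * z i) = β * Real.sqrt (1 - t) *
        ∑ a ∈ Finset.range x.K, Real.sqrt (x.q (a + 1) - x.q a) * ∑ i, g (a + 1) i * z i := by
    simp only [Finset.mul_sum, Finset.sum_mul]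
    rw [Finset.sum_comm]
    exact Finset.sum_congr rfl fun b _ => Finset.sum_congr rfl fun i _ => by ring
  rw [energy, driftEnergy_eq]
  simp only [Fintype.sum_sum_type, Fintype.sum_prod_type, noisePoint, noiseObs, baseEnergy]
  rw [e2, e3]
  simp only [expo, spinSq]
  ring

end Model

end GaussianSpinGlass
end

noncomputable section

namespace GaussianSpinGlass

variable {N : ℕ}

lemma lme_gaussPi_inr (m : ℝ) {F : Spins N → ℝ} (hF : Measurable F) :
    lme (gaussPi (NoiseIndex N)) m (fun ξ => F (fun i => ξ (.inr i))) =
      lme (spinMeasure N) m F := by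
  by_cases hm : m = 0
  · subst hm
    rw [lme_zero, lme_zero, integral_gaussPi_inr hF]
  · rw [lme_of_ne hm, lme_of_ne hm,
      integral_gaussPi_inr (F := fun y => Real.exp (m * F y)) (hF.const_mul m).exp]

lemma tmean_gaussPi_inr (m : ℝ) {F X : Spins N → ℝ} (hF : Measurable F) (hX : Measurable X) :
    tmean (gaussPi (NoiseIndex N)) m (fun ξ => F (fun i => ξ (.inr i)))
      (fun ξ => X (fun i => ξ (.inr i))) = tmean (spinMeasure N) m F X := by
  rw [tmean, tmean, integral_gaussPi_inr (F := fun y => Real.exp (m * F y)) (hF.const_mul m).exp,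
    integral_gaussPi_inr (F := fun y => Real.exp (m * F y) * X y) ((hF.const_mul m).exp.mul hX)]

section Model
variable (β h lam : ℝ) (x : OrderParameter)

lemma cutTilt_last (S : Set (Spins N)) (t : ℝ) (J : Couplings N) (g : Fields N)
    (O : Spins N → ℝ) :
    cutTilt β h lam x S t J x.K g O = cutState β h lam x S t J g O := by
  simp [cutTilt, tiltLevels]

lemma cutTilt_of_lt (S : Set (Spins N)) (t : ℝ) (J : Couplings N) {a : ℕ} (ha : a < x.K)
    (g : Fields N) (O : Spins N → ℝ) :
    cutTilt β h lam x S t J a g O = tmean (spinMeasure N) (x.m (a + 1))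
      (fun y => cutLog β h lam x S t J (a + 1) (Function.update g (a + 1) y))
      (fun y => cutTilt β h lam x S t J (a + 1) (Function.update g (a + 1) y) O) := by
  simp only [cutTilt]
  rw [show x.K - a = (x.K - (a + 1)) + 1 by omega]
  rfl

lemma measurable_cutTilt_update (S : Set (Spins N)) (t : ℝ) (J : Couplings N) (a b : ℕ)
    (g : Fields N) {O : Spins N → ℝ} (hO : Measurable O) :
    Measurable (fun y => cutTilt β h lam x S t J a (Function.update g b y) O) := by
  have := (measurable_cutTilt β h lam x S hO a).comp
    ((measurable_prodMk_field t J).comp (measurable_updateField b g))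
  exact this

lemma shift_noisePoint (t : ℝ) (J : Couplings N) (g : Fields N)
    {a : ℕ} (ha : a < x.K) (ξ : NoiseIndex N → ℝ) :
    shift (siteVar (x.q (a + 1) - x.q a)) (siteVar (-(x.q (a + 1) - x.q a))) t
      (noisePoint x t J g a) ξ =
      noisePoint x t J (Function.update g (a + 1) fun i => ξ (.inr i)) (a + 1) := by
  have hq : 0 ≤ x.q (a + 1) - x.q a := sub_nonneg.2 (x.q_mono a ha)
  ext k
  rcases k with ⟨i, j⟩ | i
  · simp [shift, siteVar, noisePoint]
  · have e : ∑ b ∈ Finset.range a, Real.sqrt (x.q (b + 1) - x.q b) *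
        Function.update g (a + 1) (fun i => ξ (.inr i)) (b + 1) i =
        ∑ b ∈ Finset.range a, Real.sqrt (x.q (b + 1) - x.q b) * g (b + 1) i := by
      refine Finset.sum_congr rfl fun b hb => ?_
      rw [Function.update_of_ne]
      have := Finset.mem_range.1 hb
      omega
    simp only [shift, siteVar, noisePoint]
    rw [Finset.sum_range_succ, e, Function.update_self,
      show x.q (a + 1) - x.q a + -(x.q (a + 1) - x.q a) * t =
        (x.q (a + 1) - x.q a) * (1 - t) by ring, Real.sqrt_mul hq]
    ring

lemma shift_couplingVar (t : ℝ) (ξ : NoiseIndex N → ℝ) :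
    shift 0 couplingVar t 0 ξ = noisePoint x t (fun i j => ξ (.inl (i, j))) 0 0 := by
  ext k
  rcases k with ⟨i, j⟩ | i <;> simp [shift, couplingVar, noisePoint]

lemma levelJet_U (n : ℕ) {t : ℝ} (ht : t ∈ Set.Icc (0 : ℝ) 1) (J : Couplings N) {a : ℕ}
    (ha : a ≤ x.K) : ∀ g : Fields N, (levelJet β h lam x n a).U t (noisePoint x t J g a) =
      cutLog β h lam x (box n) t J a g := by
  induction ha using Nat.decreasingInduction with
  | self =>
    intro g
    rw [levelJet_last, cutLog_last]
    simp only [topJet, freeEnergyJet, Jet.logJet, partitionJet, energy_noisePoint β h lam x ht,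
      cutZ, boltzmann_eq]
    simp
  | of_succ a ha ih =>
    intro g
    rw [levelJet_of_lt β h lam x n ha, cutLog_of_lt β h lam x _ t J ha]
    simp only [Jet.step, shift_noisePoint x t J g ha, ih]
    exact lme_gaussPi_inr _ (measurable_cutLog_update _ _ _ _ _ _)

lemma levelJet_Ui (n : ℕ) {t : ℝ} (ht : t ∈ Set.Icc (0 : ℝ) 1) (J : Couplings N)
    (k : NoiseIndex N) {a : ℕ}
    (ha : a ≤ x.K) : ∀ g : Fields N, (levelJet β h lam x n a).Ui k t (noisePoint x t J g a) =
      cutTilt β h lam x (box n) t J a g (noiseObs β k) := by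
  induction ha using Nat.decreasingInduction with
  | self =>
    intro g
    rw [levelJet_last, cutTilt_last, cutState_eq_tmean]
    simp only [topJet, freeEnergyJet, Jet.logJet, partitionJet, energy_noisePoint β h lam x ht,
      tmean]
    simp
  | of_succ a ha ih =>
    intro g
    rw [levelJet_of_lt β h lam x n ha, cutTilt_of_lt β h lam x _ t J ha]
    simp only [Jet.step, Jet.tilt, shift_noisePoint x t J g ha, ih,
      levelJet_U β h lam x n ht J (Nat.succ_le_of_lt ha)]
    exact tmean_gaussPi_inr _ (measurable_cutLog_update _ _ _ _ _ _)
      (measurable_cutTilt_update _ _ _ _ _ _ _ _ _ _ (continuous_noiseObs β k).measurable)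

/-- The quadratic form in the first derivatives that drives the evolution of level `a`. -/
def gradForm (S : Set (Spins N)) (t : ℝ) (J : Couplings N) (a : ℕ) (g : Fields N) : ℝ :=
  ∑ k, heatCoeff (x.q a) k * cutTilt β h lam x S t J a g (noiseObs β k) ^ 2

lemma cutTilt_const_mul (S : Set (Spins N)) (t : ℝ) (J : Couplings N) (a : ℕ) (g : Fields N)
    (c : ℝ) (O : Spins N → ℝ) :
    cutTilt β h lam x S t J a g (fun z => c * O z) = c * cutTilt β h lam x S t J a g O := by
  have e : ∀ g, cutState β h lam x S t J g (fun z => c * O z) =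
      c * cutState β h lam x S t J g O := fun g => by
    rw [cutState_eq_tmean, cutState_eq_tmean, tmean_const_mul]
  simp only [cutTilt, e, tiltLevels_const_mul]

variable {β h lam x}

lemma CutFamily.gradForm_eq {P : Type*} {S : P → Set (Spins N)} {τ : P → ℝ} {𝒥 : P → Couplings N}
    {θ : ℝ} (F : CutFamily β h lam x S τ 𝒥 θ) (hN : 1 ≤ N) (p : P) {a : ℕ} (ha : a ≤ x.K)
    (g : Fields N) : gradForm β h lam x (S p) (τ p) (𝒥 p) a g =
      N * β ^ 2 / 2 * (replicaSq β h lam x (S p) (τ p) (𝒥 p) a g - x.q a ^ 2) := by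
  have hN0 : (N : ℝ) ≠ 0 := by positivity
  rw [gradForm, replicaSq, sum_replicaCoeff_mul]
  simp only [Fintype.sum_sum_type, Fintype.sum_prod_type, heatCoeff, noiseObs, replicaObs,
    cutTilt_const_mul, F.cutTilt_one p ha, mul_pow, div_pow,
    Real.sq_sqrt (by positivity : (0 : ℝ) ≤ 2 * N), one_mul, ← Finset.mul_sum]
  field_simp
  ring

lemma CutFamily.growth_gradForm {P : Type*} {S : P → Set (Spins N)} {τ : P → ℝ}
    {𝒥 : P → Couplings N} {θ : ℝ} (F : CutFamily β h lam x S τ 𝒥 θ) (hN : 1 ≤ N) {a : ℕ}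
    (ha : a ≤ x.K) : Growth (fun p => couplingSq (𝒥 p)) a
      (fun p => gradForm β h lam x (S p) (τ p) (𝒥 p) a) := by
  have e : (fun p => gradForm β h lam x (S p) (τ p) (𝒥 p) a) = fun p g => N * β ^ 2 / 2 *
      (replicaSq β h lam x (S p) (τ p) (𝒥 p) a g + -(x.q a ^ 2)) :=
    funext fun p => funext fun g => F.gradForm_eq hN p ha g
  rw [e]
  exact ((F.growth_replicaSq ha).add
    (Growth.const_add (fun p => couplingSq_nonneg _) a _)).const_mul _

lemma CutFamily.tilt_gradForm {P : Type*} {S : P → Set (Spins N)} {τ : P → ℝ}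
    {𝒥 : P → Couplings N} {θ : ℝ} (F : CutFamily β h lam x S τ 𝒥 θ) (hN : 1 ≤ N) (p : P) {a : ℕ}
    (ha : a ≤ x.K) : tiltLevels x.m (cutLog β h lam x (S p) (τ p) (𝒥 p))
      (gradForm β h lam x (S p) (τ p) (𝒥 p) a) 0 a 0 =
      N * β ^ 2 / 2 * (cutFluct β h lam x (S p) (τ p) (𝒥 p) a - x.q a ^ 2) := by
  have e : gradForm β h lam x (S p) (τ p) (𝒥 p) a = fun g => N * β ^ 2 / 2 *
      (replicaSq β h lam x (S p) (τ p) (𝒥 p) a g + -(x.q a ^ 2)) :=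
    funext fun g => F.gradForm_eq hN p ha g
  rw [e, tiltLevels_const_mul, sub_eq_add_neg]
  congr 1
  have := F.levelGrowth.tilt_add (X := fun p => replicaSq β h lam x (S p) (τ p) (𝒥 p) a)
    (Y := fun _ _ => -(x.q a ^ 2)) a 0 (by omega) (by rw [zero_add]; exact F.growth_replicaSq ha)
    (by rw [zero_add]; exact Growth.const_add (fun p => couplingSq_nonneg _) a _) p 0
  rw [this, F.levelGrowth.tilt_const _ a 0 (by omega) p 0]
  rfl

variable (β h lam x)

lemma heatCoeff_sub (a : ℕ) (k : NoiseIndex N) :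
    heatCoeff (x.q (a + 1)) k - siteVar (-(x.q (a + 1) - x.q a)) k = heatCoeff (x.q a) k := by
  rcases k with k | k
  · simp [heatCoeff, siteVar]
  · simp only [heatCoeff, siteVar]; ring

lemma levelJet_heat (hN : 1 ≤ N) (n : ℕ) {t : ℝ} (ht : t ∈ Set.Ioo (0 : ℝ) 1) (J : Couplings N)
    {a : ℕ} (ha : a ≤ x.K) : ∀ g : Fields N,
    (levelJet β h lam x n a).Ut t (noisePoint x t J g a) +
      1 / 2 * ∑ k, heatCoeff (x.q a) k * (levelJet β h lam x n a).Uii k t (noisePoint x t J g a) =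
    -(x.m a / 2) * gradForm β h lam x (box n) t J a g - 1 / 2 * ∑ b ∈ Finset.Icc a x.K,
      (x.m (b + 1) - x.m b) * tiltLevels x.m (cutLog β h lam x (box n) t J)
        (gradForm β h lam x (box n) t J b) a (b - a) g := by
  have ht' := Set.Ioo_subset_Icc_self ht
  induction ha using Nat.decreasingInduction with
  | self =>
    intro g
    obtain ⟨R, hR⟩ := exists_boundedModel_box (N := N) β h lam x n
    have h1 := hR.freeEnergy_heat (fun z => rfl) t (noisePoint x t J g x.K)
    have h2 : ∀ k, (levelJet β h lam x n x.K).Ui k t (noisePoint x t J g x.K) =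
      cutTilt β h lam x (box n) t J x.K g (noiseObs β k) := fun k =>
        levelJet_Ui β h lam x n ht' J k le_rfl g
    simp only [levelJet_last, topJet, OrderParameter.Q] at h1 h2 ⊢
    rw [h1]
    simp only [h2, Finset.Icc_self, Finset.sum_singleton, Nat.sub_self, tiltLevels, x.m_last]
    rw [← gradForm]
    ring
  | of_succ a ha ih =>
    intro g
    obtain ⟨hr, C, hC⟩ := levelJet_regular (N := N) β h lam x n (Nat.succ_le_of_lt ha)
    have key := Jet.step_heat hr hC (x.m_nonneg (a := a + 1) (by omega))
      (siteVar (x.q (a + 1) - x.q a)) (siteVar (-(x.q (a + 1) - x.q a))) (heatCoeff (x.q (a + 1)))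
      ht (noisePoint x t J g a)
    simp only [heatCoeff_sub, ← levelJet_of_lt β h lam x n ha] at key
    rw [key]
    have F := cutFamily_box (N := N) (β := β) (h := h) (lam := lam) (x := x) n
    let p : Set.Icc (0 : ℝ) 1 × Couplings N := (⟨t, ht'⟩, J)
    have e1 : ∀ g', ((levelJet β h lam x n (a + 1)).Ut t (noisePoint x t J g' (a + 1)) +
        1 / 2 * ∑ k, heatCoeff (x.q (a + 1)) k *
          (levelJet β h lam x n (a + 1)).Uii k t (noisePoint x t J g' (a + 1))) +
        x.m (a + 1) / 2 * ∑ k, heatCoeff (x.q (a + 1)) k *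
          (levelJet β h lam x n (a + 1)).Ui k t (noisePoint x t J g' (a + 1)) ^ 2 =
        -(1 / 2) * ∑ b ∈ Finset.Icc (a + 1) x.K, (x.m (b + 1) - x.m b) *
          tiltLevels x.m (cutLog β h lam x (box n) t J)
            (gradForm β h lam x (box n) t J b) (a + 1) (b - (a + 1)) g' := by
      intro g'
      rw [ih g']
      simp only [levelJet_Ui β h lam x n ht' J _ (Nat.succ_le_of_lt ha)]
      rw [← gradForm]
      ring
    have gT : ∀ b ∈ Finset.Icc (a + 1) x.K, Growth (fun p : Set.Icc (0 : ℝ) 1 × Couplings N =>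
        couplingSq p.2) (a + 1) (fun p => tiltLevels x.m (cutLog β h lam x (box n) p.1 p.2)
            (gradForm β h lam x (box n) p.1 p.2 b) (a + 1) (b - (a + 1))) := by
      intro b hb
      obtain ⟨h1, h2⟩ := Finset.mem_Icc.1 hb
      refine F.levelGrowth.tilt _ _ (by omega) ?_
      rw [Nat.add_sub_cancel' h1]
      exact F.growth_gradForm hN h2
    have e2 : (levelJet β h lam x n (a + 1)).tilt (x.m (a + 1)) (siteVar (x.q (a + 1) - x.q a))
        (siteVar (-(x.q (a + 1) - x.q a))) (fun t y =>
          ((levelJet β h lam x n (a + 1)).Ut t y + 1 / 2 * ∑ k, heatCoeff (x.q (a + 1)) k *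
            (levelJet β h lam x n (a + 1)).Uii k t y) + x.m (a + 1) / 2 *
            ∑ k, heatCoeff (x.q (a + 1)) k * (levelJet β h lam x n (a + 1)).Ui k t y ^ 2) t
          (noisePoint x t J g a) =
        tmean (spinMeasure N) (x.m (a + 1))
          (fun y => cutLog β h lam x (box n) t J (a + 1) (Function.update g (a + 1) y))
          (fun y => -(1 / 2) * ∑ b ∈ Finset.Icc (a + 1) x.K, (x.m (b + 1) - x.m b) *
            tiltLevels x.m (cutLog β h lam x (box n) t J) (gradForm β h lam x (box n) t J b)
              (a + 1) (b - (a + 1)) (Function.update g (a + 1) y)) := by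
      simp only [Jet.tilt, shift_noisePoint x t J g ha, e1,
        levelJet_U β h lam x n ht' J (Nat.succ_le_of_lt ha)]
      refine tmean_gaussPi_inr _ (F := fun y => cutLog β h lam x (box n) t J (a + 1)
          (Function.update g (a + 1) y)) (X := fun y => -(1 / 2) * ∑ b ∈ Finset.Icc (a + 1) x.K,
            (x.m (b + 1) - x.m b) * tiltLevels x.m (cutLog β h lam x (box n) t J)
              (gradForm β h lam x (box n) t J b) (a + 1) (b - (a + 1))
              (Function.update g (a + 1) y)) (measurable_cutLog_update _ _ _ _ _ _) ?_
      refine (Finset.measurable_fun_sum _ fun b hb => Measurable.const_mul ?_ _).const_mul _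
      exact ((gT b hb).meas p).comp (measurable_updateField (a + 1) g)
    rw [e2, tmean_const_mul, tmean_sum _ fun b hb => ?_]
    · simp only [tmean_const_mul, levelJet_Ui β h lam x n ht' J _ ha.le]
      rw [← gradForm, ← Finset.insert_Icc_succ_left_eq_Icc ha.le, Finset.sum_insert (by simp)]
      have e3 : ∀ b ∈ Finset.Icc (a + 1) x.K, (x.m (b + 1) - x.m b) *
          tiltLevels x.m (cutLog β h lam x (box n) t J)
            (gradForm β h lam x (box n) t J b) a (b - a) g =
          (x.m (b + 1) - x.m b) * tmean (spinMeasure N) (x.m (a + 1))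
            (fun y => cutLog β h lam x (box n) t J (a + 1) (Function.update g (a + 1) y))
            (fun y => tiltLevels x.m (cutLog β h lam x (box n) t J)
              (gradForm β h lam x (box n) t J b) (a + 1) (b - (a + 1))
              (Function.update g (a + 1) y)) := by
        intro b hb
        have h1 := (Finset.mem_Icc.1 hb).1
        rw [show b - a = (b - (a + 1)) + 1 by omega]
        rfl
      rw [Order.succ_eq_add_one, Finset.sum_congr rfl e3, Nat.sub_self, tiltLevels]
      ring
    · exact F.levelGrowth.integrable_exp_mul ha ((gT b hb).const_mul (x.m (b + 1) - x.m b)) p g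

/-- The jet of the averaged free energy of the cut-off model. -/
def quenchedJet (n : ℕ) : Jet (NoiseIndex N) := (levelJet β h lam x n 0).step 0 0 couplingVar

lemma quenchedJet_regular (n : ℕ) : (quenchedJet (N := N) β h lam x n).Regular := by
  obtain ⟨hr, C, hC⟩ := levelJet_regular (N := N) β h lam x n (Nat.zero_le _)
  refine hr.step hC 0 ⟨fun k => le_rfl, fun k => ?_⟩
  rcases k with k | k <;> simp [couplingVar]

lemma measurable_cutLog_zero (S : Set (Spins N)) :
    Measurable (fun q : ℝ × Couplings N => cutLog β h lam x S q.1 q.2 0 0) := by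
  have e : Measurable (fun q : ℝ × Couplings N => ((q, 0) : (ℝ × Couplings N) × Fields N)) := by
    fun_prop
  have := (measurable_cutLog β h lam x S 0).comp e
  exact this

lemma quenchedJet_U (n : ℕ) {t : ℝ} (ht : t ∈ Set.Icc (0 : ℝ) 1) :
    (quenchedJet (N := N) β h lam x n).U t 0 =
      ∫ J, cutLog β h lam x (box n) t J 0 0 ∂(couplingMeasure N) := by
  simp only [quenchedJet, Jet.step, lme_zero, shift_couplingVar x,
    levelJet_U β h lam x n ht _ (Nat.zero_le _)]
  have hm := (measurable_cutLog_zero (N := N) β h lam x (box n)).comp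
    (measurable_prodMk_left (x := t))
  exact integral_gaussPi_inl hm

lemma quenchedJet_Ut (hN : 1 ≤ N) (n : ℕ) {t : ℝ} (ht : t ∈ Set.Ioo (0 : ℝ) 1) :
    (quenchedJet (N := N) β h lam x n).Ut t 0 = N * (squareTerm β x -
      β ^ 2 / 4 * ∑ a ∈ Finset.Icc 0 x.K, (x.m (a + 1) - x.m a) *
        ∫ J, cutFluct β h lam x (box n) t J a ∂(couplingMeasure N)) := by
  have ht' := Set.Ioo_subset_Icc_self ht
  obtain ⟨hr, C, hC⟩ := levelJet_regular (N := N) β h lam x n (Nat.zero_le _)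
  have key := Jet.step_heat hr hC le_rfl 0 couplingVar (heatCoeff (x.q 0)) ht 0
  have e0 : ∀ k : NoiseIndex N, heatCoeff (x.q 0) k - couplingVar k = 0 := by
    intro k
    rcases k with k | k <;> simp [heatCoeff, couplingVar, x.q_zero]
  have F := cutFamily_box (N := N) (β := β) (h := h) (lam := lam) (x := x) n
  have hm : ∀ a, Measurable (fun J => cutFluct (N := N) β h lam x (box n) t J a) := by
    intro a
    have := (measurable_cutFluct (N := N) (β := β) (h := h) (lam := lam) (x := x) (box n) a).comp
      (measurable_prodMk_left (x := t))
    exact this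
  have hI : ∀ a ∈ Finset.Icc 0 x.K,
      Integrable (fun J => cutFluct (N := N) β h lam x (box n) t J a) (couplingMeasure N) := by
    intro a ha
    obtain ⟨D, -, hD⟩ := F.cutFluct_le (Finset.mem_Icc.1 ha).2
    exact integrable_of_abs_le_couplingSq (hm a) fun J => hD (⟨t, ht'⟩, J)
  simp only [e0, zero_mul, Finset.sum_const_zero, mul_zero, add_zero, zero_div, sub_zero] at key
  rw [quenchedJet, key]
  simp only [Jet.tilt, tmean_zero, shift_couplingVar x,
    levelJet_heat β h lam x hN n ht _ (Nat.zero_le _), x.m_zero, zero_div, neg_zero, zero_mul,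
    zero_sub, Nat.sub_zero]
  have e1 : ∀ J : Couplings N, ∀ b ∈ Finset.Icc 0 x.K, (x.m (b + 1) - x.m b) *
      tiltLevels x.m (cutLog β h lam x (box n) t J) (gradForm β h lam x (box n) t J b) 0 b 0 =
      (x.m (b + 1) - x.m b) *
        (N * β ^ 2 / 2 * (cutFluct β h lam x (box n) t J b - x.q b ^ 2)) := by
    intro J b hb
    congr 1
    exact F.tilt_gradForm hN (⟨t, ht'⟩, J) (Finset.mem_Icc.1 hb).2
  have e1' := fun J => Finset.sum_congr rfl (e1 J)
  simp only [e1']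
  rw [integral_gaussPi_inl (F := fun J => -(1 / 2 * ∑ b ∈ Finset.Icc 0 x.K, (x.m (b + 1) - x.m b) *
    (N * β ^ 2 / 2 * (cutFluct β h lam x (box n) t J b - x.q b ^ 2)))) ?_]
  · have i3 : ∀ b ∈ Finset.Icc 0 x.K, Integrable (fun J => (x.m (b + 1) - x.m b) *
        (N * β ^ 2 / 2 * (cutFluct β h lam x (box n) t J b - x.q b ^ 2))) (couplingMeasure N) :=
      fun b hb => (((hI b hb).sub (integrable_const _)).const_mul _).const_mul _
    rw [integral_neg, integral_const_mul, integral_finsetSum _ i3]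
    have e2 : ∀ b ∈ Finset.Icc 0 x.K, ∫ J, (x.m (b + 1) - x.m b) *
        (N * β ^ 2 / 2 * (cutFluct β h lam x (box n) t J b - x.q b ^ 2)) ∂(couplingMeasure N) =
        N * β ^ 2 / 2 * ((x.m (b + 1) - x.m b) *
          ∫ J, cutFluct β h lam x (box n) t J b ∂(couplingMeasure N)) -
          N * β ^ 2 / 2 * ((x.m (b + 1) - x.m b) * x.q b ^ 2) := by
      intro b hb
      rw [integral_const_mul, integral_const_mul, integral_sub (hI b hb) (integrable_const _)]
      simp
      ring
    rw [Finset.sum_congr rfl e2, Finset.sum_sub_distrib, ← Finset.mul_sum, ← Finset.mul_sum]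
    have e3 : ∑ b ∈ Finset.Icc 0 x.K, (x.m (b + 1) - x.m b) * x.q b ^ 2 =
        ∑ b ∈ Finset.Icc 1 x.K, (x.m (b + 1) - x.m b) * x.q b ^ 2 := by
      rw [← Finset.insert_Icc_succ_left_eq_Icc (Nat.zero_le x.K), Finset.sum_insert (by simp),
        x.q_zero]
      simp
    rw [e3, squareTerm]
    ring
  · have := hm
    fun_prop

end Model

end GaussianSpinGlass
end

noncomputable section

namespace GaussianSpinGlass

variable {N : ℕ}

/-! ### Explicit solution at `t = 0` -/

lemma integrable_spin_exp_quadratic {c : ℝ} (hc : c < 1 / 2) (b : Spins N) :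
    Integrable (fun y : Spins N => Real.exp (∑ i, (c * y i ^ 2 + b i * y i))) (spinMeasure N) := by
  simp only [Real.exp_sum]
  exact Integrable.fintype_prod (f := fun i y => Real.exp (c * y ^ 2 + b i * y))
    fun i => integrable_exp_quadratic hc (b i)

lemma integral_spin_exp_quadratic {c : ℝ} (hc : c < 1 / 2) (b : Spins N) :
    ∫ y : Spins N, Real.exp (∑ i, (c * y i ^ 2 + b i * y i)) ∂(spinMeasure N) =
      Real.exp (N * (-(1 / 2) * Real.log (1 - 2 * c)) + ∑ i, b i ^ 2 / (2 * (1 - 2 * c))) := by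
  have h0 : 0 < 1 - 2 * c := by linarith
  simp only [Real.exp_sum, spinMeasure]
  rw [integral_fintype_prod_eq_prod (fun i y => Real.exp (c * y ^ 2 + b i * y))]
  have e : (Real.sqrt (1 - 2 * c))⁻¹ = Real.exp (-(1 / 2) * Real.log (1 - 2 * c)) := by
    rw [Real.sqrt_eq_rpow, Real.rpow_def_of_pos h0, ← Real.exp_neg]
    congr 1; ring
  simp only [integral_exp_quadratic hc, e]
  rw [Finset.prod_mul_distrib, Finset.prod_const, Finset.card_univ, Fintype.card_fin,
    ← Real.exp_nat_mul, ← Real.exp_sum, ← Real.exp_add]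

lemma integrable_sq_add_mul (u σ : ℝ) :
    Integrable (fun y : ℝ => (u + σ * y) ^ 2) (gaussianReal 0 1) := by
  have h2 : Integrable (fun y : ℝ => y ^ 2) (gaussianReal 0 1) :=
    (memLp_id_gaussianReal (μ := 0) (v := 1) 2).integrable_sq
  have h1 : Integrable (fun y : ℝ => y) (gaussianReal 0 1) :=
    (memLp_id_gaussianReal (μ := 0) (v := 1) 1).integrable (by simp)
  refine (((h2.const_mul (σ ^ 2)).add (h1.const_mul (2 * u * σ))).add
    (integrable_const (u ^ 2))).congr (ae_of_all _ fun y => ?_)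
  simp only [Pi.add_apply]
  ring

lemma integral_sq_add_mul (u σ : ℝ) :
    ∫ y : ℝ, (u + σ * y) ^ 2 ∂(gaussianReal 0 1) = u ^ 2 + σ ^ 2 := by
  have h2 : Integrable (fun y : ℝ => y ^ 2) (gaussianReal 0 1) :=
    (memLp_id_gaussianReal (μ := 0) (v := 1) 2).integrable_sq
  have h1 : Integrable (fun y : ℝ => y) (gaussianReal 0 1) :=
    (memLp_id_gaussianReal (μ := 0) (v := 1) 1).integrable (by simp)
  have v : ∫ y : ℝ, y ^ 2 ∂(gaussianReal 0 1) = 1 := by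
    have := variance_fun_id_gaussianReal (μ := 0) (v := 1)
    rw [variance_of_integral_eq_zero aemeasurable_id' (by simp)] at this
    simpa using this
  have e : (fun y : ℝ => (u + σ * y) ^ 2) =
      fun y => (σ ^ 2 * y ^ 2 + 2 * u * σ * y) + u ^ 2 := by ext y; ring
  have ia : Integrable (fun y : ℝ => σ ^ 2 * y ^ 2 + 2 * u * σ * y) (gaussianReal 0 1) :=
    (h2.const_mul (σ ^ 2)).add (h1.const_mul (2 * u * σ))
  rw [e, integral_add ia (integrable_const _),
    integral_add (h2.const_mul (σ ^ 2)) (h1.const_mul (2 * u * σ)), integral_const_mul,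
    integral_const_mul, v, integral_id_gaussianReal]
  simp
  ring

lemma integrable_spin_quadratic (c k σ : ℝ) (u : Spins N) :
    Integrable (fun y : Spins N => c + k * ∑ i, (u i + σ * y i) ^ 2) (spinMeasure N) := by
  refine (integrable_const c).add (Integrable.const_mul (integrable_finsetSum _ fun i _ => ?_) k)
  exact integrable_comp_eval (μ := fun _ : Fin N => gaussianReal 0 1) (i := i)
    (integrable_sq_add_mul (u i) σ)

lemma exp_quadratic_eq (m c k σ : ℝ) (u y : Spins N) :
    Real.exp (m * (c + k * ∑ i, (u i + σ * y i) ^ 2)) =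
      Real.exp (m * c + m * k * ∑ i, u i ^ 2) *
        Real.exp (∑ i, (m * k * σ ^ 2 * y i ^ 2 + 2 * m * k * σ * u i * y i)) := by
  rw [← Real.exp_add]
  congr 1
  simp only [Finset.mul_sum, mul_add]
  rw [add_assoc, ← Finset.sum_add_distrib]
  congr 1
  exact Finset.sum_congr rfl fun i _ => by ring

lemma integrable_exp_spin_quadratic {m k σ : ℝ} (hk : 2 * m * k * σ ^ 2 < 1) (c : ℝ)
    (u : Spins N) :
    Integrable (fun y : Spins N => Real.exp (m * (c + k * ∑ i, (u i + σ * y i) ^ 2)))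
      (spinMeasure N) := by
  simp only [exp_quadratic_eq]
  exact (integrable_spin_exp_quadratic (by linarith) _).const_mul _

lemma lme_spin_quadratic {m k σ : ℝ} (hk : 2 * m * k * σ ^ 2 < 1) :
    ∃ d, ∀ (N : ℕ) (c : ℝ) (u : Spins N),
      lme (spinMeasure N) m (fun y => c + k * ∑ i, (u i + σ * y i) ^ 2) =
        c + N * d + k / (1 - 2 * m * k * σ ^ 2) * ∑ i, u i ^ 2 := by
  by_cases hm : m = 0
  · subst hm
    refine ⟨k * σ ^ 2, fun N c u => ?_⟩
    have hi : ∀ i : Fin N, Integrable (fun y : Spins N => (u i + σ * y i) ^ 2) (spinMeasure N) :=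
      fun i => integrable_comp_eval (μ := fun _ : Fin N => gaussianReal 0 1) (i := i)
        (integrable_sq_add_mul (u i) σ)
    have hv : ∀ i : Fin N, ∫ y : Spins N, (u i + σ * y i) ^ 2 ∂(spinMeasure N) =
        u i ^ 2 + σ ^ 2 := fun i => by
      rw [← integral_sq_add_mul]
      exact integral_comp_eval (μ := fun _ : Fin N => gaussianReal 0 1) (i := i)
        (integrable_sq_add_mul (u i) σ).1
    rw [lme_zero, integral_add (integrable_const _)
      ((integrable_finsetSum _ fun i _ => hi i).const_mul k), integral_const_mul,
      integral_finsetSum _ fun i _ => hi i]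
    simp only [hv, Finset.sum_add_distrib]
    simp
    ring
  · refine ⟨1 / m * (-(1 / 2) * Real.log (1 - 2 * (m * k * σ ^ 2))), fun N c u => ?_⟩
    have hp : 1 - 2 * (m * k * σ ^ 2) ≠ 0 := by linarith
    have hp' : 1 - 2 * m * k * σ ^ 2 ≠ 0 := by linarith
    rw [lme_of_ne hm]
    simp only [exp_quadratic_eq]
    rw [integral_const_mul, integral_spin_exp_quadratic (by linarith), ← Real.exp_add,
      Real.log_exp, ← Finset.sum_div]
    have e : ∑ i, (2 * m * k * σ * u i) ^ 2 = (2 * m * k * σ) ^ 2 * ∑ i, u i ^ 2 := by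
      rw [Finset.mul_sum]
      exact Finset.sum_congr rfl fun i _ => by ring
    rw [e, show 2 * (1 - 2 * (m * k * σ ^ 2)) = 2 * (1 - 2 * m * k * σ ^ 2) by ring]
    generalize ∑ i, u i ^ 2 = S
    generalize Real.log (1 - 2 * (m * k * σ ^ 2)) = L
    have key : m * k * S + (2 * m * k * σ) ^ 2 * S / (2 * (1 - 2 * m * k * σ ^ 2)) =
        m * (k / (1 - 2 * m * k * σ ^ 2) * S) := by
      generalize hD : 1 - 2 * m * k * σ ^ 2 = D at hp'
      rw [show (2 * m * k * σ) ^ 2 * S = 2 * m * k * S * (1 - D) by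
        linear_combination (-2 * m * k * S) * hD]
      field_simp
      ring
    calc _ = 1 / m * (m * c + N * (-(1 / 2) * L) +
          (m * k * S + (2 * m * k * σ) ^ 2 * S / (2 * (1 - 2 * m * k * σ ^ 2)))) := by ring
      _ = _ := by rw [key]; field_simp

section Model
variable (β h lam : ℝ) (x : OrderParameter)

/-- The accumulated site field at level `a` and time `0`. -/
def fieldPoint (g : Fields N) (a : ℕ) (i : Fin N) : ℝ :=
  ∑ b ∈ Finset.range a, Real.sqrt (x.q (b + 1) - x.q b) * g (b + 1) i

/-- The curvature of the effective single spin Gaussian at level `a`. -/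
def curvature (a : ℕ) : ℝ :=
  1 - lam + β ^ 2 * (x.Q - ∑ b ∈ Finset.Ico a x.K, x.m (b + 1) * (x.q (b + 1) - x.q b))

lemma curvature_last : curvature β lam x x.K = 1 - lam + β ^ 2 * x.Q := by simp [curvature]

lemma curvature_of_lt {a : ℕ} (ha : a < x.K) : curvature β lam x a =
    curvature β lam x (a + 1) - x.m (a + 1) * β ^ 2 * (x.q (a + 1) - x.q a) := by
  simp only [curvature]
  rw [Finset.sum_eq_sum_Ico_succ_bot ha]
  ring

variable {β h lam x}

lemma curvature_pos (hx : 0 < 1 - lam + β ^ 2 * x.gap) (a : ℕ) : 0 < curvature β lam x a := by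
  have hq : ∀ b < x.K, 0 ≤ x.m (b + 1) * (x.q (b + 1) - x.q b) := fun b hb =>
    mul_nonneg (x.m_nonneg (by omega)) (sub_nonneg.2 (x.q_mono b hb))
  have h1 : ∑ b ∈ Finset.Ico a x.K, x.m (b + 1) * (x.q (b + 1) - x.q b) ≤
      ∑ b ∈ Finset.range x.K, x.m (b + 1) * (x.q (b + 1) - x.q b) :=
    Finset.sum_le_sum_of_subset_of_nonneg
      (fun b hb => Finset.mem_range.2 (Finset.mem_Ico.1 hb).2)
      fun b hb _ => hq b (Finset.mem_range.1 hb)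
  have h2 : x.gap = x.Q - ∑ b ∈ Finset.range x.K, x.m (b + 1) * (x.q (b + 1) - x.q b) := by
    have : x.Q = ∑ b ∈ Finset.range x.K, (x.q (b + 1) - x.q b) := by
      rw [Finset.sum_range_sub, x.q_zero, sub_zero, OrderParameter.Q]
    rw [this, ← Finset.sum_sub_distrib, OrderParameter.gap]
    exact Finset.sum_congr rfl fun b _ => by ring
  have h3 : x.gap ≤ x.Q - ∑ b ∈ Finset.Ico a x.K, x.m (b + 1) * (x.q (b + 1) - x.q b) := by
    linarith
  have := mul_le_mul_of_nonneg_left h3 (sq_nonneg β)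
  unfold curvature
  linarith

lemma expo_zero (J : Couplings N) (g : Fields N) (z : Spins N) :
    expo β h lam x 0 J g z = ∑ i, ((1 - curvature β lam x x.K) / 2 * z i ^ 2 +
      β * (h + fieldPoint x g x.K i) * z i) := by
  have e3 : ∑ i, fieldPoint x g x.K i * z i =
        ∑ a ∈ Finset.range x.K, Real.sqrt (x.q (a + 1) - x.q a) * ∑ i, g (a + 1) i * z i := by
    simp only [fieldPoint, Finset.mul_sum, Finset.sum_mul]
    rw [Finset.sum_comm]
    exact Finset.sum_congr rfl fun b _ => Finset.sum_congr rfl fun i _ => by ring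
  have e : ∑ i, ((1 - curvature β lam x x.K) / 2 * z i ^ 2 +
      β * (h + fieldPoint x g x.K i) * z i) = (1 - curvature β lam x x.K) / 2 * ∑ i, z i ^ 2 +
      β * h * ∑ i, z i + β * ∑ i, fieldPoint x g x.K i * z i := by
    simp only [Finset.mul_sum]
    rw [← Finset.sum_add_distrib, ← Finset.sum_add_distrib]
    exact Finset.sum_congr rfl fun i _ => by ring
  rw [e, e3, curvature_last]
  simp [expo]
  ring

lemma integrable_boltzmann_zero (hx : 0 < 1 - lam + β ^ 2 * x.gap) (J : Couplings N)
    (g : Fields N) : Integrable (boltzmann β h lam x 0 J g) (spinMeasure N) := by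
  have := integrable_spin_exp_quadratic (N := N) (c := (1 - curvature β lam x x.K) / 2)
    (by linarith [curvature_pos hx x.K]) fun i => β * (h + fieldPoint x g x.K i)
  exact this.congr (ae_of_all _ fun z => by rw [boltzmann_eq, expo_zero])

lemma fieldPoint_update (g : Fields N) (a : ℕ) (y : Spins N) (i : Fin N) :
    fieldPoint x (Function.update g (a + 1) y) (a + 1) i =
      fieldPoint x g a i + Real.sqrt (x.q (a + 1) - x.q a) * y i := by
  rw [fieldPoint, Finset.sum_range_succ, Function.update_self]
  congr 1
  refine Finset.sum_congr rfl fun b hb => ?_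
  rw [Function.update_of_ne]
  have := Finset.mem_range.1 hb
  omega

lemma two_mul_curvature_lt (hx : 0 < 1 - lam + β ^ 2 * x.gap) {a : ℕ} (ha : a < x.K) :
    2 * x.m (a + 1) * (β ^ 2 / (2 * curvature β lam x (a + 1))) *
      Real.sqrt (x.q (a + 1) - x.q a) ^ 2 < 1 := by
  rw [Real.sq_sqrt (sub_nonneg.2 (x.q_mono a ha))]
  have h1 := curvature_pos hx (a + 1)
  have h2 := curvature_pos hx a
  rw [curvature_of_lt β lam x ha] at h2
  rw [show 2 * x.m (a + 1) * (β ^ 2 / (2 * curvature β lam x (a + 1))) * (x.q (a + 1) - x.q a) =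
    x.m (a + 1) * β ^ 2 * (x.q (a + 1) - x.q a) / curvature β lam x (a + 1) by field_simp,
    div_lt_one h1]
  linarith

lemma cutLog_zero_time (hx : 0 < 1 - lam + β ^ 2 * x.gap) {a : ℕ} (ha : a ≤ x.K) :
    ∃ c, ∀ (N : ℕ) (J : Couplings N) (g : Fields N), cutLog β h lam x Set.univ 0 J a g =
      N * c + β ^ 2 / (2 * curvature β lam x a) * ∑ i, (h + fieldPoint x g a i) ^ 2 := by
  induction ha using Nat.decreasingInduction with
  | self =>
    have hp := curvature_pos hx x.K
    refine ⟨-(1 / 2) * Real.log (curvature β lam x x.K), fun N J g => ?_⟩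
    rw [cutLog_last, cutZ]
    simp only [Measure.restrict_univ, boltzmann_eq, expo_zero]
    rw [integral_spin_exp_quadratic (by linarith), Real.log_exp,
      show 1 - 2 * ((1 - curvature β lam x x.K) / 2) = curvature β lam x x.K by ring,
      Finset.mul_sum]
    congr 1
    exact Finset.sum_congr rfl fun i _ => by ring
  | of_succ a ha ih =>
    obtain ⟨c, hc⟩ := ih
    have hlt := two_mul_curvature_lt hx ha
    obtain ⟨d, hd⟩ := lme_spin_quadratic hlt
    refine ⟨c + d, fun N J g => ?_⟩
    rw [cutLog_of_lt _ _ _ _ _ _ _ ha]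
    simp only [hc, fieldPoint_update, ← add_assoc]
    rw [hd]
    have h1 := curvature_pos hx (a + 1)
    have h2 := curvature_pos hx a
    have e : β ^ 2 / (2 * curvature β lam x (a + 1)) / (1 - 2 * x.m (a + 1) *
        (β ^ 2 / (2 * curvature β lam x (a + 1))) * Real.sqrt (x.q (a + 1) - x.q a) ^ 2) =
        β ^ 2 / (2 * curvature β lam x a) := by
      rw [Real.sq_sqrt (sub_nonneg.2 (x.q_mono a ha))]
      have e1 : 1 - 2 * x.m (a + 1) * (β ^ 2 / (2 * curvature β lam x (a + 1))) *
          (x.q (a + 1) - x.q a) = curvature β lam x a / curvature β lam x (a + 1) := by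
        rw [curvature_of_lt β lam x ha]
        field_simp
      rw [e1]
      field_simp
    rw [e]
    ring

lemma wellPosed_zero (hx : 0 < 1 - lam + β ^ 2 * x.gap) (J : Couplings N) :
    WellPosed β h lam x Set.univ 0 J where
  pos := fun g => by
    have := integrable_boltzmann_zero (h := h) hx J g
    rw [cutZ, Measure.restrict_univ]
    exact integral_exp_pos this
  int_exp := fun a ha g => by
    obtain ⟨c, hc⟩ := cutLog_zero_time (h := h) hx (Nat.succ_le_of_lt ha)
    simp only [Nat.succ_eq_add_one] at hc
    simp only [hc, fieldPoint_update, ← add_assoc]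
    exact integrable_exp_spin_quadratic (two_mul_curvature_lt hx ha) _ _
  int_log := fun a ha g => by
    obtain ⟨c, hc⟩ := cutLog_zero_time (h := h) hx (Nat.succ_le_of_lt ha)
    simp only [Nat.succ_eq_add_one] at hc
    simp only [hc, fieldPoint_update, ← add_assoc]
    exact integrable_spin_quadratic _ _ _ _

lemma exists_cutLog_zero_time (hx : 0 < 1 - lam + β ^ 2 * x.gap) :
    ∃ φ₀, ∀ (N : ℕ) (J : Couplings N), cutLog β h lam x Set.univ 0 J 0 0 = N * φ₀ := by
  obtain ⟨c, hc⟩ := cutLog_zero_time (h := h) hx (Nat.zero_le x.K)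
  refine ⟨c + β ^ 2 / (2 * curvature β lam x 0) * h ^ 2, fun N J => ?_⟩
  rw [hc]
  simp [fieldPoint]
  ring

end Model

end GaussianSpinGlass
end

noncomputable section

namespace GaussianSpinGlass

variable {N : ℕ}

/-! ### The sum rule -/

section Model
variable (β h lam : ℝ) (x : OrderParameter)

/-- `E_0 log Z_0` with the spins restricted to `S`. -/
def meanLog (S : Set (Spins N)) (t : ℝ) : ℝ :=
  ∫ J, cutLog β h lam x S t J 0 0 ∂(couplingMeasure N)

/-- `⟨(q₁₂ - q_a)²⟩_a` with the spins restricted to `S`. -/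
def meanFluct (S : Set (Spins N)) (a : ℕ) (t : ℝ) : ℝ :=
  ∫ J, cutFluct β h lam x S t J a ∂(couplingMeasure N)

lemma measurable_cutLog_right (S : Set (Spins N)) (t : ℝ) :
    Measurable (fun J : Couplings N => cutLog β h lam x S t J 0 0) := by
  have := (measurable_cutLog_zero β h lam x S).comp (measurable_prodMk_left (x := t))
  exact this

lemma measurable_cutFluct_right (S : Set (Spins N)) (t : ℝ) (a : ℕ) :
    Measurable (fun J : Couplings N => cutFluct β h lam x S t J a) := by
  have := (measurable_cutFluct (β := β) (h := h) (lam := lam) (x := x) S a).comp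
    (measurable_prodMk_left (x := t))
  exact this

lemma measurable_meanFluct (S : Set (Spins N)) (a : ℕ) :
    Measurable (meanFluct β h lam x S a) := by
  have := (measurable_cutFluct (β := β) (h := h) (lam := lam) (x := x) S a).stronglyMeasurable
  exact this.integral_prod_right'.measurable

variable {β h lam x}

lemma integrable_const_mul_couplingSq (C : ℝ) :
    Integrable (fun J : Couplings N => C * (1 + couplingSq J)) (couplingMeasure N) :=
  ((integrable_const 1).add integrable_couplingSq).const_mul C

lemma integrable_cutLog_box (n : ℕ) {t : ℝ} (ht : t ∈ Set.Icc (0 : ℝ) 1) :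
    Integrable (fun J : Couplings N => cutLog β h lam x (box n) t J 0 0) (couplingMeasure N) := by
  obtain ⟨C, -, hC⟩ := (cutFamily_box (N := N) (β := β) (h := h) (lam := lam) (x := x) n).cutLog_le
  exact integrable_of_abs_le_couplingSq (measurable_cutLog_right β h lam x _ t)
    fun J => hC (⟨t, ht⟩, J)

lemma integrable_cutLog_univ (hβ : β ≠ 0) (hN : 1 ≤ N) {t : ℝ} (ht : t ∈ Set.Ioc (0 : ℝ) 1) :
    Integrable (fun J : Couplings N => cutLog β h lam x Set.univ t J 0 0) (couplingMeasure N) := by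
  obtain ⟨C, -, hC⟩ :=
    (cutFamily_pos (N := N) (h := h) (lam := lam) (x := x) hβ hN ht.1).cutLog_le
  exact integrable_of_abs_le_couplingSq (measurable_cutLog_right β h lam x _ t)
    fun J => hC (cutUniv, ⟨t, le_rfl, ht.2⟩, J)

lemma integrable_cutLog_zero (hx : 0 < 1 - lam + β ^ 2 * x.gap) :
    Integrable (fun J : Couplings N => cutLog β h lam x Set.univ 0 J 0 0) (couplingMeasure N) := by
  obtain ⟨φ₀, h0⟩ := exists_cutLog_zero_time (h := h) hx
  simp only [h0]
  exact integrable_const _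

/-- The model without cut-off is well posed and integrable for all `t ∈ [0, 1]`. -/
lemma wellPosed_of_mem (hβ : β ≠ 0) (hN : 1 ≤ N) (hx : 0 < 1 - lam + β ^ 2 * x.gap) {t : ℝ}
    (ht : t ∈ Set.Icc (0 : ℝ) 1) :
    (∀ J : Couplings N, WellPosed β h lam x Set.univ t J) ∧
    (∀ (J : Couplings N) g, Integrable (boltzmann β h lam x t J g) (spinMeasure N)) ∧
    Integrable (fun J : Couplings N => cutLog β h lam x Set.univ t J 0 0) (couplingMeasure N) := by
  rcases ht.1.eq_or_lt with rfl | h0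
  · exact ⟨wellPosed_zero hx, integrable_boltzmann_zero hx, integrable_cutLog_zero hx⟩
  · exact ⟨wellPosed_univ hβ hN ⟨h0, ht.2⟩, integrable_boltzmann hβ hN ⟨h0, ht.2⟩,
      integrable_cutLog_univ hβ hN ⟨h0, ht.2⟩⟩

lemma cutLog_box_le (hβ : β ≠ 0) (hN : 1 ≤ N) (hx : 0 < 1 - lam + β ^ 2 * x.gap) {t : ℝ}
    (ht : t ∈ Set.Icc (0 : ℝ) 1) (n : ℕ) (J : Couplings N) :
    cutLog β h lam x (box n) t J 0 0 ≤ cutLog β h lam x Set.univ t J 0 0 := by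
  obtain ⟨H, hI, -⟩ := wellPosed_of_mem (h := h) hβ hN hx ht
  exact cutLog_mono (Set.subset_univ _) (wellPosed_box n ht J) (H J)
    (fun g => by rw [integrableOn_univ]; exact hI J g) (Nat.zero_le _) _

lemma meanLog_box_le (hβ : β ≠ 0) (hN : 1 ≤ N) (hx : 0 < 1 - lam + β ^ 2 * x.gap) {t : ℝ}
    (ht : t ∈ Set.Icc (0 : ℝ) 1) (n : ℕ) :
    meanLog (N := N) β h lam x (box n) t ≤ meanLog (N := N) β h lam x Set.univ t :=
  integral_mono (integrable_cutLog_box n ht) (wellPosed_of_mem hβ hN hx ht).2.2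
    (cutLog_box_le hβ hN hx ht n)

lemma tendsto_meanLog (hβ : β ≠ 0) (hN : 1 ≤ N) (hx : 0 < 1 - lam + β ^ 2 * x.gap) {t : ℝ}
    (ht : t ∈ Set.Icc (0 : ℝ) 1) :
    Tendsto (fun n => meanLog (N := N) β h lam x (box n) t) atTop
      (𝓝 (meanLog (N := N) β h lam x Set.univ t)) := by
  obtain ⟨H, hI, hJ⟩ := wellPosed_of_mem (N := N) (h := h) hβ hN hx ht
  refine tendsto_integral_of_dominated_convergence
    (fun J => |cutLog β h lam x (box 0) t J 0 0| + |cutLog β h lam x Set.univ t J 0 0|)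
    (fun n => (measurable_cutLog_right β h lam x _ t).aestronglyMeasurable)
    ((integrable_cutLog_box 0 ht).abs.add hJ.abs) (fun n => ae_of_all _ fun J => ?_)
    (ae_of_all _ fun J => tendsto_cutLog ht (H J) (hI J) (Nat.zero_le _) 0)
  have h1 := cutLog_box_le (h := h) hβ hN hx ht n J
  have h2 := cutLog_mono (box_mono (Nat.zero_le n))
    (wellPosed_box (β := β) (h := h) (lam := lam) (x := x) 0 ht J) (wellPosed_box n ht J)
    (integrableOn_boltzmann_box n ht J) (Nat.zero_le x.K) 0
  rw [Real.norm_eq_abs, abs_le]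
  constructor
  · linarith [neg_abs_le (cutLog β h lam x (box 0) t J 0 0),
      abs_nonneg (cutLog β h lam x Set.univ t J 0 0)]
  · linarith [le_abs_self (cutLog β h lam x Set.univ t J 0 0),
      abs_nonneg (cutLog β h lam x (box 0) t J 0 0)]

lemma exists_meanFluct_box_le (n : ℕ) {a : ℕ} (ha : a ≤ x.K) : ∃ C, ∀ t ∈ Set.Icc (0 : ℝ) 1,
    |meanFluct (N := N) β h lam x (box n) a t| ≤ C := by
  obtain ⟨C, -, hC⟩ :=
    (cutFamily_box (N := N) (β := β) (h := h) (lam := lam) (x := x) n).cutFluct_le ha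
  refine ⟨∫ J : Couplings N, C * (1 + couplingSq J) ∂(couplingMeasure N), fun t ht => ?_⟩
  rw [meanFluct, ← Real.norm_eq_abs]
  exact norm_integral_le_of_norm_le (integrable_const_mul_couplingSq C)
    (ae_of_all _ fun J => hC (⟨t, ht⟩, J))

lemma exists_meanFluct_le (hβ : β ≠ 0) (hN : 1 ≤ N) {s : ℝ} (hs : 0 < s) {a : ℕ} (ha : a ≤ x.K) :
    ∃ C, ∀ S : CutSet N, ∀ t ∈ Set.Icc s 1, |meanFluct (N := N) β h lam x S a t| ≤ C := by
  obtain ⟨C, -, hC⟩ :=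
    (cutFamily_pos (N := N) (h := h) (lam := lam) (x := x) hβ hN hs).cutFluct_le ha
  refine ⟨∫ J : Couplings N, C * (1 + couplingSq J) ∂(couplingMeasure N), fun S t ht => ?_⟩
  rw [meanFluct, ← Real.norm_eq_abs]
  exact norm_integral_le_of_norm_le (integrable_const_mul_couplingSq C)
    (ae_of_all _ fun J => hC (S, ⟨t, ht⟩, J))

lemma tendsto_meanFluct (hβ : β ≠ 0) (hN : 1 ≤ N) {t : ℝ} (ht : t ∈ Set.Ioc (0 : ℝ) 1) {a : ℕ}
    (ha : a ≤ x.K) : Tendsto (fun n => meanFluct (N := N) β h lam x (box n) a t) atTop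
      (𝓝 (meanFluct (N := N) β h lam x Set.univ a t)) := by
  obtain ⟨C, -, hC⟩ :=
    (cutFamily_pos (N := N) (h := h) (lam := lam) (x := x) hβ hN ht.1).cutFluct_le ha
  exact tendsto_integral_of_dominated_convergence (fun J => C * (1 + couplingSq J))
    (fun n => (measurable_cutFluct_right β h lam x _ t a).aestronglyMeasurable)
    (integrable_const_mul_couplingSq C)
    (fun n => ae_of_all _ fun J => hC (cutBox n, ⟨t, le_rfl, ht.2⟩, J))
    (ae_of_all _ fun J => tendsto_cutFluct hβ hN ht J ha)

lemma meanFluct_box_nonneg (n : ℕ) {t : ℝ} (ht : t ∈ Set.Icc (0 : ℝ) 1) {a : ℕ} (ha : a ≤ x.K) :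
    0 ≤ meanFluct (N := N) β h lam x (box n) a t :=
  integral_nonneg fun J => (cutFamily_box (N := N) n).cutFluct_nonneg (⟨t, ht⟩, J) ha

lemma meanFluct_univ_nonneg (hβ : β ≠ 0) (hN : 1 ≤ N) {t : ℝ} (ht : t ∈ Set.Ioc (0 : ℝ) 1)
    {a : ℕ} (ha : a ≤ x.K) : 0 ≤ meanFluct (N := N) β h lam x Set.univ a t :=
  ge_of_tendsto' (tendsto_meanFluct hβ hN ht ha)
    fun n => meanFluct_box_nonneg n ⟨ht.1.le, ht.2⟩ ha

lemma intervalIntegrable_of_bound {f : ℝ → ℝ} (hf : Measurable f) {s r C : ℝ}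
    (hC : ∀ t ∈ Set.Icc s r, |f t| ≤ C) (hsr : s ≤ r) : IntervalIntegrable f volume s r := by
  rw [intervalIntegrable_iff_integrableOn_Icc_of_le hsr]
  exact Measure.integrableOn_of_bounded (M := C) (by simp) hf.aestronglyMeasurable
    (ae_restrict_of_forall_mem measurableSet_Icc hC)

lemma intervalIntegrable_meanFluct_box (n : ℕ) {s r : ℝ} (hs : 0 ≤ s) (hr : r ≤ 1) (hsr : s ≤ r)
    {a : ℕ} (ha : a ≤ x.K) :
    IntervalIntegrable (meanFluct (N := N) β h lam x (box n) a) volume s r := by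
  obtain ⟨C, hC⟩ := exists_meanFluct_box_le (N := N) (β := β) (h := h) (lam := lam) n ha
  exact intervalIntegrable_of_bound (measurable_meanFluct β h lam x _ a)
    (fun t ht => hC t ⟨hs.trans ht.1, ht.2.trans hr⟩) hsr

lemma meanLog_box_sub (hN : 1 ≤ N) (n : ℕ) {s r : ℝ} (hs : 0 ≤ s) (hr : r ≤ 1) (hsr : s ≤ r) :
    meanLog (N := N) β h lam x (box n) r - meanLog (N := N) β h lam x (box n) s =
      N * ((r - s) * squareTerm β x - β ^ 2 / 4 * ∑ a ∈ Finset.Icc 0 x.K,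
        (x.m (a + 1) - x.m a) * ∫ t in s..r, meanFluct (N := N) β h lam x (box n) a t) := by
  have hreg := quenchedJet_regular (N := N) β h lam x n
  have sub : Set.Icc s r ⊆ Set.Icc (0 : ℝ) 1 := Set.Icc_subset_Icc hs hr
  have hcont := (hreg.continuousOn_time 0).mono sub
  have hi : ∀ a ∈ Finset.Icc 0 x.K, IntervalIntegrable (fun t => (x.m (a + 1) - x.m a) *
      meanFluct (N := N) β h lam x (box n) a t) volume s r := fun a ha =>
    (intervalIntegrable_meanFluct_box n hs hr hsr (Finset.mem_Icc.1 ha).2).const_mul _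
  have hi' : IntervalIntegrable (fun t => β ^ 2 / 4 * ∑ a ∈ Finset.Icc 0 x.K,
      (x.m (a + 1) - x.m a) * meanFluct (N := N) β h lam x (box n) a t) volume s r := by
    refine IntervalIntegrable.const_mul ?_ _
    have := IntervalIntegrable.sum (Finset.Icc 0 x.K) hi
    simpa only [Finset.sum_fn] using this
  have key := intervalIntegral.integral_eq_sub_of_hasDerivAt_of_le hsr hcont
    (f' := fun t => N * (squareTerm β x - β ^ 2 / 4 * ∑ a ∈ Finset.Icc 0 x.K,
      (x.m (a + 1) - x.m a) * meanFluct (N := N) β h lam x (box n) a t)) (fun t ht => by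
        have h1 : t ∈ Set.Ioo (0 : ℝ) 1 := ⟨hs.trans_lt ht.1, ht.2.trans_le hr⟩
        have := hreg.hasDerivAt_time h1 0
        rwa [quenchedJet_Ut β h lam x hN n h1] at this)
    ((intervalIntegrable_const.sub hi').const_mul _)
  rw [quenchedJet_U β h lam x n (sub ⟨hsr, le_rfl⟩), quenchedJet_U β h lam x n (sub ⟨le_rfl, hsr⟩)]
    at key
  rw [meanLog, meanLog, ← key, intervalIntegral.integral_const_mul,
    intervalIntegral.integral_sub intervalIntegrable_const hi',
    intervalIntegral.integral_const_mul, intervalIntegral.integral_finsetSum hi]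
  simp only [intervalIntegral.integral_const_mul, intervalIntegral.integral_const, smul_eq_mul]

lemma meanLog_univ_sub (hβ : β ≠ 0) (hN : 1 ≤ N) (hx : 0 < 1 - lam + β ^ 2 * x.gap) {s : ℝ}
    (hs : 0 < s) (hs1 : s ≤ 1) :
    meanLog (N := N) β h lam x Set.univ 1 - meanLog (N := N) β h lam x Set.univ s =
      N * ((1 - s) * squareTerm β x - β ^ 2 / 4 * ∑ a ∈ Finset.Icc 0 x.K,
        (x.m (a + 1) - x.m a) * ∫ t in s..1, meanFluct (N := N) β h lam x Set.univ a t) := by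
  have h1 := (tendsto_meanLog (N := N) (h := h) hβ hN hx (t := 1) (by simp)).sub
    (tendsto_meanLog (N := N) (h := h) hβ hN hx (t := s) ⟨hs.le, hs1⟩)
  simp only [meanLog_box_sub hN _ hs.le le_rfl hs1] at h1
  refine tendsto_nhds_unique h1 ?_
  refine (tendsto_const_nhds.sub ((tendsto_finsetSum _ fun a ha => ?_).const_mul _)).const_mul _
  refine Tendsto.const_mul _ ?_
  have ha' := (Finset.mem_Icc.1 ha).2
  obtain ⟨C, hC⟩ := exists_meanFluct_le (N := N) (h := h) (lam := lam) hβ hN hs ha'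
  have hu : Set.uIoc s 1 = Set.Ioc s 1 := Set.uIoc_of_le hs1
  refine intervalIntegral.tendsto_integral_filter_of_dominated_convergence (fun _ => C)
    (Eventually.of_forall fun n => (measurable_meanFluct β h lam x _ a).aestronglyMeasurable)
    (Eventually.of_forall fun n => ae_of_all _ fun t ht => ?_) intervalIntegrable_const
    (ae_of_all _ fun t ht => ?_)
  · rw [hu] at ht
    exact hC (cutBox n) t ⟨ht.1.le, ht.2⟩
  · rw [hu] at ht
    exact tendsto_meanFluct hβ hN ⟨hs.trans ht.1, ht.2⟩ ha'

lemma OrderParameter.sub_nonneg (x : OrderParameter) {a : ℕ} (ha : a ∈ Finset.Icc 0 x.K) :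
    0 ≤ x.m (a + 1) - x.m a := _root_.sub_nonneg.2 (x.m_mono a (Finset.mem_Icc.1 ha).2)

lemma meanLog_univ_le (hβ : β ≠ 0) (hN : 1 ≤ N) (hx : 0 < 1 - lam + β ^ 2 * x.gap) {s : ℝ}
    (hs : s ∈ Set.Icc (0 : ℝ) 1) :
    meanLog (N := N) β h lam x Set.univ s ≤
      meanLog (N := N) β h lam x Set.univ 0 + N * (s * squareTerm β x) := by
  refine le_of_tendsto_of_tendsto' (tendsto_meanLog hβ hN hx hs)
    ((tendsto_meanLog hβ hN hx (t := 0) (by simp)).add_const _) fun n => ?_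
  have h1 := meanLog_box_sub (β := β) (h := h) (lam := lam) (x := x) hN n le_rfl hs.2 hs.1
  have h2 : 0 ≤ β ^ 2 / 4 * ∑ a ∈ Finset.Icc 0 x.K,
        (x.m (a + 1) - x.m a) * ∫ t in (0 : ℝ)..s, meanFluct (N := N) β h lam x (box n) a t := by
    refine mul_nonneg (by positivity) (Finset.sum_nonneg fun a ha => mul_nonneg (x.sub_nonneg ha) ?_)
    exact intervalIntegral.integral_nonneg hs.1 fun t ht =>
      meanFluct_box_nonneg n ⟨ht.1, ht.2.trans hs.2⟩ (Finset.mem_Icc.1 ha).2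
  have h3 := mul_nonneg (Nat.cast_nonneg (α := ℝ) N) h2
  rw [sub_zero, mul_sub] at h1
  linarith

lemma tendsto_meanLog_zero (hβ : β ≠ 0) (hN : 1 ≤ N) (hx : 0 < 1 - lam + β ^ 2 * x.gap) :
    Tendsto (meanLog (N := N) β h lam x Set.univ) (𝓝[>] 0)
      (𝓝 (meanLog (N := N) β h lam x Set.univ 0)) := by
  set Φ := meanLog (N := N) β h lam x Set.univ
  have hev : ∀ᶠ s in 𝓝[>] (0 : ℝ), s ∈ Set.Icc (0 : ℝ) 1 := by
    filter_upwards [Ioo_mem_nhdsGT (zero_lt_one' ℝ)] with s hs using Set.Ioo_subset_Icc_self hs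
  rw [tendsto_order]
  constructor
  · intro b hb
    have h1 := (tendsto_meanLog (N := N) (h := h) hβ hN hx (t := 0) (by simp)).eventually
      (lt_mem_nhds hb)
    obtain ⟨n, hn⟩ := h1.exists
    have hc : ContinuousWithinAt (meanLog (N := N) β h lam x (box n)) (Set.Icc 0 1) 0 := by
      have := (quenchedJet_regular (N := N) β h lam x n).continuousOn_time 0 0 (by simp)
      exact this.congr (fun s hs => (quenchedJet_U β h lam x n hs).symm)
        (quenchedJet_U β h lam x n (by simp)).symm
    have h2 := hc.eventually (lt_mem_nhds hn)
    have h3 : ∀ᶠ s in 𝓝[>] (0 : ℝ), b < meanLog (N := N) β h lam x (box n) s := by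
      have e : 𝓝[>] (0 : ℝ) ≤ 𝓝[Set.Icc 0 1] 0 := by
        rw [← nhdsWithin_Ioo_eq_nhdsGT (zero_lt_one' ℝ)]
        exact nhdsWithin_mono _ Set.Ioo_subset_Icc_self
      exact e h2
    filter_upwards [h3, hev] with s hs hs'
    exact hs.trans_le (meanLog_box_le hβ hN hx hs' n)
  · intro b hb
    have h1 : Tendsto (fun s : ℝ => Φ 0 + N * (s * squareTerm β x)) (𝓝[>] 0) (𝓝 (Φ 0)) := by
      have : Continuous (fun s : ℝ => Φ 0 + N * (s * squareTerm β x)) := by fun_prop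
      have := this.tendsto 0
      simp only [zero_mul, mul_zero, add_zero] at this
      exact this.mono_left nhdsWithin_le_nhds
    filter_upwards [h1.eventually (gt_mem_nhds hb), hev] with s hs hs'
    exact (meanLog_univ_le hβ hN hx hs').trans_lt hs

lemma intervalIntegrable_meanFluct (hβ : β ≠ 0) (hN : 1 ≤ N)
    (hx : 0 < 1 - lam + β ^ 2 * x.gap) {a : ℕ} (ha : a ∈ Finset.Icc 0 x.K)
    (hm : x.m a < x.m (a + 1)) :
    IntervalIntegrable (meanFluct (N := N) β h lam x Set.univ a) volume 0 1 := by
  have hN0 : (0 : ℝ) < N := by exact_mod_cast hN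
  have ha' := (Finset.mem_Icc.1 ha).2
  rw [intervalIntegrable_iff_integrableOn_Ioc_of_le zero_le_one]
  set Φ := meanLog (N := N) β h lam x Set.univ with hΦ
  have hlim : Tendsto (fun n : ℕ => 1 / ((n : ℝ) + 1)) atTop (𝓝 0) :=
    tendsto_one_div_add_atTop_nhds_zero_nat
  have hpos : ∀ n : ℕ, (0 : ℝ) < 1 / ((n : ℝ) + 1) := fun n => by positivity
  have hle : ∀ n : ℕ, 1 / ((n : ℝ) + 1) ≤ 1 := fun n => by
    rw [div_le_one (by positivity)]; linarith [Nat.cast_nonneg (α := ℝ) n]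
  have hi : ∀ n : ℕ, IntervalIntegrable (meanFluct (N := N) β h lam x Set.univ a) volume
      (1 / ((n : ℝ) + 1)) 1 := fun n => by
    obtain ⟨C, hC⟩ := exists_meanFluct_le (N := N) (h := h) (lam := lam) hβ hN (hpos n) ha'
    exact intervalIntegrable_of_bound (measurable_meanFluct β h lam x _ a) (hC cutUniv) (hle n)
  have hlim2 : Tendsto (fun n : ℕ => Φ (1 / ((n : ℝ) + 1))) atTop (𝓝 (Φ 0)) :=
    (tendsto_meanLog_zero (N := N) (h := h) hβ hN hx).comp
      (tendsto_nhdsWithin_iff.2 ⟨hlim, Eventually.of_forall hpos⟩)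
  obtain ⟨B, hB⟩ := hlim2.bddAbove_range
  have hsq : 0 ≤ squareTerm β x := by
    refine mul_nonneg (by positivity) (Finset.sum_nonneg fun b hb => mul_nonneg ?_ (sq_nonneg _))
    exact x.sub_nonneg (Finset.mem_Icc.2 ⟨Nat.zero_le _, (Finset.mem_Icc.1 hb).2⟩)
  refine integrableOn_Ioc_of_intervalIntegral_norm_bounded_left
    (I := 4 / (β ^ 2 * (x.m (a + 1) - x.m a)) * (squareTerm β x + (B - Φ 1) / N))
    (a := fun n : ℕ => 1 / ((n : ℝ) + 1)) (l := atTop) (fun n => ?_) hlim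
    (Eventually.of_forall fun n => ?_)
  · exact (intervalIntegrable_iff_integrableOn_Ioc_of_le (hle n)).1 (hi n)
  · have e := meanLog_univ_sub (N := N) (h := h) hβ hN hx (hpos n) (hle n)
    have hb : Φ (1 / ((n : ℝ) + 1)) ≤ B := hB ⟨n, rfl⟩
    have hnn : ∀ b ∈ Finset.Icc 0 x.K,
        0 ≤ ∫ t in (1 / ((n : ℝ) + 1))..1, meanFluct (N := N) β h lam x Set.univ b t := fun b hb =>
      intervalIntegral.integral_nonneg (hle n) fun t ht => meanFluct_univ_nonneg hβ hN
        ⟨(hpos n).trans_le ht.1, ht.2⟩ (Finset.mem_Icc.1 hb).2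
    have hsing := Finset.single_le_sum (f := fun b => (x.m (b + 1) - x.m b) *
      ∫ t in (1 / ((n : ℝ) + 1))..1, meanFluct (N := N) β h lam x Set.univ b t)
      (fun b hb => mul_nonneg (x.sub_nonneg hb) (hnn b hb)) ha
    have e4 : ∫ t in (1 / ((n : ℝ) + 1))..1, ‖meanFluct (N := N) β h lam x Set.univ a t‖ =
        ∫ t in (1 / ((n : ℝ) + 1))..1, meanFluct (N := N) β h lam x Set.univ a t := by
      refine intervalIntegral.integral_congr fun t ht => ?_
      rw [Set.uIcc_of_le (hle n)] at ht
      exact Real.norm_of_nonneg (meanFluct_univ_nonneg hβ hN ⟨(hpos n).trans_le ht.1, ht.2⟩ ha')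
    rw [← intervalIntegral.integral_of_le (hle n), e4]
    generalize (∫ t in (1 / ((n : ℝ) + 1))..1, meanFluct (N := N) β h lam x Set.univ a t) = I
      at hsing
    generalize (∑ b ∈ Finset.Icc 0 x.K, (x.m (b + 1) - x.m b) *
      ∫ t in (1 / ((n : ℝ) + 1))..1, meanFluct (N := N) β h lam x Set.univ b t) = T at hsing e
    have hd : 0 < x.m (a + 1) - x.m a := sub_pos.2 hm
    have hb2 : 0 < β ^ 2 := by positivity
    have e6 : β ^ 2 / 4 * T ≤ squareTerm β x + (B - Φ 1) / N := by
      have h1 : (1 - 1 / ((n : ℝ) + 1)) * squareTerm β x ≤ squareTerm β x := by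
        nlinarith [mul_nonneg (hpos n).le hsq]
      have h2 : (Φ 1 - Φ (1 / ((n : ℝ) + 1))) / N =
          (1 - 1 / ((n : ℝ) + 1)) * squareTerm β x - β ^ 2 / 4 * T := by
        rw [e]; field_simp
      have h3 : (Φ 1 - B) / N ≤ (Φ 1 - Φ (1 / ((n : ℝ) + 1))) / N := by gcongr
      have h4 : (Φ 1 - B) / N = -((B - Φ 1) / N) := by ring
      linarith
    have e7 : β ^ 2 / 4 * ((x.m (a + 1) - x.m a) * I) ≤ squareTerm β x + (B - Φ 1) / N :=
      (mul_le_mul_of_nonneg_left hsing (by positivity)).trans e6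
    calc I = 4 / (β ^ 2 * (x.m (a + 1) - x.m a)) *
          (β ^ 2 / 4 * ((x.m (a + 1) - x.m a) * I)) := by field_simp
      _ ≤ _ := mul_le_mul_of_nonneg_left e7 (by positivity)

lemma meanLog_sum_rule (hβ : β ≠ 0) (hN : 1 ≤ N) (hx : 0 < 1 - lam + β ^ 2 * x.gap) :
    meanLog (N := N) β h lam x Set.univ 1 - meanLog (N := N) β h lam x Set.univ 0 =
      N * (squareTerm β x - β ^ 2 / 4 * ∑ a ∈ Finset.Icc 0 x.K,
        (x.m (a + 1) - x.m a) * ∫ t in (0 : ℝ)..1, meanFluct (N := N) β h lam x Set.univ a t) := by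
  have hlim : Tendsto (fun n : ℕ => 1 / ((n : ℝ) + 1)) atTop (𝓝 0) :=
    tendsto_one_div_add_atTop_nhds_zero_nat
  have hpos : ∀ n : ℕ, (0 : ℝ) < 1 / ((n : ℝ) + 1) := fun n => by positivity
  have hle : ∀ n : ℕ, 1 / ((n : ℝ) + 1) ≤ 1 := fun n => by
    rw [div_le_one (by positivity)]; linarith [Nat.cast_nonneg (α := ℝ) n]
  have hlim2 : Tendsto (fun n : ℕ => meanLog (N := N) β h lam x Set.univ 1 -
      meanLog (N := N) β h lam x Set.univ (1 / ((n : ℝ) + 1))) atTop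
      (𝓝 (meanLog (N := N) β h lam x Set.univ 1 - meanLog (N := N) β h lam x Set.univ 0)) :=
    tendsto_const_nhds.sub ((tendsto_meanLog_zero (N := N) (h := h) hβ hN hx).comp
      (tendsto_nhdsWithin_iff.2 ⟨hlim, Eventually.of_forall hpos⟩))
  refine tendsto_nhds_unique hlim2 ?_
  simp only [meanLog_univ_sub hβ hN hx (hpos _) (hle _)]
  refine Tendsto.const_mul _ (Tendsto.sub ?_ (Tendsto.const_mul _
    (tendsto_finsetSum _ fun a ha => ?_)))
  · have := ((tendsto_const_nhds (x := (1 : ℝ))).sub hlim).mul_const (squareTerm β x)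
    simpa using this
  · rcases (x.m_mono a (Finset.mem_Icc.1 ha).2).eq_or_lt with he | hm
    · simp [he]
    · refine Tendsto.const_mul _ ?_
      have hi := intervalIntegrable_meanFluct (N := N) (h := h) hβ hN hx ha hm
      have hc := intervalIntegral.continuousOn_primitive_interval_left
        (f := meanFluct (N := N) β h lam x Set.univ a) (μ := volume) (a := 0) (b := 1)
        (by rw [Set.uIcc_of_le zero_le_one]
            exact (intervalIntegrable_iff_integrableOn_Icc_of_le zero_le_one).1 hi)
      have := hc 0 (by simp)
      refine this.tendsto.comp (tendsto_nhdsWithin_iff.2 ⟨hlim, Eventually.of_forall fun n => ?_⟩)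
      rw [Set.uIcc_of_le zero_le_one]
      exact ⟨(hpos n).le, hle n⟩

end Model

end GaussianSpinGlass
end

noncomputable section

namespace GaussianSpinGlass

variable {N : ℕ} {β h lam : ℝ} {x : OrderParameter}

lemma interpZ_one (J : Couplings N) (g : Fields N) :
    interpZ β h lam x 1 J g = partitionFunction β h lam J := by
  unfold interpZ partitionFunction boltzmann hamiltonian
  congr 1
  ext z
  congr 1
  rw [Real.sqrt_div zero_le_one, Real.sqrt_one]
  simp only [sub_self, Real.sqrt_zero, mul_zero, zero_mul]
  ring

lemma cutLog_one (J : Couplings N) {a : ℕ} (ha : a ≤ x.K) : ∀ g : Fields N,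
    cutLog β h lam x Set.univ 1 J a g = Real.log (partitionFunction β h lam J) := by
  induction ha using Nat.decreasingInduction with
  | self => intro g; rw [cutLog_last, cutZ_univ, interpZ_one]
  | of_succ a ha ih =>
    intro g
    rw [cutLog_of_lt _ _ _ _ _ _ _ ha]
    simp only [ih]
    exact lme_const _ _

lemma boltzmann_zero_beta (t : ℝ) (J : Couplings N) :
    boltzmann 0 h lam x t J = boltzmann 0 h lam x 0 J := by
  ext g z
  simp [boltzmann]

lemma levelZ_zero_beta (t : ℝ) (J : Couplings N) (a : ℕ) :
    levelZ 0 h lam x t J a = levelZ 0 h lam x 0 J a := by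
  have key : ∀ n a, levelZAux 0 h lam x t J a n = levelZAux 0 h lam x 0 J a n := by
    intro n
    induction n with
    | zero =>
      intro a
      ext g
      simp only [levelZAux, interpZ, boltzmann_zero_beta t]
    | succ n ih => intro a; simp only [levelZAux, ih (a + 1)]
  exact key _ a

lemma fluctuation_zero_beta (a : ℕ) (t : ℝ) :
    fluctuation 0 h lam x N a t = fluctuation 0 h lam x N a 0 := by
  simp only [fluctuation, bracket, replicaState, levelState, weight, state, interpZ,
    levelZ_zero_beta t, boltzmann_zero_beta t]

lemma cutLog_zero_beta (S : Set (Spins N)) (t : ℝ) (J : Couplings N) :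
    cutLog 0 h lam x S t J = cutLog 0 h lam x S 0 J := by
  ext a g
  simp only [cutLog, cutZ, boltzmann_zero_beta t]

lemma wellPosed_univ_of_mem (hN : 1 ≤ N) (hx : 0 < 1 - lam + β ^ 2 * x.gap) {t : ℝ}
    (ht : t ∈ Set.Icc (0 : ℝ) 1) :
    (∀ J : Couplings N, WellPosed β h lam x Set.univ t J) ∧
    (∀ (J : Couplings N) g, Integrable (boltzmann β h lam x t J g) (spinMeasure N)) ∧
    Integrable (fun J : Couplings N => cutLog β h lam x Set.univ t J 0 0) (couplingMeasure N) := by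
  by_cases hβ : β = 0
  · subst hβ
    refine ⟨fun J => ⟨fun g => ?_, fun a ha g => ?_, fun a ha g => ?_⟩, fun J g => ?_, ?_⟩
    · have := (wellPosed_zero (h := h) hx J).pos g
      simpa only [cutZ, boltzmann_zero_beta t] using this
    · rw [cutLog_zero_beta]
      exact (wellPosed_zero (h := h) hx J).int_exp a ha g
    · rw [cutLog_zero_beta]
      exact (wellPosed_zero (h := h) hx J).int_log a ha g
    · rw [boltzmann_zero_beta]
      exact integrable_boltzmann_zero hx J g
    · simp only [cutLog_zero_beta _ t]
      exact integrable_cutLog_zero hx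
  · exact wellPosed_of_mem hβ hN hx ht

lemma log_levelZ_zero (hN : 1 ≤ N) (hx : 0 < 1 - lam + β ^ 2 * x.gap) {t : ℝ}
    (ht : t ∈ Set.Icc (0 : ℝ) 1) (J : Couplings N) :
    Real.log (levelZ β h lam x t J 0 0) = cutLog β h lam x Set.univ t J 0 0 := by
  rw [((wellPosed_univ_of_mem hN hx ht).1 J).levelZ_eq (Nat.zero_le _), Real.log_exp]

lemma phi_eq (hN : 1 ≤ N) (hx : 0 < 1 - lam + β ^ 2 * x.gap) {t : ℝ}
    (ht : t ∈ Set.Icc (0 : ℝ) 1) :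
    phi β h lam x N t = 1 / (N : ℝ) * meanLog (N := N) β h lam x Set.univ t := by
  simp only [phi, log_levelZ_zero hN hx ht, meanLog]

lemma pressure_eq :
    pressure β h lam N = 1 / (N : ℝ) * meanLog (N := N) β h lam x Set.univ 1 := by
  simp only [pressure, meanLog, cutLog_one _ (Nat.zero_le _)]

lemma intervalIntegral_fluctuation (hβ : β ≠ 0) (hN : 1 ≤ N) {a : ℕ} (ha : a ≤ x.K) :
    ∫ t in (0 : ℝ)..1, fluctuation β h lam x N a t =
      ∫ t in (0 : ℝ)..1, meanFluct (N := N) β h lam x Set.univ a t := by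
  rw [intervalIntegral.integral_of_le zero_le_one, intervalIntegral.integral_of_le zero_le_one]
  exact setIntegral_congr_fun measurableSet_Ioc fun t ht => fluctuation_eq hβ hN ht ha

lemma integralsConverge (hN : 1 ≤ N) (hx : 0 < 1 - lam + β ^ 2 * x.gap) :
    IntegralsConverge β h lam x N := by
  refine ⟨?_, fun t ht J g => ?_, fun t ht => ?_, fun a ha hm => ?_⟩
  · have := (wellPosed_univ_of_mem (N := N) (h := h) hN hx (t := 1) (by simp)).2.2
    simpa only [cutLog_one _ (Nat.zero_le _)] using this
  · obtain ⟨H, hI, -⟩ := wellPosed_univ_of_mem (N := N) (h := h) hN hx ht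
    refine ⟨hI J g, fun a ha => ?_⟩
    obtain ⟨h1, h2⟩ := Finset.mem_Icc.1 ha
    obtain ⟨b, rfl⟩ : ∃ b, a = b + 1 := ⟨a - 1, by omega⟩
    simp only [(H J).levelZ_eq h2, Real.log_exp, ← Real.exp_mul, mul_comm _ (x.m (b + 1))]
    exact ⟨(H J).int_exp b h2 g, (H J).int_log b h2 g⟩
  · simp only [log_levelZ_zero hN hx ht]
    exact (wellPosed_univ_of_mem hN hx ht).2.2
  · by_cases hβ : β = 0
    · subst hβ
      rw [show fluctuation 0 h lam x N a = fun _ => fluctuation 0 h lam x N a 0 from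
        funext fun t => fluctuation_zero_beta a t]
      exact intervalIntegrable_const
    · have := intervalIntegrable_meanFluct (N := N) (h := h) hβ hN hx ha hm
      rw [intervalIntegrable_iff_integrableOn_Ioc_of_le zero_le_one] at this ⊢
      exact this.congr_fun (fun t ht => (fluctuation_eq hβ hN ht (Finset.mem_Icc.1 ha).2).symm)
        measurableSet_Ioc

lemma pressure_sum_rule (hN : 1 ≤ N) (hx : 0 < 1 - lam + β ^ 2 * x.gap) :
    pressure β h lam N = phi β h lam x N 0 + squareTerm β x - errorTerm β h lam x N := by
  have hN0 : (N : ℝ) ≠ 0 := by positivity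
  rw [pressure_eq (x := x), phi_eq hN hx (by simp)]
  by_cases hβ : β = 0
  · subst hβ
    simp [meanLog, cutLog_zero_beta _ 1, squareTerm, errorTerm]
  · have key := meanLog_sum_rule (N := N) (h := h) hβ hN hx
    have e : errorTerm β h lam x N = β ^ 2 / 4 * ∑ a ∈ Finset.Icc 0 x.K,
        (x.m (a + 1) - x.m a) * ∫ t in (0 : ℝ)..1, meanFluct (N := N) β h lam x Set.univ a t := by
      rw [errorTerm]
      congr 1
      refine Finset.sum_congr rfl fun a ha => ?_
      rw [intervalIntegral_fluctuation hβ hN (Finset.mem_Icc.1 ha).2]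
    rw [← e] at key
    rw [eq_add_of_sub_eq key]
    field_simp
    ring

lemma errorTerm_nonneg (hN : 1 ≤ N) : 0 ≤ errorTerm β h lam x N := by
  by_cases hβ : β = 0
  · subst hβ
    simp [errorTerm]
  · refine mul_nonneg (by positivity) (Finset.sum_nonneg fun a ha => mul_nonneg (x.sub_nonneg ha) ?_)
    have ha' := (Finset.mem_Icc.1 ha).2
    rw [intervalIntegral_fluctuation hβ hN ha', intervalIntegral.integral_of_le zero_le_one]
    exact setIntegral_nonneg measurableSet_Ioc fun t ht => meanFluct_univ_nonneg hβ hN ht ha'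

lemma exists_phi_zero (hx : 0 < 1 - lam + β ^ 2 * x.gap) :
    ∃ φ₀, ∀ N : ℕ, 1 ≤ N → phi β h lam x N 0 = φ₀ := by
  obtain ⟨φ₀, h0⟩ := exists_cutLog_zero_time (h := h) hx
  refine ⟨φ₀, fun N hN => ?_⟩
  have hN0 : (N : ℝ) ≠ 0 := by positivity
  rw [phi_eq hN hx (by simp), meanLog]
  simp only [h0]
  simp
  field_simp

lemma pressure_le (hx : 0 < 1 - lam + β ^ 2 * x.gap) (hN : 1 ≤ N) :
    pressure β h lam N ≤ phi β h lam x N 0 + squareTerm β x := by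
  rw [pressure_sum_rule (x := x) hN hx]
  linarith [errorTerm_nonneg (β := β) (h := h) (lam := lam) (x := x) hN]

end GaussianSpinGlass
end

noncomputable section

namespace GaussianSpinGlass

/-! ### Comparison of quenched free energies -/

section Comparison
variable {ι : Type*} [Fintype ι] [DecidableEq ι] {Z : Type*} [MeasurableSpace Z] {ν : Measure Z}
  {w : ι → Z → ℝ} {a b : Z → ℝ} {R : ℝ} [IsFiniteMeasure ν] [NeZero ν]

lemma BoundedModel.sum_sq_gibbs_nonpos (H : BoundedModel ν w a b R) {d : ι → ℝ}
    (hd : ∀ z z', ∑ i, d i * (w i z * w i z') ≤ 0) (t : ℝ) (x : ι → ℝ) :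
    ∑ i, d i * (freeEnergyJet ν w a b).Ui i t x ^ 2 ≤ 0 := by
  set v := energy w a b t x
  have e : ∀ i, (freeEnergyJet ν w a b).Ui i t x = tmean ν 1 v (w i) := fun i => by
    simp [freeEnergyJet, Jet.logJet, partitionJet, tmean, v]
  have hi : ∀ (c : ι → ℝ), ∀ i ∈ Finset.univ,
      Integrable (fun z => Real.exp (1 * v z) * (c i * w i z)) ν := by
    intro c i _
    have := (H.integrable t x (H.meas_w i) (H.bd_w.mono fun z hz => hz i)).const_mul (c i)
    refine this.congr (ae_of_all _ fun z => ?_)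
    simp only [one_mul, v]
    ring
  have key : ∑ i, d i * tmean ν 1 v (w i) ^ 2 =
      tmean ν 1 v (fun z => tmean ν 1 v (fun z' => ∑ i, (d i * w i z) * w i z')) := by
    have e1 : ∀ z, tmean ν 1 v (fun z' => ∑ i, (d i * w i z) * w i z') =
        ∑ i, (d i * tmean ν 1 v (w i)) * w i z := by
      intro z
      rw [tmean_sum _ (hi fun i => d i * w i z)]
      simp only [tmean_const_mul]
      exact Finset.sum_congr rfl fun i _ => by ring
    simp only [e1]
    rw [tmean_sum _ (hi fun i => d i * tmean ν 1 v (w i))]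
    simp only [tmean_const_mul]
    exact Finset.sum_congr rfl fun i _ => by ring
  simp only [e]
  rw [key]
  have hneg : ∀ {X : Z → ℝ}, (∀ z, X z ≤ 0) → tmean ν 1 v X ≤ 0 := fun {X} hX => by
    have := tmean_nonneg (μ := ν) (m := 1) (v := v) (X := fun z => -1 * X z)
      fun z => by linarith [hX z]
    rw [tmean_const_mul] at this
    linarith
  refine hneg fun z => hneg fun z' => ?_
  simpa only [mul_assoc] using hd z z'

lemma BoundedModel.quenched_mono (H : BoundedModel ν w a b R) {α d : ι → ℝ}
    (hα : NoiseProfile α d) (hb : ∀ z, b z = -(1 / 2) * ∑ i, d i * w i z ^ 2)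
    (hd : ∀ z z', ∑ i, d i * (w i z * w i z') ≤ 0) :
    ∫ ξ, Real.log (∫ z, Real.exp (energy w a b 0 (shift α d 0 0 ξ) z) ∂ν) ∂(gaussPi ι) ≤
      ∫ ξ, Real.log (∫ z, Real.exp (energy w a b 1 (shift α d 1 0 ξ) z) ∂ν) ∂(gaussPi ι) := by
  set j := (freeEnergyJet ν w a b).step 0 α d
  have hr := H.freeEnergy_regular
  obtain ⟨C, hC⟩ := H.freeEnergy_linBound
  have hj : j.Regular := hr.step hC 0 hα
  have hU : ∀ t, j.U t 0 =
      ∫ ξ, Real.log (∫ z, Real.exp (energy w a b t (shift α d t 0 ξ) z) ∂ν) ∂(gaussPi ι) := by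
    intro t
    simp [j, Jet.step, lme_zero, freeEnergyJet, Jet.logJet, partitionJet]
  rw [← hU, ← hU]
  have hmono : MonotoneOn (fun t => j.U t 0) (Set.Icc 0 1) := by
    refine monotoneOn_of_deriv_nonneg (convex_Icc 0 1) (hj.continuousOn_time 0)
      (fun t ht => ?_) fun t ht => ?_
    · rw [interior_Icc] at ht
      exact (hj.hasDerivAt_time ht 0).differentiableAt.differentiableWithinAt
    · rw [interior_Icc] at ht
      rw [(hj.hasDerivAt_time ht 0).deriv]
      have key := Jet.step_heat hr hC le_rfl α d d ht 0
      simp only [sub_self, zero_mul, Finset.sum_const_zero, mul_zero, add_zero, zero_div,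
        sub_zero] at key
      rw [key]
      refine tmean_nonneg fun ξ => ?_
      beta_reduce
      rw [H.freeEnergy_heat hb]
      have := H.sum_sq_gibbs_nonpos hd t (shift α d t 0 ξ)
      linarith
  exact hmono (by simp) (by simp) zero_le_one

end Comparison

/-! ### Superadditivity of the pressure -/

section Superadditivity
variable {N₁ N₂ : ℕ}

/-- The first `N₁` spins. -/
def leftSpins (z : Spins (N₁ + N₂)) : Spins N₁ := fun i => z (Fin.castAdd N₂ i)

/-- The last `N₂` spins. -/
def rightSpins (z : Spins (N₁ + N₂)) : Spins N₂ := fun i => z (Fin.natAdd N₁ i)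

lemma measurePreserving_split :
    MeasurePreserving (fun z : Spins (N₁ + N₂) => (leftSpins z, rightSpins z))
      (spinMeasure (N₁ + N₂)) ((spinMeasure N₁).prod (spinMeasure N₂)) := by
  have h1 := measurePreserving_comp_injective (ι := Fin (N₁ + N₂))
    (f := fun k : Fin N₁ ⊕ Fin N₂ => finSumFinEquiv k) finSumFinEquiv.injective
  have h2 := measurePreserving_sumPiEquivProdPi
    (fun _ : Fin N₁ ⊕ Fin N₂ => gaussianReal 0 1)
  exact h2.comp h1

lemma split_mem_box (n : ℕ) (z : Spins (N₁ + N₂)) :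
    z ∈ (box n : Set (Spins (N₁ + N₂))) ↔ leftSpins z ∈ (box n : Set (Spins N₁)) ∧
      rightSpins z ∈ (box n : Set (Spins N₂)) := by
  exact Fin.forall_fin_add (fun i => |z i| ≤ (n : ℝ) + 1)

lemma setIntegral_box_split (n : ℕ) {f₁ : Spins N₁ → ℝ} {f₂ : Spins N₂ → ℝ} (h₁ : Measurable f₁)
    (h₂ : Measurable f₂) :
    ∫ z in box n, f₁ (leftSpins z) * f₂ (rightSpins z) ∂(spinMeasure (N₁ + N₂)) =
      (∫ z in box n, f₁ z ∂(spinMeasure N₁)) * ∫ z in box n, f₂ z ∂(spinMeasure N₂) := by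
  have hs : MeasurableSet ((box n : Set (Spins N₁)) ×ˢ (box n : Set (Spins N₂))) :=
    (measurableSet_box n).prod (measurableSet_box n)
  have h := measurePreserving_split (N₁ := N₁) (N₂ := N₂)
  have hr := h.restrict_preimage hs
  have e : (fun z : Spins (N₁ + N₂) => (leftSpins z, rightSpins z)) ⁻¹'
      ((box n : Set (Spins N₁)) ×ˢ (box n : Set (Spins N₂))) = box n := by
    ext z
    simp only [Set.mem_preimage, Set.mem_prod]
    exact (split_mem_box n z).symm
  rw [e, ← Measure.prod_restrict] at hr
  rw [← integral_prod_mul, ← hr.map_eq, integral_map hr.measurable.aemeasurable]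
  exact ((h₁.comp measurable_fst).mul (h₂.comp measurable_snd)).aestronglyMeasurable

/-- The exponent of the partition function. -/
def fullExpo {N : ℕ} (β h lam : ℝ) (J : Couplings N) (z : Spins N) : ℝ :=
  β / Real.sqrt (2 * N) * (∑ i, ∑ j, J i j * (z i * z j)) - β ^ 2 / (4 * N) * spinSq z ^ 2 +
    β * h * ∑ i, z i + lam / 2 * spinSq z

lemma expo_one {N : ℕ} (β h lam : ℝ) (x : OrderParameter) (J : Couplings N) (g : Fields N)
    (z : Spins N) : expo β h lam x 1 J g z = fullExpo β h lam J z := by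
  unfold expo fullExpo spinSq
  rw [Real.sqrt_div zero_le_one, Real.sqrt_one]
  simp only [sub_self, Real.sqrt_zero, mul_zero, zero_mul, mul_assoc]
  ring

lemma meanLog_box_one {N : ℕ} (β h lam : ℝ) (x : OrderParameter) (n : ℕ) :
    meanLog (N := N) β h lam x (box n) 1 = ∫ J : Couplings N,
      Real.log (∫ z in box n, Real.exp (fullExpo β h lam J z) ∂(spinMeasure N))
        ∂(couplingMeasure N) := by
  have key : ∀ (J : Couplings N), ∀ a ≤ x.K, ∀ g : Fields N, cutLog β h lam x (box n) 1 J a g =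
      Real.log (∫ z in box n, Real.exp (fullExpo β h lam J z) ∂(spinMeasure N)) := by
    intro J a ha
    induction ha using Nat.decreasingInduction with
    | self => intro g; simp only [cutLog_last, cutZ, boltzmann_eq, expo_one]
    | of_succ a ha ih =>
      intro g
      rw [cutLog_of_lt _ _ _ _ _ _ _ ha]
      simp only [ih]
      exact lme_const _ _
  simp only [meanLog, key _ 0 (Nat.zero_le _)]

/-- Index set of the couplings of the whole system and of its two parts. -/
abbrev SplitIndex (N₁ N₂ : ℕ) :=
  (Fin (N₁ + N₂) × Fin (N₁ + N₂)) ⊕ (Fin N₁ × Fin N₁) ⊕ (Fin N₂ × Fin N₂)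

/-- The observables coupled to the noises. -/
def splitObs (β : ℝ) : SplitIndex N₁ N₂ → Spins (N₁ + N₂) → ℝ
  | .inl (i, j) => fun z => β / Real.sqrt (2 * (N₁ + N₂ : ℕ)) * (z i * z j)
  | .inr (.inl (i, j)) => fun z => β / Real.sqrt (2 * N₁) * (leftSpins z i * leftSpins z j)
  | .inr (.inr (i, j)) => fun z => β / Real.sqrt (2 * N₂) * (rightSpins z i * rightSpins z j)

/-- The initial variances: only the two parts are coupled. -/
def splitVar : SplitIndex N₁ N₂ → ℝ
  | .inl _ => 0
  | .inr _ => 1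

/-- The rate of change of the variances. -/
def splitRate : SplitIndex N₁ N₂ → ℝ
  | .inl _ => 1
  | .inr _ => -1

/-- The exponent at `t = 0` without noise. -/
def splitBase (β h lam : ℝ) (z : Spins (N₁ + N₂)) : ℝ :=
  -(β ^ 2 / (4 * N₁)) * spinSq (leftSpins z) ^ 2 - β ^ 2 / (4 * N₂) * spinSq (rightSpins z) ^ 2 +
    β * h * ∑ i, z i + lam / 2 * spinSq z

/-- The coefficient of `t` in the exponent. -/
def splitDrift (β : ℝ) (z : Spins (N₁ + N₂)) : ℝ :=
  -(1 / 2) * ∑ k, splitRate k * splitObs β k z ^ 2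

lemma continuous_splitObs (β : ℝ) (k : SplitIndex N₁ N₂) : Continuous (splitObs β k) := by
  rcases k with ⟨i, j⟩ | ⟨i, j⟩ | ⟨i, j⟩ <;> unfold splitObs leftSpins rightSpins <;> fun_prop

lemma continuous_splitBase (β h lam : ℝ) :
    Continuous (splitBase (N₁ := N₁) (N₂ := N₂) β h lam) := by
  unfold splitBase spinSq leftSpins rightSpins; fun_prop

lemma continuous_splitDrift (β : ℝ) : Continuous (splitDrift (N₁ := N₁) (N₂ := N₂) β) := by
  have := continuous_splitObs (N₁ := N₁) (N₂ := N₂) β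
  unfold splitDrift; fun_prop

lemma sum_splitRate_mul (β : ℝ) (z z' : Spins (N₁ + N₂)) :
    ∑ k, splitRate k * (splitObs β k z * splitObs β k z') =
      β ^ 2 / 2 * ((∑ i, z i * z' i) ^ 2 / (N₁ + N₂ : ℕ)
        - (∑ i, leftSpins z i * leftSpins z' i) ^ 2 / N₁
        - (∑ i, rightSpins z i * rightSpins z' i) ^ 2 / N₂) := by
  have e : ∀ (N : ℕ) (y y' : Spins N), ∑ i, ∑ j, β / Real.sqrt (2 * N) * (y i * y j) *
      (β / Real.sqrt (2 * N) * (y' i * y' j)) = β ^ 2 / (2 * N) * (∑ i, y i * y' i) ^ 2 := by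
    intro N y y'
    rw [sq (∑ i, y i * y' i), Finset.sum_mul_sum, Finset.mul_sum]
    refine Finset.sum_congr rfl fun i _ => ?_
    rw [Finset.mul_sum]
    refine Finset.sum_congr rfl fun j _ => ?_
    have : (β / Real.sqrt (2 * N)) ^ 2 = β ^ 2 / (2 * N) := by
      rw [div_pow, Real.sq_sqrt (by positivity)]
    rw [← this]
    ring
  simp only [Fintype.sum_sum_type, Fintype.sum_prod_type, splitRate, splitObs, one_mul, neg_mul,
    Finset.sum_neg_distrib, e]
  ring

lemma splitDrift_eq (β : ℝ) (z : Spins (N₁ + N₂)) :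
    splitDrift β z = -(β ^ 2 / (4 * (N₁ + N₂ : ℕ))) * spinSq z ^ 2 +
      β ^ 2 / (4 * N₁) * spinSq (leftSpins z) ^ 2 +
      β ^ 2 / (4 * N₂) * spinSq (rightSpins z) ^ 2 := by
  have := sum_splitRate_mul β z z
  simp only [← sq] at this
  rw [splitDrift, this]
  simp only [spinSq]
  ring

lemma sum_splitRate_nonpos (h₁ : 1 ≤ N₁) (h₂ : 1 ≤ N₂) (β : ℝ) (z z' : Spins (N₁ + N₂)) :
    ∑ k, splitRate k * (splitObs β k z * splitObs β k z') ≤ 0 := by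
  have e : ∑ i, z i * z' i = ∑ i, leftSpins z i * leftSpins z' i +
      ∑ i, rightSpins z i * rightSpins z' i := Fin.sum_univ_add _
  have p₁ : (0 : ℝ) < N₁ := by exact_mod_cast h₁
  have p₂ : (0 : ℝ) < N₂ := by exact_mod_cast h₂
  rw [sum_splitRate_mul, e]
  generalize ∑ i, leftSpins z i * leftSpins z' i = p
  generalize ∑ i, rightSpins z i * rightSpins z' i = q
  refine mul_nonpos_of_nonneg_of_nonpos (by positivity) ?_
  push_cast
  have : (p + q) ^ 2 / ((N₁ : ℝ) + N₂) - p ^ 2 / N₁ - q ^ 2 / N₂ =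
      -((N₂ * p - N₁ * q) ^ 2 / (N₁ * N₂ * (N₁ + N₂))) := by
    field_simp
    ring
  rw [this]
  have : 0 ≤ (N₂ * p - N₁ * q) ^ 2 / (N₁ * N₂ * ((N₁ : ℝ) + N₂)) := by positivity
  linarith

lemma noiseProfile_split : NoiseProfile (splitVar : SplitIndex N₁ N₂ → ℝ) splitRate := by
  refine ⟨fun k => ?_, fun k => ?_⟩ <;> rcases k with k | k <;> simp [splitVar, splitRate]

lemma energy_split_one (β h lam : ℝ) (ξ : SplitIndex N₁ N₂ → ℝ) (z : Spins (N₁ + N₂)) :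
    energy (splitObs β) (splitBase β h lam) (splitDrift β) 1 (shift splitVar splitRate 1 0 ξ) z =
      fullExpo β h lam (fun i j => ξ (.inl (i, j))) z := by
  rw [energy, splitDrift_eq, fullExpo, splitBase]
  simp only [Fintype.sum_sum_type, Fintype.sum_prod_type, shift, splitVar, splitRate, splitObs,
    Finset.mul_sum]
  simp
  have e : ∀ i j : Fin (N₁ + N₂), ξ (.inl (i, j)) *
      (β / (Real.sqrt 2 * Real.sqrt (N₁ + N₂)) * (z i * z j)) =
      β / (Real.sqrt 2 * Real.sqrt (N₁ + N₂)) * (ξ (.inl (i, j)) * (z i * z j)) := by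
    intro i j; ring
  simp only [e]
  ring

lemma energy_split_zero (β h lam : ℝ) (ξ : SplitIndex N₁ N₂ → ℝ) (z : Spins (N₁ + N₂)) :
    energy (splitObs β) (splitBase β h lam) (splitDrift β) 0 (shift splitVar splitRate 0 0 ξ) z =
      fullExpo β h lam (fun i j => ξ (.inr (.inl (i, j)))) (leftSpins z) +
      fullExpo β h lam (fun i j => ξ (.inr (.inr (i, j)))) (rightSpins z) := by
  have e1 : ∑ i, z i = ∑ i, leftSpins z i + ∑ i, rightSpins z i := Fin.sum_univ_add _
  have e2 : spinSq z = spinSq (leftSpins z) + spinSq (rightSpins z) :=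
    Fin.sum_univ_add (fun i => z i ^ 2)
  have e3 : ∀ {N : ℕ} (c : ℝ) (J : Couplings N) (y : Spins N),
      ∑ i, ∑ j, J i j * (c * (y i * y j)) = c * ∑ i, ∑ j, J i j * (y i * y j) := by
    intro N c J y
    simp only [Finset.mul_sum]
    exact Finset.sum_congr rfl fun i _ => Finset.sum_congr rfl fun j _ => by ring
  rw [energy, fullExpo, fullExpo, splitBase, e1, e2]
  simp only [Fintype.sum_sum_type, Fintype.sum_prod_type, shift, splitVar, splitRate, splitObs,
    Pi.zero_apply, zero_add, mul_zero, add_zero, Real.sqrt_zero, Real.sqrt_one, zero_mul, one_mul,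
    Finset.sum_const_zero]
  rw [e3 _ (fun i j => ξ (.inr (.inl (i, j)))), e3 _ (fun i j => ξ (.inr (.inr (i, j))))]
  ring

lemma measurable_log_fullZ {N : ℕ} (β h lam : ℝ) (n : ℕ) : Measurable (fun J : Couplings N =>
    Real.log (∫ z in box n, Real.exp (fullExpo β h lam J z) ∂(spinMeasure N))) := by
  have : Measurable (fun r : Couplings N × Spins N => Real.exp (fullExpo β h lam r.1 r.2)) := by
    unfold fullExpo spinSq; fun_prop
  exact this.stronglyMeasurable.integral_prod_right'.measurable.log

lemma integral_gaussPi_curry {ι κ κ' : Type*} [Fintype ι] [DecidableEq ι] [Fintype κ] [Fintype κ']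
    {f : κ × κ' → ι} (hf : Function.Injective f) {F : (κ → κ' → ℝ) → ℝ} (hF : Measurable F) :
    ∫ ξ : ι → ℝ, F (fun i j => ξ (f (i, j))) ∂(gaussPi ι) =
      ∫ J, F J ∂(Measure.pi fun _ : κ => gaussPi κ') := by
  have h := measurePreserving_curry κ κ'
  rw [integral_gaussPi_comp hf (F := fun ξ : κ × κ' → ℝ => F fun i j => ξ (i, j))
    (hF.comp h.measurable), ← h.map_eq, integral_map h.measurable.aemeasurable
    hF.aestronglyMeasurable]

lemma integrable_gaussPi_curry {ι κ κ' : Type*} [Fintype ι] [DecidableEq ι] [Fintype κ]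
    [Fintype κ'] {f : κ × κ' → ι} (hf : Function.Injective f) {F : (κ → κ' → ℝ) → ℝ}
    (hF : Integrable F (Measure.pi fun _ : κ => gaussPi κ')) :
    Integrable (fun ξ : ι → ℝ => F (fun i j => ξ (f (i, j)))) (gaussPi ι) := by
  have h := (measurePreserving_curry κ κ').comp (measurePreserving_comp_injective hf)
  exact h.integrable_comp_of_integrable hF

lemma meanLog_box_superadditive (h₁ : 1 ≤ N₁) (h₂ : 1 ≤ N₂) (β h lam : ℝ) (x : OrderParameter)
    (n : ℕ) :
    meanLog (N := N₁) β h lam x (box n) 1 + meanLog (N := N₂) β h lam x (box n) 1 ≤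
      meanLog (N := N₁ + N₂) β h lam x (box n) 1 := by
  obtain ⟨R, H⟩ := exists_boundedModel (ν := spinMeasure (N₁ + N₂)) (isCompact_box n)
    (measurableSet_box n) (continuous_splitObs β) (continuous_splitBase β h lam)
    (continuous_splitDrift β)
  have key := H.quenched_mono noiseProfile_split (fun z => rfl) (sum_splitRate_nonpos h₁ h₂ β)
  simp only [energy_split_one, energy_split_zero, Real.exp_add] at key
  have hm : ∀ {N : ℕ} (J : Couplings N), Measurable (fun z => Real.exp (fullExpo β h lam J z)) := by
    intro N J
    unfold fullExpo spinSq; fun_prop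
  have hpos : ∀ {N : ℕ} (J : Couplings N),
      0 < ∫ z in box n, Real.exp (fullExpo β h lam J z) ∂(spinMeasure N) := by
    intro N J
    have := (cutFamily_box (N := N) (β := β) (h := h) (lam := lam) (x := x) n).cutZ_pos
      (⟨1, by simp⟩, J) 0
    simpa only [cutZ, boltzmann_eq, expo_one] using this
  simp only [setIntegral_box_split n (hm _) (hm _), Real.log_mul (hpos _).ne' (hpos _).ne'] at key
  have hi : ∀ N : ℕ, Integrable (fun J : Couplings N =>
      Real.log (∫ z in box n, Real.exp (fullExpo β h lam J z) ∂(spinMeasure N)))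
        (couplingMeasure N) := by
    intro N
    have h1 := integrable_cutLog_box (N := N) (β := β) (h := h) (lam := lam)
      (x := ⟨1, le_rfl, fun _ => 0, fun a => if a = 2 then 1 else 0, rfl, by simp, by simp, by simp,
        fun a ha => by interval_cases a <;> simp⟩) n (t := 1) (by simp)
    refine h1.congr (ae_of_all _ fun J => ?_)
    simp only [cutLog, nestLog, cutZ, boltzmann_eq, expo_one, tsub_zero]
    exact lme_const _ _
  have inj : Function.Injective (fun k : Fin (N₁ + N₂) × Fin (N₁ + N₂) =>
      (.inl k : SplitIndex N₁ N₂)) := Sum.inl_injective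
  have inj₁ : Function.Injective (fun k : Fin N₁ × Fin N₁ =>
      (.inr (.inl k) : SplitIndex N₁ N₂)) := Sum.inr_injective.comp Sum.inl_injective
  have inj₂ : Function.Injective (fun k : Fin N₂ × Fin N₂ =>
      (.inr (.inr k) : SplitIndex N₁ N₂)) := Sum.inr_injective.comp Sum.inr_injective
  rw [integral_add (integrable_gaussPi_curry inj₁ (hi N₁)) (integrable_gaussPi_curry inj₂ (hi N₂)),
    integral_gaussPi_curry inj₁ (measurable_log_fullZ β h lam n),
    integral_gaussPi_curry inj₂ (measurable_log_fullZ β h lam n),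
    integral_gaussPi_curry inj (measurable_log_fullZ β h lam n)] at key
  simp only [meanLog_box_one]
  exact key

end Superadditivity

section Limit
variable {β h lam : ℝ} {x : OrderParameter}

lemma pressure_superadditive (hβ : β ≠ 0) (hx : 0 < 1 - lam + β ^ 2 * x.gap) {N₁ N₂ : ℕ}
    (h₁ : 1 ≤ N₁) (h₂ : 1 ≤ N₂) :
    N₁ * pressure β h lam N₁ + N₂ * pressure β h lam N₂ ≤
      ((N₁ + N₂ : ℕ) : ℝ) * pressure β h lam (N₁ + N₂) := by
  have e : ∀ {N : ℕ}, 1 ≤ N →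
      N * pressure β h lam N = meanLog (N := N) β h lam x Set.univ 1 := fun {N} hN => by
    have hN0 : (N : ℝ) ≠ 0 := by positivity
    rw [pressure_eq (x := x)]
    field_simp
  have h₁₂ : 1 ≤ N₁ + N₂ := by omega
  rw [e h₁, e h₂, e h₁₂]
  have ht : (1 : ℝ) ∈ Set.Icc (0 : ℝ) 1 := by simp
  exact le_of_tendsto_of_tendsto' ((tendsto_meanLog hβ h₁ hx ht).add (tendsto_meanLog hβ h₂ hx ht))
    (tendsto_meanLog hβ h₁₂ hx ht) fun n => meanLog_box_superadditive h₁ h₂ β h lam x n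

lemma exists_tendsto_pressure (hx : 0 < 1 - lam + β ^ 2 * x.gap) :
    ∃ A, Tendsto (fun N : ℕ => pressure β h lam N) atTop (𝓝 A) := by
  obtain ⟨φ₀, h0⟩ := exists_phi_zero (h := h) hx
  by_cases hβ : β = 0
  · subst hβ
    refine ⟨φ₀, tendsto_const_nhds.congr' ?_⟩
    filter_upwards [eventually_ge_atTop 1] with N hN
    rw [pressure_sum_rule (x := x) hN hx, h0 N hN]
    simp [squareTerm, errorTerm]
  · let u : ℕ → ℝ := fun N => -(N * pressure β h lam N)
    have hu : Subadditive u := by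
      intro m n
      rcases Nat.eq_zero_or_pos m with rfl | hm
      · simp [u]
      rcases Nat.eq_zero_or_pos n with rfl | hn
      · simp [u]
      have := pressure_superadditive (h := h) hβ hx hm hn
      simp only [u]
      linarith
    have hb : BddBelow (Set.range fun n => u n / n) := by
      refine ⟨min 0 (-(φ₀ + squareTerm β x)), ?_⟩
      rintro _ ⟨n, rfl⟩
      rcases Nat.eq_zero_or_pos n with rfl | hn
      · simp
      · have hn0 : (n : ℝ) ≠ 0 := by positivity
        have h1 := pressure_le (N := n) (h := h) hx hn
        rw [h0 n hn] at h1
        have e : u n / n = -pressure β h lam n := by simp only [u]; field_simp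
        beta_reduce
        rw [e]
        exact (min_le_right _ _).trans (by linarith)
    refine ⟨-hu.lim, (hu.tendsto_lim hb).neg.congr' ?_⟩
    filter_upwards [eventually_ge_atTop 1] with n hn
    have hn0 : (n : ℝ) ≠ 0 := by positivity
    simp only [u]
    field_simp

end Limit

end GaussianSpinGlass
end

theorem theorem7 (β h lam : ℝ) (x : GaussianSpinGlass.OrderParameter)
    (hx : 0 < 1 - lam + β ^ 2 * x.gap) :
    (∀ N : ℕ, 1 ≤ N →
      GaussianSpinGlass.IntegralsConverge β h lam x N ∧
      GaussianSpinGlass.pressure β h lam N =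
        GaussianSpinGlass.phi β h lam x N 0 + GaussianSpinGlass.squareTerm β x
          - GaussianSpinGlass.errorTerm β h lam x N) ∧
    ∃ A φ₀ R : ℝ,
      Tendsto (fun N : ℕ => GaussianSpinGlass.pressure β h lam N) atTop (𝓝 A) ∧
      (∀ N : ℕ, 1 ≤ N → GaussianSpinGlass.phi β h lam x N 0 = φ₀) ∧
      Tendsto (fun N : ℕ => GaussianSpinGlass.errorTerm β h lam x N) atTop (𝓝 R) ∧
      A = φ₀ + GaussianSpinGlass.squareTerm β x - R ∧
      A ≤ φ₀ + GaussianSpinGlass.squareTerm β x := by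
  refine ⟨fun N hN => ⟨GaussianSpinGlass.integralsConverge hN hx,
    GaussianSpinGlass.pressure_sum_rule hN hx⟩, ?_⟩
  obtain ⟨A, hA⟩ := GaussianSpinGlass.exists_tendsto_pressure (h := h) hx
  obtain ⟨φ₀, h0⟩ := GaussianSpinGlass.exists_phi_zero (h := h) hx
  have hR : Tendsto (fun N : ℕ => GaussianSpinGlass.errorTerm β h lam x N) atTop
      (𝓝 (φ₀ + GaussianSpinGlass.squareTerm β x - A)) := by
    refine (tendsto_const_nhds.sub hA).congr' ?_
    filter_upwards [eventually_ge_atTop 1] with N hN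
    rw [GaussianSpinGlass.pressure_sum_rule (x := x) hN hx, h0 N hN]
    ring
  have hnn : 0 ≤ φ₀ + GaussianSpinGlass.squareTerm β x - A :=
    ge_of_tendsto hR ((eventually_ge_atTop 1).mono fun N hN =>
      GaussianSpinGlass.errorTerm_nonneg hN)
  exact ⟨A, φ₀, _, hA, h0, hR, by ring, by linarith⟩
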